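/- Let $\lambda:\mathbf R\to(0,\infty)$ be smooth with $\lambda'(0)=0$ and $\lambda''(0)>0$, and let $M=\mathbf S^2\times\mathbf R$ carry the metric $dr^2+\lambda(r)^2 g_{\mathbf S^2}$, where $g_{\mathbf S^2}=d\phi^2+\sin^2\phi\,d\theta^2$ is the round metric. Then $\Gamma=\mathbf S^2\times\{0\}$ is a strictly stable minimal sphere, and in a neighborhood of $\Gamma$ there are, on each side of $\Gamma$, families of rotationally invariant noncompact minimal annuli limiting on $\Gamma$ and parametrized by $\mathbf S^2\times\mathbf S^1$, in the following sense. For $x\in\mathbf S^2$ let $(\phi,\theta)$ be spherical coordinates centered at $x$, so that $\phi$ is the angle to $x$. On the strip $[0,\pi]\times\mathbf R\ni(\phi,r)$ consider the degenerate metric $$ds^2=\lambda^2(r)\sin^2\phi\,\bigl(dr^2+\lambda^2(r)\,d\phi^2\bigr).$$ For $\epsilon>0$ and a side $e\in\{1,-1\}$, a unit speed geodesic $\sigma:(0,\infty)\to(0,\pi)\times\mathbf R$ of $ds^2$ is called spiraling from the side $e$ in the $\epsilon$-collar if $0<e\,r<\epsilon$ along $\sigma$, $e\,r(\sigma(t))\to\epsilon$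 as $t\to0^+$, and $\bigcap_{t>0}\overline{\sigma([t,\infty))}=[0,\pi]\times\{0\}$. Let $\mathcal A_{e,\epsilon}$ be the set of embedded minimal annuli $\Sigma\subset M$, diffeomorphic to $(0,\infty)\times\mathbf S^1$, which for some $x\in\mathbf S^2$ are the preimage of such a geodesic $\sigma$ under $(\phi,\theta,r)\mapsto(\phi,r)$ in spherical coordinates centered at $x$ (so $\Sigma$ is invariant under the rotations about $x$). Give $\mathcal A_{e,\epsilon}$ the quotient topology from the space of such pairs $(x,\sigma)$, with the topology of convergence of $x$ and of $C^1$ convergence of $\sigma$ on compact subsets of $(0,\infty)$. There is $\epsilon>0$ such that for each side $e\in\{1,-1\}$ there is a continuous map $F:\mathbf S^2\times\mathbf S^1\to\mathcal A_{e,\epsilon}$ such that, for each $x\in\mathbf S^2$, every $F(x,s)$ is the preimage of a spiraling geodesic in spherical coordinates centered at $x$, and $s\mapsto F(x,s)$ is injective (a circle worth of annuli for each $x$). -/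

import Mathlib

open Set Filter Topology MeasureTheory
open scoped ContDiff

noncomputable section

namespace Warped

/-- Euclidean 3-space. -/
abbrev E3 : Type := EuclideanSpace ℝ (Fin 3)

/-- The round unit sphere `S²`. -/
abbrev S2 : Type := Metric.sphere (0 : E3) 1

/-- The manifold `S² × ℝ`, as a subset of `ℝ³ × ℝ`; points are written `(y, r)`. -/
def M : Set (E3 × ℝ) := Metric.sphere (0 : E3) 1 ×ˢ univ

/-- The warped metric `dr² + λ(r)² g_{S²}` at the point `p`. A tangent vector of `S² × ℝ` at
`(y, r)` is a pair `(a, b)` with `a ⊥ y`, and `g_{S²}` is the restriction of the Euclidean inner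
product. -/
def metric (lam : ℝ → ℝ) (p v w : E3 × ℝ) : ℝ :=
  v.2 * w.2 + lam p.2 ^ 2 * inner ℝ v.1 w.1

/-! ### Minimal surfaces -/

/-- The area density of a parametrized surface `Φ` in the warped metric, at the parameter `z`. -/
def areaDensity (lam : ℝ → ℝ) (Φ : ℝ × ℝ → E3 × ℝ) (z : ℝ × ℝ) : ℝ :=
  Real.sqrt
    (metric lam (Φ z) (fderiv ℝ Φ z (1, 0)) (fderiv ℝ Φ z (1, 0)) *
        metric lam (Φ z) (fderiv ℝ Φ z (0, 1)) (fderiv ℝ Φ z (0, 1)) -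
      metric lam (Φ z) (fderiv ℝ Φ z (1, 0)) (fderiv ℝ Φ z (0, 1)) ^ 2)

/-- `Ψ τ` is a smooth variation of `Φ : U → S² × ℝ` through maps into `S² × ℝ`, fixed outside the
compact set `K ⊆ U`. -/
structure IsVariation (U K : Set (ℝ × ℝ)) (Φ : ℝ × ℝ → E3 × ℝ)
    (Ψ : ℝ → ℝ × ℝ → E3 × ℝ) : Prop where
  isCompact : IsCompact K
  subset : K ⊆ U
  smooth : ContDiffOn ℝ ∞ (fun q : ℝ × (ℝ × ℝ) => Ψ q.1 q.2) (univ ×ˢ U)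
  mem : ∀ τ, ∀ z ∈ U, Ψ τ z ∈ M
  zero : ∀ z ∈ U, Ψ 0 z = Φ z
  fixed : ∀ τ, ∀ z ∈ U \ K, Ψ τ z = Φ z

/-- `Φ` is a smooth minimal immersion of the open set `U` into `S² × ℝ` with the warped metric:
the first variation of area vanishes for every compactly supported variation. -/
structure IsMinimalImmersion (lam : ℝ → ℝ) (U : Set (ℝ × ℝ)) (Φ : ℝ × ℝ → E3 × ℝ) : Prop where
  smooth : ContDiffOn ℝ ∞ Φ U
  mem : ∀ z ∈ U, Φ z ∈ M
  immersion : ∀ z ∈ U, Function.Injective (fderiv ℝ Φ z)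
  critical : ∀ (K : Set (ℝ × ℝ)) (Ψ : ℝ → ℝ × ℝ → E3 × ℝ), IsVariation U K Φ Ψ →
    HasDerivAt (fun τ => ∫ z in K, areaDensity lam (Ψ τ) z) 0 0

/-- `S` is an embedded (noncompact, open) minimal annulus in `S² × ℝ`: the image of an embedding
of `(0, ∞) × S¹` which, read on the universal cover `(0, ∞) × ℝ`, is a minimal immersion. -/
def IsMinimalAnnulus (lam : ℝ → ℝ) (S : Set (E3 × ℝ)) : Prop :=
  ∃ (Φ : ℝ × ℝ → E3 × ℝ) (f : Ioi (0 : ℝ) × AddCircle (2 * Real.pi) → E3 × ℝ),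
    IsMinimalImmersion lam (Ioi 0 ×ˢ univ) Φ ∧ IsEmbedding f ∧ range f = S ∧
      ∀ (t : Ioi (0 : ℝ)) (θ : ℝ), f (t, (θ : AddCircle (2 * Real.pi))) = Φ (t, θ)

/-! ### The sphere `S² × {0}` -/

/-- The area of the normal graph `r = τ u(y)` over `S² × {0}` in the warped metric. -/
def graphArea (lam : ℝ → ℝ) (u : E3 → ℝ) (τ : ℝ) : ℝ :=
  ∫ y : S2, lam (τ * u y) * Real.sqrt (lam (τ * u y) ^ 2 +
      τ ^ 2 * (‖gradient u (y : E3)‖ ^ 2 - inner ℝ (gradient u (y : E3)) (y : E3) ^ 2))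
    ∂((volume : Measure E3).toSphere)

/-- `S² × {0}` is a strictly stable minimal sphere: for normal variations `u ∂_r` the first
variation of area vanishes and the second variation is bounded below by a positive multiple of
`∫ u²`. -/
def IsStrictlyStableMinimalSphere (lam : ℝ → ℝ) : Prop :=
  (∀ u : E3 → ℝ, ContDiff ℝ ∞ u → HasDerivAt (graphArea lam u) 0 0) ∧
  ∃ c > 0, ∀ u : E3 → ℝ, ContDiff ℝ ∞ u →
    c * ∫ y : S2, u y ^ 2 ∂((volume : Measure E3).toSphere) ≤ iteratedDeriv 2 (graphArea lam u) 0

/-! ### Geodesics of the degenerate metric on the strip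

Points of the strip `[0, π] × ℝ` are written `(φ, r)`; the metric is
`λ(r)² sin² φ (dr² + λ(r)² dφ²)`. -/

/-- The coefficient of `dr²`. -/
def coeffR (lam : ℝ → ℝ) (φ r : ℝ) : ℝ := lam r ^ 2 * Real.sin φ ^ 2

/-- The coefficient of `dφ²`. -/
def coeffPhi (lam : ℝ → ℝ) (φ r : ℝ) : ℝ := lam r ^ 4 * Real.sin φ ^ 2

/-- `t ↦ (φ t, r t)`, `t > 0`, is a unit speed geodesic in the interior of the strip: it solves the
Euler–Lagrange equations of the energy `½ (coeffPhi φ'² + coeffR r'²)`. -/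
structure IsStripGeodesic (lam : ℝ → ℝ) (φ r : ℝ → ℝ) : Prop where
  smooth_phi : ContDiffOn ℝ ∞ φ (Ioi 0)
  smooth_r : ContDiffOn ℝ ∞ r (Ioi 0)
  mem : ∀ t > 0, φ t ∈ Ioo 0 Real.pi
  unit_speed : ∀ t > 0,
    coeffPhi lam (φ t) (r t) * deriv φ t ^ 2 + coeffR lam (φ t) (r t) * deriv r t ^ 2 = 1
  eq_phi : ∀ t > 0,
    deriv (fun s => coeffPhi lam (φ s) (r s) * deriv φ s) t =
      1 / 2 * (deriv (fun a => coeffPhi lam a (r t)) (φ t) * deriv φ t ^ 2 +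
        deriv (fun a => coeffR lam a (r t)) (φ t) * deriv r t ^ 2)
  eq_r : ∀ t > 0,
    deriv (fun s => coeffR lam (φ s) (r s) * deriv r s) t =
      1 / 2 * (deriv (fun b => coeffPhi lam (φ t) b) (r t) * deriv φ t ^ 2 +
        deriv (fun b => coeffR lam (φ t) b) (r t) * deriv r t ^ 2)

/-- `σ = (φ, r)` is a geodesic spiraling into `{r = 0}` from the side `e` (`e = 1` is the side
`r > 0` and `e = -1` the side `r < 0`) inside the collar `0 < e r < ε`: it enters the collar
through `e r = ε`, never leaves it, and its limit set for `t → ∞` is the whole segment `{r = 0}` of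
the strip. -/
structure IsSpiralingGeodesic (lam : ℝ → ℝ) (e ε : ℝ) (σ : ℝ → ℝ × ℝ) : Prop where
  geodesic : IsStripGeodesic lam (fun t => (σ t).1) (fun t => (σ t).2)
  collar : ∀ t > 0, 0 < e * (σ t).2 ∧ e * (σ t).2 < ε
  enters : Tendsto (fun t => e * (σ t).2) (𝓝[>] 0) (𝓝 ε)
  limitSet : ⋂ t ∈ Ioi (0 : ℝ), closure (σ '' Ici t) = Icc 0 Real.pi ×ˢ {0}

/-- The preimage in `S² × ℝ` of the curve `σ(t)`, `t > 0`, under `(φ, θ, r) ↦ (φ, r)`, for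
spherical coordinates `(φ, θ)` centered at `x`; here `φ` is the angle between `x` and `y`. It is
invariant under the rotations about `x`. -/
def preimage (x : S2) (σ : ℝ → ℝ × ℝ) : Set (E3 × ℝ) :=
  {p | p ∈ M ∧ (InnerProductGeometry.angle (x : E3) p.1, p.2) ∈ σ '' Ioi 0}

/-! ### The space of spiraling annuli -/

/-- Pairs of a center `x ∈ S²` and a spiraling geodesic `σ`. -/
def Generator (lam : ℝ → ℝ) (e ε : ℝ) : Type :=
  {q : S2 × (ℝ → ℝ × ℝ) // IsSpiralingGeodesic lam e ε q.2 ∧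
    IsMinimalAnnulus lam (preimage q.1 q.2)}

/-- Convergence of the centers, and `C¹` convergence of the geodesics on compact subsets of
`(0, ∞)` (by the geodesic equation this is the same as smooth convergence). -/
instance (lam : ℝ → ℝ) (e ε : ℝ) : TopologicalSpace (Generator lam e ε) :=
  TopologicalSpace.induced
    (fun q => (q.1.1, UniformOnFun.ofFun {K : Set (Ioi (0 : ℝ)) | IsCompact K}
      (fun t : Ioi (0 : ℝ) => (q.1.2 t, deriv q.1.2 t))))
    inferInstance

/-- The set of minimal annuli which are preimages of geodesics spiraling into `{r = 0}` from the
side `e`, in the collar of width `ε`. -/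
def SpiralingAnnulus (lam : ℝ → ℝ) (e ε : ℝ) : Type :=
  {S : Set (E3 × ℝ) // ∃ q : Generator lam e ε, S = preimage q.1.1 q.1.2}

/-- The annulus generated by a center and a geodesic. -/
def Generator.annulus {lam : ℝ → ℝ} {e ε : ℝ} (q : Generator lam e ε) :
    SpiralingAnnulus lam e ε :=
  ⟨preimage q.1.1 q.1.2, q, rfl⟩

/-- The quotient topology: annuli are close if they are generated by close data. -/
instance (lam : ℝ → ℝ) (e ε : ℝ) : TopologicalSpace (SpiralingAnnulus lam e ε) :=
  TopologicalSpace.coinduced Generator.annulus inferInstance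

end Warped

end

/-! A surface of revolution over a unit speed geodesic of the strip is minimal, so the theorem is
about geodesics near the segment `r = 0`. If `α` is the angle at which such a geodesic descends, put
`P = sin φ · sin α` and `(cos φ, sin φ · cos α) = √(1 - P²) · (cos θ, sin θ)`. For constant `λ` the
quantity `P` is the Clairaut integral and `θ` is the phase of the oscillation of `φ` between the
poles. In the time `t` with `ds = λ² sin² φ dt`, writing `width = sin φ`, the geodesic equations
become `θ' = width + 2λ' cos θ sin θ · P`, `r' = -λ P`, `P' = -2λ' (1 - P²) sin² θ`. Since `0` is a
nondegenerate minimum of `λ`, `λ' > 0` on one side of it, and `P` is used up while the curve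
descends. The spiraling geodesics form the stable set of `r = P = 0`. The field is only Lipschitz
there, because `width` vanishes at the poles, so the stable set is found by shooting rather than by
a stable manifold theorem.

Existence: start at `r = ε` with a given angle `θ₀` and vary `P`. If `P` is large compared with `r`,
the orbit crosses `r = 0` (`exists_neg_of_steep`); if `P` is below `threshold r`, the orbit loses
its momentum first (`pos_of_lt_threshold`). Both conditions are open and they exclude each other, so
by connectedness some momentum satisfies neither (`exists_stable`). Along such a stable orbit `r`
and `P` tend to `0` and `θ` tends to `∞`; the delicate point is that `θ` cannot stall at a pole
(`not_tendsto_of_sin_eq_zero`). As `cos φ = √(1 - P²) cos θ`, the limit set is the whole segment.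

Uniqueness: as functions of the angle, orbits are ordered by a competitive comparison principle
(`comparison`). The less steep of two stable orbits with the same `θ₀` stays higher, and the gap
cannot close in the limit (`not_lt_of_theta_eq`), although both heights tend to `0`. Hence the
stable momentum is a function of `θ₀`, continuous and `2π`-periodic, and there is a circle of
spiraling geodesics. The image of a profile determines its tangents, hence `P` and `θ` modulo `2π`
on entry (`cos_sin_eq_of_image_eq`), so the annuli with a common center are distinct.

Minimality follows by writing the first variation density as a divergence (`variation_density_eq`,
`critical_revolution`); strict stability of the sphere is a direct computation of the second
variation. The side `e = -1` is the side `e = 1` for `λ(-r)`. -/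

namespace Warped

/-! ### Flows of bounded Lipschitz vector fields -/

section Flow

open scoped NNReal

variable {E : Type*} [NormedAddCommGroup E] [NormedSpace ℝ E]

/-- A bounded Lipschitz vector field has a global integral curve through every point. -/
theorem exists_integralCurve_of_lipschitz [CompleteSpace E] {V : E → E} {K L : ℝ≥0}
    (hV : LipschitzWith K V) (hL : ∀ x, ‖V x‖ ≤ L) (x : E) :
    ∃ y : ℝ → E, y 0 = x ∧ ∀ t, HasDerivAt y (V (y t)) t := by
  have key : ∀ n : ℕ, ∃ y : ℝ → E, y 0 = x ∧
      ∀ t ∈ Ioo (-((n : ℝ) + 1)) ((n : ℝ) + 1), HasDerivAt y (V (y t)) t := by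
    intro n
    have h0 : (0 : ℝ) ∈ Icc (-((n : ℝ) + 1)) ((n : ℝ) + 1) :=
      ⟨by linarith [n.cast_nonneg (α := ℝ)], by positivity⟩
    have hpl : IsPicardLindelof (fun _ => V) (⟨0, h0⟩ : Icc (-((n : ℝ) + 1)) ((n : ℝ) + 1)) x
        (L * (n + 1)) 0 L K :=
      IsPicardLindelof.of_time_independent (fun z _ => hL z) hV.lipschitzOnWith (by simp)
    obtain ⟨y, hy0, hy⟩ := hpl.exists_eq_forall_mem_Icc_hasDerivWithinAt₀
    exact ⟨y, hy0, fun t ht => (hy t (Ioo_subset_Icc_self ht)).hasDerivAt (Icc_mem_nhds ht.1 ht.2)⟩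
  choose y hy0 hy using key
  have agree : ∀ m n : ℕ, m ≤ n → EqOn (y m) (y n) (Ioo (-((m : ℝ) + 1)) ((m : ℝ) + 1)) := by
    intro m n hmn
    have hc : (m : ℝ) ≤ n := by exact_mod_cast hmn
    refine ODE_solution_unique_of_mem_Ioo (v := fun _ => V) (s := fun _ => univ) (K := K)
      (t₀ := 0) (fun _ _ => hV.lipschitzOnWith) ?_ (fun t ht => ⟨hy m t ht, trivial⟩)
      (fun t ht => ⟨hy n t ⟨by linarith [ht.1], by linarith [ht.2]⟩, trivial⟩) (by rw [hy0, hy0])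
    exact ⟨by linarith [m.cast_nonneg (α := ℝ)], by positivity⟩
  -- At time `t` the solution of index `⌈|t|⌉₊` is read off; the `+ 1` in its interval keeps `t` in
  -- the interior.
  refine ⟨fun t => y ⌈|t|⌉₊ t, by simp [hy0], fun t => ?_⟩
  have hmem : ∀ u : ℝ, u ∈ Ioo (-((⌈|u|⌉₊ : ℝ) + 1)) ((⌈|u|⌉₊ : ℝ) + 1) := by
    intro u
    have h := Nat.le_ceil |u|
    constructor <;> [linarith [neg_abs_le u]; linarith [le_abs_self u]]
  have hev : (fun u => y ⌈|u|⌉₊ u) =ᶠ[𝓝 t] y (⌈|t|⌉₊) := by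
    filter_upwards [isOpen_Ioo.mem_nhds (hmem t)] with u hu
    rcases le_total ⌈|u|⌉₊ ⌈|t|⌉₊ with h | h
    · exact agree _ _ h (hmem u)
    · exact (agree _ _ h hu).symm
  exact (hy _ t (hmem t)).congr_of_eventuallyEq hev

/-- Integral curves of a Lipschitz field depend continuously on the initial value. -/
theorem dist_integralCurve_le {V : E → E} {K : ℝ≥0} (hV : LipschitzWith K V) {y z : ℝ → E}
    (hy : ∀ t, HasDerivAt y (V (y t)) t) (hz : ∀ t, HasDerivAt z (V (z t)) t) {t : ℝ} :
    dist (y t) (z t) ≤ dist (y 0) (z 0) * Real.exp (K * |t|) := by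
  rcases le_total 0 t with ht | ht
  · have := dist_le_of_trajectories_ODE (v := fun _ => V) (a := 0) (b := t) (fun _ => hV)
      (fun s _ => (hy s).continuousAt.continuousWithinAt) (fun s _ => (hy s).hasDerivWithinAt)
      (fun s _ => (hz s).continuousAt.continuousWithinAt) (fun s _ => (hz s).hasDerivWithinAt)
      le_rfl t ⟨ht, le_rfl⟩
    rwa [sub_zero, show K * t = K * |t| by rw [abs_of_nonneg ht]] at this
  -- Backward time is forward time for `-V`, which has the same Lipschitz constant.
  · have hrev : ∀ {w : ℝ → E}, (∀ t, HasDerivAt w (V (w t)) t) →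
        ∀ s, HasDerivAt (fun s => w (-s)) (-V (w (-s))) s := by
      intro w hw s
      simpa [Function.comp_def] using (hw (-s)).scomp s (hasDerivAt_neg s)
    have := dist_le_of_trajectories_ODE (v := fun _ x => -V x) (a := 0) (b := -t) (fun _ => hV.neg)
      (fun s _ => (hrev hy s).continuousAt.continuousWithinAt)
      (fun s _ => (hrev hy s).hasDerivWithinAt)
      (fun s _ => (hrev hz s).continuousAt.continuousWithinAt)
      (fun s _ => (hrev hz s).hasDerivWithinAt)
      le_rfl (-t) ⟨by linarith, le_rfl⟩
    simpa [abs_of_nonpos ht] using this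

/-- The flow of a bounded Lipschitz vector field. -/
theorem exists_flow_of_lipschitz [CompleteSpace E] {V : E → E} {K L : ℝ≥0}
    (hV : LipschitzWith K V) (hL : ∀ x, ‖V x‖ ≤ L) :
    ∃ Y : E → ℝ → E, (∀ x, Y x 0 = x) ∧ (∀ x t, HasDerivAt (Y x) (V (Y x t)) t) ∧
      Continuous fun q : E × ℝ => Y q.1 q.2 := by
  choose Y hY0 hY using exists_integralCurve_of_lipschitz hV hL
  refine ⟨Y, hY0, hY, continuous_iff_continuousAt.2 fun q => ?_⟩
  rw [ContinuousAt, tendsto_iff_dist_tendsto_zero]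
  have hb : ∀ p : E × ℝ, dist (Y p.1 p.2) (Y q.1 q.2) ≤
      dist p.1 q.1 * Real.exp (K * |p.2|) + dist (Y q.1 p.2) (Y q.1 q.2) := by
    intro p
    refine (dist_triangle _ (Y q.1 p.2) _).trans ?_
    gcongr
    simpa [hY0] using dist_integralCurve_le hV (hY p.1) (hY q.1) (t := p.2)
  refine squeeze_zero (fun _ => dist_nonneg) hb ?_
  have hc : Continuous (Y q.1) := continuous_iff_continuousAt.2 fun t => (hY q.1 t).continuousAt
  have : Continuous fun p : E × ℝ =>
      dist p.1 q.1 * Real.exp (K * |p.2|) + dist (Y q.1 p.2) (Y q.1 q.2) := by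
    fun_prop
  simpa using this.tendsto q

/-- Integral curves in an open set on which the field is smooth are smooth. -/
theorem contDiffOn_of_hasDerivAt {W : E → E} {U : Set E} {J : Set ℝ} (hJ : IsOpen J)
    (hW : ContDiffOn ℝ ∞ W U) {w : ℝ → E} (hU : ∀ t ∈ J, w t ∈ U)
    (hw : ∀ t ∈ J, HasDerivAt w (W (w t)) t) : ContDiffOn ℝ ∞ w J := by
  rw [contDiffOn_infty]
  intro n
  induction n with
  | zero =>
    exact contDiffOn_zero.2 fun t ht => (hw t ht).continuousAt.continuousWithinAt
  | succ n ih =>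
    rw [Nat.cast_succ, contDiffOn_succ_iff_deriv_of_isOpen hJ]
    -- Bootstrap: `w' = W ∘ w` is as smooth as `w`.
    refine ⟨fun t ht => (hw t ht).differentiableAt.differentiableWithinAt, by simp, ?_⟩
    refine ((hW.of_le (by exact_mod_cast le_top)).comp ih hU).congr fun t ht => (hw t ht).deriv

end Flow

/-! ### Bounded Lipschitz functions -/

/-- Bounded Lipschitz real functions. -/
def BddLip {E : Type*} [PseudoMetricSpace E] (f : E → ℝ) : Prop :=
  ∃ C : ℝ, (∀ x, |f x| ≤ C) ∧ ∀ x y, |f x - f y| ≤ C * dist x y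

namespace BddLip

variable {E : Type*} [PseudoMetricSpace E] {f g : E → ℝ}

theorem const (c : ℝ) : BddLip fun _ : E => c :=
  ⟨|c|, fun _ => le_rfl, fun x y => by simpa using mul_nonneg (abs_nonneg c) dist_nonneg⟩

theorem add (hf : BddLip f) (hg : BddLip g) : BddLip fun x => f x + g x := by
  obtain ⟨A, hA, hA'⟩ := hf
  obtain ⟨B, hB, hB'⟩ := hg
  refine ⟨A + B, fun x => (abs_add_le _ _).trans (add_le_add (hA x) (hB x)), fun x y => ?_⟩
  calc |f x + g x - (f y + g y)| = |(f x - f y) + (g x - g y)| := by ring_nf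
    _ ≤ |f x - f y| + |g x - g y| := abs_add_le _ _
    _ ≤ A * dist x y + B * dist x y := add_le_add (hA' x y) (hB' x y)
    _ = (A + B) * dist x y := by ring

theorem mul (hf : BddLip f) (hg : BddLip g) : BddLip fun x => f x * g x := by
  obtain ⟨A, hA, hA'⟩ := hf
  obtain ⟨B, hB, hB'⟩ := hg
  rcases isEmpty_or_nonempty E with hE | ⟨⟨x₀⟩⟩
  · exact ⟨0, fun x => hE.elim x, fun x => hE.elim x⟩
  have hA0 : 0 ≤ A := (abs_nonneg _).trans (hA x₀)
  have hB0 : 0 ≤ B := (abs_nonneg _).trans (hB x₀)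
  refine ⟨2 * (A * B), fun x => ?_, fun x y => ?_⟩
  · rw [abs_mul]
    nlinarith [mul_le_mul (hA x) (hB x) (abs_nonneg _) hA0, mul_nonneg hA0 hB0]
  · calc |f x * g x - f y * g y| = |f x * (g x - g y) + (f x - f y) * g y| := by ring_nf
      _ ≤ |f x * (g x - g y)| + |(f x - f y) * g y| := abs_add_le _ _
      _ = |f x| * |g x - g y| + |f x - f y| * |g y| := by rw [abs_mul, abs_mul]
      _ ≤ A * (B * dist x y) + A * dist x y * B := by
        gcongr
        exacts [hA x, hB' x y, hA' x y, hB y]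
      _ = 2 * (A * B) * dist x y := by ring

theorem neg (hf : BddLip f) : BddLip fun x => -f x := by
  simpa using (const (-1)).mul hf

/-- The square root is not Lipschitz at `0`, but `√(a² + b²)` is the modulus of `a + ib`, so the
triangle inequality gives a Lipschitz bound even where both functions vanish. -/
theorem sqrt_sq_add_sq (hf : BddLip f) (hg : BddLip g) :
    BddLip fun x => Real.sqrt (f x ^ 2 + g x ^ 2) := by
  obtain ⟨A, hA, hA'⟩ := hf
  obtain ⟨B, hB, hB'⟩ := hg
  have hle : ∀ a b : ℝ, Real.sqrt (a ^ 2 + b ^ 2) ≤ |a| + |b| := fun a b => by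
    refine Real.sqrt_le_iff.2 ⟨by positivity, ?_⟩
    nlinarith [sq_abs a, sq_abs b, mul_nonneg (abs_nonneg a) (abs_nonneg b)]
  have htri : ∀ a b c d : ℝ, Real.sqrt (a ^ 2 + b ^ 2) ≤
      Real.sqrt (c ^ 2 + d ^ 2) + (|a - c| + |b - d|) := fun a b c d => by
    have h : ∀ x y : ℝ, Real.sqrt (x ^ 2 + y ^ 2) = ‖(⟨x, y⟩ : ℂ)‖ := fun x y => by
      rw [Complex.norm_def, Complex.normSq_mk]; ring_nf
    have h2 : (⟨a, b⟩ : ℂ) = ⟨c, d⟩ + ⟨a - c, b - d⟩ := by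
      apply Complex.ext <;> simp
    calc Real.sqrt (a ^ 2 + b ^ 2) = ‖(⟨c, d⟩ + ⟨a - c, b - d⟩ : ℂ)‖ := by rw [h, h2]
      _ ≤ ‖(⟨c, d⟩ : ℂ)‖ + ‖(⟨a - c, b - d⟩ : ℂ)‖ := norm_add_le _ _
      _ ≤ _ := by rw [← h, ← h]; gcongr; exact hle _ _
  refine ⟨A + B, fun x => ?_, fun x y => ?_⟩
  · rw [abs_of_nonneg (Real.sqrt_nonneg _)]
    exact (hle _ _).trans (add_le_add (hA x) (hB x))
  · have h1 := htri (f x) (g x) (f y) (g y)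
    have h2 := htri (f y) (g y) (f x) (g x)
    rw [abs_sub_comm (f y), abs_sub_comm (g y)] at h2
    have h3 := hA' x y
    have h4 := hB' x y
    rw [abs_le]
    constructor <;> nlinarith

theorem comp_lipschitz {F : Type*} [PseudoMetricSpace F] {h : F → E} (hf : BddLip f)
    (hh : LipschitzWith 1 h) : BddLip fun x => f (h x) := by
  obtain ⟨A, hA, hA'⟩ := hf
  refine ⟨A, fun x => hA _, fun x y => (hA' _ _).trans ?_⟩
  have hA0 : 0 ≤ A := (abs_nonneg _).trans (hA (h x))
  have := hh.dist_le_mul x y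
  rw [NNReal.coe_one, one_mul] at this
  gcongr

theorem sin : BddLip Real.sin :=
  ⟨1, Real.abs_sin_le_one, fun x y => by
    simpa [Real.dist_eq] using Real.lipschitzWith_sin.dist_le_mul x y⟩

theorem cos : BddLip Real.cos :=
  ⟨1, Real.abs_cos_le_one, fun x y => by
    simpa [Real.dist_eq] using Real.lipschitzWith_cos.dist_le_mul x y⟩

theorem exists_lipschitzWith (hf : BddLip f) :
    ∃ K : NNReal, LipschitzWith K f ∧ ∀ x, |f x| ≤ K := by
  obtain ⟨A, hA, hA'⟩ := hf
  refine ⟨A.toNNReal, LipschitzWith.of_dist_le_mul fun x y => ?_, fun x => ?_⟩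
  · have hA0 : 0 ≤ A := (abs_nonneg _).trans (hA x)
    rw [Real.coe_toNNReal _ hA0, Real.dist_eq]
    exact hA' x y
  · exact (hA x).trans (Real.le_coe_toNNReal A)

end BddLip

/-! ### Monotonicity from derivative bounds on half-lines -/

theorem monotoneOn_of_hasDerivAt {f f' : ℝ → ℝ} {s : Set ℝ} (hs : Convex ℝ s)
    (h : ∀ t ∈ s, HasDerivAt f (f' t) t) (h' : ∀ t ∈ s, 0 ≤ f' t) : MonotoneOn f s :=
  monotoneOn_of_deriv_nonneg hs (fun t ht => (h t ht).continuousAt.continuousWithinAt)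
    (fun t ht => (h t (interior_subset ht)).differentiableAt.differentiableWithinAt)
    (fun t ht => by rw [(h t (interior_subset ht)).deriv]; exact h' t (interior_subset ht))

theorem antitoneOn_of_hasDerivAt {f f' : ℝ → ℝ} {s : Set ℝ} (hs : Convex ℝ s)
    (h : ∀ t ∈ s, HasDerivAt f (f' t) t) (h' : ∀ t ∈ s, f' t ≤ 0) : AntitoneOn f s := by
  have := monotoneOn_of_hasDerivAt (f := fun t => -f t) hs (fun t ht => (h t ht).neg)
    (fun t ht => by linarith [h' t ht])
  exact fun x hx y hy hxy => by simpa using this hx hy hxy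

theorem exists_lt_of_deriv_le_neg {f f' : ℝ → ℝ} {t₁ k : ℝ} (hk : 0 < k)
    (h : ∀ t ≥ t₁, HasDerivAt f (f' t) t) (h' : ∀ t ≥ t₁, f' t ≤ -k) (m : ℝ) :
    ∃ t ≥ t₁, f t < m := by
  have hanti : AntitoneOn (fun t => f t + k * t) (Ici t₁) :=
    antitoneOn_of_hasDerivAt (convex_Ici _)
      (fun t ht => (h t ht).add ((hasDerivAt_id t).const_mul k))
      (fun t ht => by linarith [h' t ht])
  set T := max t₁ (t₁ + (f t₁ - m) / k + 1) with hT
  have hT1 : t₁ ≤ T := le_max_left _ _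
  have hT2 : t₁ + (f t₁ - m) / k + 1 ≤ T := le_max_right _ _
  have h3 : f T + k * T ≤ f t₁ + k * t₁ := hanti self_mem_Ici hT1 hT1
  refine ⟨T, hT1, ?_⟩
  have h4 : k * (t₁ + (f t₁ - m) / k + 1) ≤ k * T := by gcongr
  have h5 : k * (t₁ + (f t₁ - m) / k + 1) = k * t₁ + (f t₁ - m) + k := by field_simp
  linarith

theorem exists_gt_of_le_deriv {f f' : ℝ → ℝ} {t₁ k : ℝ} (hk : 0 < k)
    (h : ∀ t ≥ t₁, HasDerivAt f (f' t) t) (h' : ∀ t ≥ t₁, k ≤ f' t) (m : ℝ) :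
    ∃ t ≥ t₁, m < f t := by
  obtain ⟨t, ht, h1⟩ := exists_lt_of_deriv_le_neg (f := fun t => -f t) hk
    (fun t ht => (h t ht).neg) (fun t ht => by linarith [h' t ht]) (-m)
  exact ⟨t, ht, by linarith⟩

/-! ### The width function -/

/-- `sin φ` in terms of the angle `θ` and the vertical momentum `P`, where
`cos φ = √(1 - P²) cos θ`. -/
noncomputable def width (θ P : ℝ) : ℝ := Real.sqrt (Real.sin θ ^ 2 + (P * Real.cos θ) ^ 2)

theorem width_sq (θ P : ℝ) : width θ P ^ 2 = Real.sin θ ^ 2 + (P * Real.cos θ) ^ 2 :=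
  Real.sq_sqrt (by positivity)

theorem width_nonneg (θ P : ℝ) : 0 ≤ width θ P := Real.sqrt_nonneg _

theorem abs_sin_le_width (θ P : ℝ) : |Real.sin θ| ≤ width θ P :=
  Real.abs_le_sqrt (by nlinarith [sq_nonneg (P * Real.cos θ)])

/-- Indeed `width² - P² = (1 - P²) sin² θ`. -/
theorem le_width {θ P : ℝ} (h0 : 0 ≤ P) (h1 : P ≤ 1) : P ≤ width θ P := by
  refine Real.le_sqrt_of_sq_le ?_
  have := Real.sin_sq_add_cos_sq θ
  nlinarith [mul_nonneg (sq_nonneg (Real.sin θ)) (by nlinarith : (0 : ℝ) ≤ 1 - P ^ 2)]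

theorem width_le_one {θ P : ℝ} (h0 : 0 ≤ P) (h1 : P ≤ 1) : width θ P ≤ 1 := by
  refine Real.sqrt_le_one.2 ?_
  have := Real.sin_sq_add_cos_sq θ
  nlinarith [mul_nonneg (sq_nonneg (Real.cos θ)) (by nlinarith : (0 : ℝ) ≤ 1 - P ^ 2)]

/-- The arithmetic-geometric mean inequality for `sin θ` and `P cos θ` gives `width² / 2`, and
`width ≤ 1`. This lets the correction term in `dθ/dt` be absorbed by the main term. -/
theorem abs_cos_sin_mul_le {θ P : ℝ} (h0 : 0 ≤ P) (h1 : P ≤ 1) :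
    |Real.cos θ * Real.sin θ * P| ≤ width θ P / 2 := by
  have h2 := width_sq θ P
  have h3 := width_le_one (θ := θ) h0 h1
  have h4 := width_nonneg θ P
  rw [abs_le]
  constructor <;>
    nlinarith [sq_nonneg (Real.sin θ + P * Real.cos θ), sq_nonneg (Real.sin θ - P * Real.cos θ)]

/-- Clamping to `[0, m]`. -/
noncomputable def clamp (m x : ℝ) : ℝ := max 0 (min m x)

theorem clamp_nonneg (m x : ℝ) : 0 ≤ clamp m x := le_max_left _ _

theorem clamp_le {m : ℝ} (hm : 0 ≤ m) (x : ℝ) : clamp m x ≤ m := max_le hm (min_le_left _ _)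

theorem clamp_mem {m : ℝ} (hm : 0 ≤ m) (x : ℝ) : clamp m x ∈ Icc 0 m :=
  ⟨clamp_nonneg m x, clamp_le hm x⟩

theorem clamp_of_mem {m x : ℝ} (h : x ∈ Icc 0 m) : clamp m x = x := by
  rw [clamp, min_eq_right h.2, max_eq_right h.1]

theorem clamp_of_nonpos {m x : ℝ} (h : x ≤ 0) : clamp m x = 0 :=
  max_eq_left ((min_le_right _ _).trans h)

theorem clamp_le_self {m x : ℝ} (h : 0 ≤ x) : clamp m x ≤ x := max_le h (min_le_right _ _)

theorem le_clamp {m x : ℝ} (h : x ≤ m) : x ≤ clamp m x := by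
  rw [clamp, min_eq_right h]; exact le_max_right _ _

theorem abs_clamp_sub_le (m x y : ℝ) : |clamp m x - clamp m y| ≤ |x - y| := by
  unfold clamp
  rw [max_comm 0, max_comm 0, min_comm m, min_comm m]
  exact (abs_max_sub_max_le_abs _ _ _).trans (abs_min_sub_min_le_max x m y m |>.trans (by simp))

theorem BddLip.comp_clamp {f : ℝ → ℝ} {m C A : ℝ} (hm : 0 ≤ m) (hA : ∀ x ∈ Icc 0 m, |f x| ≤ A)
    (hC0 : 0 ≤ C) (hC : ∀ x ∈ Icc 0 m, ∀ y ∈ Icc 0 m, |f x - f y| ≤ C * |x - y|) :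
    BddLip fun x => f (clamp m x) := by
  have hA0 : 0 ≤ A := (abs_nonneg _).trans (hA 0 ⟨le_rfl, hm⟩)
  refine ⟨A + C, fun x => (hA _ (clamp_mem hm x)).trans (by linarith), fun x y => ?_⟩
  refine (hC _ (clamp_mem hm x) _ (clamp_mem hm y)).trans ?_
  rw [Real.dist_eq]
  nlinarith [abs_clamp_sub_le m x y, abs_nonneg (x - y), mul_nonneg hA0 (abs_nonneg (x - y)),
    mul_le_mul_of_nonneg_left (abs_clamp_sub_le m x y) hC0]

/-! ### Collars -/

/-- Constants controlling a warping function `l` on `[0, ε]`. -/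
structure Collar (l : ℝ → ℝ) where
  (ε a B b C K : ℝ)
  smooth : ContDiff ℝ ∞ l
  pos : ∀ r, 0 < l r
  ε_pos : 0 < ε
  a_pos : 0 < a
  b_pos : 0 < b
  K_pos : 0 < K
  deriv_zero : deriv l 0 = 0
  lower : ∀ r ∈ Icc 0 ε, a ≤ l r
  upper : ∀ r ∈ Icc 0 ε, l r ≤ B
  mono : ∀ s r, 0 ≤ s → s ≤ r → r ≤ ε → b * (r - s) ≤ deriv l r - deriv l s
  lip : ∀ s r, 0 ≤ s → s ≤ r → r ≤ ε → deriv l r - deriv l s ≤ C * (r - s)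
  small : C * ε ≤ 1 / 2
  cone : 2 * C ≤ K ^ 2 * a
  K_lt : K * ε < 1
  ε_le : ε ≤ B

/-- All sufficiently small collars are admissible. -/
theorem exists_collar {l : ℝ → ℝ} (hl : ContDiff ℝ ∞ l) (hpos : ∀ r, 0 < l r)
    (h1 : deriv l 0 = 0) (h2 : 0 < iteratedDeriv 2 l 0) :
    ∃ ε₀ > 0, ∀ ε, 0 < ε → ε ≤ ε₀ → ∃ c : Collar l, c.ε = ε := by
  set β := iteratedDeriv 2 l 0 with hβ
  have hd1 : ContDiff ℝ ∞ (deriv l) := by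
    simpa using hl.iterate_deriv 1
  have hd2 : Continuous (deriv (deriv l)) := by
    have := hl.iterate_deriv 2
    exact this.continuous
  have hβ' : deriv (deriv l) 0 = β := by rw [hβ, iteratedDeriv_succ, iteratedDeriv_one]
  have hev : ∀ᶠ r in 𝓝 (0 : ℝ), (β / 2 < deriv (deriv l) r ∧ deriv (deriv l) r < 2 * β) ∧
      (l 0 / 2 < l r ∧ l r < 2 * l 0) := by
    have hl0 := hpos 0
    refine ((hd2.tendsto 0).eventually (p := fun x => β / 2 < x ∧ x < 2 * β) ?_).and
      ((hl.continuous.tendsto 0).eventually (p := fun x => l 0 / 2 < x ∧ x < 2 * l 0) ?_)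
    · rw [hβ']; exact Ioo_mem_nhds (by linarith) (by linarith)
    · exact Ioo_mem_nhds (by linarith) (by linarith)
  obtain ⟨δ, hδ, hb⟩ := Metric.eventually_nhds_iff.1 hev
  -- Chosen for the field `cone`: with `C = 2β` and `a = l 0 / 2` it asks for `8β ≤ K² · l 0`.
  set K := Real.sqrt (8 * β / l 0) + 1 with hK
  have hK1 : 1 ≤ K := by rw [hK]; linarith [Real.sqrt_nonneg (8 * β / l 0)]
  have hK2 : 8 * β / l 0 ≤ K ^ 2 := by
    have := Real.sq_sqrt (show 0 ≤ 8 * β / l 0 by have := hpos 0; positivity)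
    rw [hK]; nlinarith [Real.sqrt_nonneg (8 * β / l 0)]
  have hl0 := hpos 0
  -- The four bounds give, in order: `ε ≤ B`; validity of the two-sided bounds on `[0, ε]`; `C ε ≤
  -- 1/2`, hence `mu ≤ 1`; and `K ε < 1`, which leaves room for steep momenta below `1`.
  refine ⟨min (l 0) (min (δ / 2) (min (1 / (4 * β)) (1 / (2 * K)))), by positivity,
    fun ε hε hle => ?_⟩
  have e0 : ε ≤ l 0 := hle.trans (min_le_left _ _)
  replace hle := hle.trans (min_le_right _ _)
  have e1 : ε ≤ δ / 2 := hle.trans (min_le_left _ _)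
  have e2 : ε ≤ 1 / (4 * β) := hle.trans ((min_le_right _ _).trans (min_le_left _ _))
  have e3 : ε ≤ 1 / (2 * K) := hle.trans ((min_le_right _ _).trans (min_le_right _ _))
  have hin : ∀ r ∈ Icc 0 ε, dist r 0 < δ := fun r hr => by
    rw [Real.dist_eq, sub_zero, abs_of_nonneg hr.1]; linarith [hr.2]
  have hdiff : Differentiable ℝ (deriv l) := hd1.differentiable (by simp)
  have hmv : ∀ s r, 0 ≤ s → s ≤ r → r ≤ ε → ∃ x ∈ Icc 0 ε,
      deriv l r - deriv l s = deriv (deriv l) x * (r - s) := by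
    intro s r hs hsr hr
    rcases hsr.eq_or_lt with rfl | hlt
    · exact ⟨s, ⟨hs, hr⟩, by simp⟩
    · obtain ⟨x, hx, hx'⟩ := exists_deriv_eq_slope (deriv l) hlt hdiff.continuous.continuousOn
        hdiff.differentiableOn
      refine ⟨x, ⟨hs.trans hx.1.le, hx.2.le.trans hr⟩, ?_⟩
      rw [hx', div_mul_cancel₀ _ (by linarith)]
  refine ⟨⟨ε, l 0 / 2, 2 * l 0, β / 2, 2 * β, K, hl, hpos, hε, by linarith [hpos 0], by linarith,
    by linarith, h1, fun r hr => (hb (hin r hr)).2.1.le, fun r hr => (hb (hin r hr)).2.2.le,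
    fun s r hs hsr hr => ?_, fun s r hs hsr hr => ?_, ?_, ?_, ?_, by linarith⟩, rfl⟩
  · obtain ⟨x, hx, h⟩ := hmv s r hs hsr hr
    rw [h]
    have := (hb (hin x hx)).1.1
    gcongr
  · obtain ⟨x, hx, h⟩ := hmv s r hs hsr hr
    rw [h]
    have := (hb (hin x hx)).1.2
    gcongr
  · rw [le_div_iff₀ (by positivity)] at e2
    linarith
  · rw [div_le_iff₀ (hpos 0)] at hK2
    linarith
  · rw [le_div_iff₀ (by positivity)] at e3
    linarith

namespace Collar

variable {l : ℝ → ℝ} (c : Collar l)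

/-- The warping function, frozen outside `[0, ε]`. -/
noncomputable def lam (r : ℝ) : ℝ := l (clamp c.ε r)

/-- Twice the derivative of the warping function, frozen outside `[0, ε]`. -/
noncomputable def mu (r : ℝ) : ℝ := 2 * deriv l (clamp c.ε r)

theorem lam_pos (r : ℝ) : 0 < c.lam r := c.pos _

theorem a_le_lam (r : ℝ) : c.a ≤ c.lam r := c.lower _ (clamp_mem c.ε_pos.le r)

theorem lam_le_B (r : ℝ) : c.lam r ≤ c.B := c.upper _ (clamp_mem c.ε_pos.le r)

theorem B_pos : 0 < c.B := (c.lam_pos 0).trans_le (c.lam_le_B 0)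

theorem b_le_C : c.b ≤ c.C := by
  have h1 := c.mono 0 c.ε le_rfl c.ε_pos.le le_rfl
  have h2 := c.lip 0 c.ε le_rfl c.ε_pos.le le_rfl
  have := c.ε_pos
  nlinarith

theorem C_pos : 0 < c.C := c.b_pos.trans_le c.b_le_C

theorem deriv_nonneg {r : ℝ} (hr : r ∈ Icc 0 c.ε) : 0 ≤ deriv l r := by
  have := c.mono 0 r le_rfl hr.1 hr.2
  rw [c.deriv_zero] at this
  nlinarith [c.b_pos, hr.1]

theorem deriv_le {r : ℝ} (hr : r ∈ Icc 0 c.ε) : deriv l r ≤ 1 / 2 := by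
  have := c.lip 0 r le_rfl hr.1 hr.2
  rw [c.deriv_zero] at this
  nlinarith [c.C_pos, hr.2, c.small]

theorem mu_nonneg (r : ℝ) : 0 ≤ c.mu r := by
  have := c.deriv_nonneg (clamp_mem c.ε_pos.le r)
  unfold mu; linarith

theorem mu_le_one (r : ℝ) : c.mu r ≤ 1 := by
  have := c.deriv_le (clamp_mem c.ε_pos.le r)
  unfold mu; linarith

theorem mu_le (r : ℝ) : c.mu r ≤ 2 * c.C * clamp c.ε r := by
  have hr := clamp_mem c.ε_pos.le r
  have := c.lip 0 _ le_rfl hr.1 hr.2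
  rw [c.deriv_zero] at this
  unfold mu; linarith

theorem le_mu (r : ℝ) : 2 * c.b * clamp c.ε r ≤ c.mu r := by
  have hr := clamp_mem c.ε_pos.le r
  have := c.mono 0 _ le_rfl hr.1 hr.2
  rw [c.deriv_zero] at this
  unfold mu; linarith

theorem mu_mono {r s : ℝ} (h : s ≤ r) : c.mu s ≤ c.mu r := by
  have hr := clamp_mem c.ε_pos.le r
  have hs := clamp_mem c.ε_pos.le s
  have hle : clamp c.ε s ≤ clamp c.ε r := max_le_max le_rfl (min_le_min le_rfl h)
  have := c.mono _ _ hs.1 hle hr.2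
  have h2 : 0 ≤ c.b * (clamp c.ε r - clamp c.ε s) :=
    mul_nonneg c.b_pos.le (by linarith)
  unfold mu; linarith

theorem abs_deriv_sub_le {r s : ℝ} (hr : r ∈ Icc 0 c.ε) (hs : s ∈ Icc 0 c.ε) :
    |deriv l r - deriv l s| ≤ c.C * |r - s| := by
  have key : ∀ r ∈ Icc 0 c.ε, ∀ s ∈ Icc 0 c.ε, s ≤ r →
      |deriv l r - deriv l s| ≤ c.C * |r - s| := by
    intro r hr s hs h
    have h1 := c.mono s r hs.1 h hr.2
    have h2 := c.lip s r hs.1 h hr.2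
    have h3 : 0 ≤ c.b * (r - s) := mul_nonneg c.b_pos.le (by linarith)
    rwa [abs_of_nonneg (by linarith), abs_of_nonneg (by linarith)]
  rcases le_total s r with h | h
  · exact key r hr s hs h
  · rw [abs_sub_comm, abs_sub_comm r]; exact key s hs r hr h

theorem abs_sub_le {r s : ℝ} (hr : r ∈ Icc 0 c.ε) (hs : s ∈ Icc 0 c.ε) :
    |l r - l s| ≤ 1 * |r - s| := by
  have := (convex_Icc (0 : ℝ) c.ε).norm_image_sub_le_of_norm_deriv_le (f := l) (C := 1)
    (fun x _ => c.smooth.differentiable (by simp) x)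
    (fun x hx => by
      rw [Real.norm_eq_abs, abs_of_nonneg (c.deriv_nonneg hx)]; linarith [c.deriv_le hx]) hs hr
  simpa using this

theorem bddLip_lam : BddLip c.lam :=
  BddLip.comp_clamp c.ε_pos.le (A := c.B)
    (fun x hx => by rw [abs_of_pos (c.pos x)]; exact c.upper x hx) zero_le_one
    (fun _ hx _ hy => c.abs_sub_le hx hy)

theorem bddLip_mu : BddLip c.mu :=
  (BddLip.const 2).mul (BddLip.comp_clamp c.ε_pos.le (A := 1 / 2)
    (fun x hx => by rw [abs_of_nonneg (c.deriv_nonneg hx)]; exact c.deriv_le hx) c.C_pos.le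
    (fun _ hx _ hy => c.abs_deriv_sub_le hx hy))

theorem abs_mu_sub_le (r s : ℝ) : |c.mu r - c.mu s| ≤ 2 * c.C * |r - s| := by
  have h := c.abs_deriv_sub_le (clamp_mem c.ε_pos.le r) (clamp_mem c.ε_pos.le s)
  have h2 := mul_le_mul_of_nonneg_left (abs_clamp_sub_le c.ε r s) c.C_pos.le
  rw [mu, mu, ← mul_sub, abs_mul, abs_two]
  linarith

theorem abs_lam_sub_le (r s : ℝ) : |c.lam r - c.lam s| ≤ |r - s| := by
  have h := c.abs_sub_le (clamp_mem c.ε_pos.le r) (clamp_mem c.ε_pos.le s)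
  have h2 := abs_clamp_sub_le c.ε r s
  rw [lam, lam]
  linarith

/-- The geodesic field of the strip, in the coordinates `(θ, r, P, s)` where `s` is arclength,
with `r` and `P` clamped. -/
noncomputable def field (y : ℝ × ℝ × ℝ × ℝ) : ℝ × ℝ × ℝ × ℝ :=
  (width y.1 (clamp 1 y.2.2.1) +
      c.mu y.2.1 * (Real.cos y.1 * Real.sin y.1 * clamp 1 y.2.2.1),
    -(c.lam y.2.1 * clamp 1 y.2.2.1),
    -(c.mu y.2.1 * ((1 - clamp 1 y.2.2.1 ^ 2) * Real.sin y.1 ^ 2)),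
    c.lam y.2.1 ^ 2 * width y.1 (clamp 1 y.2.2.1) ^ 2)

/-- The clamps make every factor bounded and Lipschitz, and `width`, the only factor with a square
root, is a modulus. A global continuous flow follows. -/
theorem exists_lipschitzWith_field :
    ∃ K L : NNReal, LipschitzWith K c.field ∧ ∀ y, ‖c.field y‖ ≤ L := by
  have p1 : LipschitzWith 1 (fun y : ℝ × ℝ × ℝ × ℝ => y.1) := LipschitzWith.prod_fst
  have p2 : LipschitzWith 1 (fun y : ℝ × ℝ × ℝ × ℝ => y.2.1) := by
    simpa [Function.comp_def] using LipschitzWith.prod_fst.comp (LipschitzWith.prod_snd (α := ℝ) (β := ℝ × ℝ × ℝ))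
  have p3 : LipschitzWith 1 (fun y : ℝ × ℝ × ℝ × ℝ => y.2.2.1) := by
    simpa [Function.comp_def] using LipschitzWith.prod_fst.comp ((LipschitzWith.prod_snd (α := ℝ) (β := ℝ × ℝ)).comp
      (LipschitzWith.prod_snd (α := ℝ) (β := ℝ × ℝ × ℝ)))
  have hs := BddLip.sin.comp_lipschitz p1
  have hc := BddLip.cos.comp_lipschitz p1
  have hl := c.bddLip_lam.comp_lipschitz p2
  have hm := c.bddLip_mu.comp_lipschitz p2
  have hP : BddLip (fun y : ℝ × ℝ × ℝ × ℝ => clamp 1 y.2.2.1) :=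
    (BddLip.comp_clamp (f := fun x => x) zero_le_one (A := 1)
      (fun x hx => by rw [abs_of_nonneg hx.1]; exact hx.2) zero_le_one
      (fun x _ y _ => by simp)).comp_lipschitz p3
  have hw : BddLip (fun y : ℝ × ℝ × ℝ × ℝ => width y.1 (clamp 1 y.2.2.1)) :=
    hs.sqrt_sq_add_sq (hP.mul hc)
  have f1 := hw.add (hm.mul ((hc.mul hs).mul hP))
  have f2 := (hl.mul hP).neg
  have f3 := (hm.mul (((BddLip.const 1).add (hP.mul hP).neg).mul (hs.mul hs))).neg
  have f4 := (hl.mul hl).mul (hw.mul hw)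
  obtain ⟨K1, k1, b1⟩ := f1.exists_lipschitzWith
  obtain ⟨K2, k2, b2⟩ := f2.exists_lipschitzWith
  obtain ⟨K3, k3, b3⟩ := f3.exists_lipschitzWith
  obtain ⟨K4, k4, b4⟩ := f4.exists_lipschitzWith
  have e : c.field = fun y => (width y.1 (clamp 1 y.2.2.1) +
      c.mu y.2.1 * (Real.cos y.1 * Real.sin y.1 * clamp 1 y.2.2.1),
      -(c.lam y.2.1 * clamp 1 y.2.2.1),
      -(c.mu y.2.1 * ((1 + -(clamp 1 y.2.2.1 * clamp 1 y.2.2.1)) *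
        (Real.sin y.1 * Real.sin y.1))),
      c.lam y.2.1 * c.lam y.2.1 *
        (width y.1 (clamp 1 y.2.2.1) * width y.1 (clamp 1 y.2.2.1))) := by
    funext y
    simp only [field, Prod.mk.injEq, true_and]
    constructor <;> ring
  rw [e]
  refine ⟨max K1 (max K2 (max K3 K4)), max K1 (max K2 (max K3 K4)),
    k1.prodMk (k2.prodMk (k3.prodMk k4)), fun y => ?_⟩
  simp only [Prod.norm_def, NNReal.coe_max, Real.norm_eq_abs]
  exact max_le_max (b1 y) (max_le_max (b2 y) (max_le_max (b3 y) (b4 y)))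

/-- Integral curves of the clamped geodesic field. -/
structure IsOrbit (θ r P S : ℝ → ℝ) : Prop where
  hθ : ∀ t, HasDerivAt θ (width (θ t) (clamp 1 (P t)) +
    c.mu (r t) * (Real.cos (θ t) * Real.sin (θ t) * clamp 1 (P t))) t
  hr : ∀ t, HasDerivAt r (-(c.lam (r t) * clamp 1 (P t))) t
  hP : ∀ t, HasDerivAt P (-(c.mu (r t) * ((1 - clamp 1 (P t) ^ 2) * Real.sin (θ t) ^ 2))) t
  hS : ∀ t, HasDerivAt S (c.lam (r t) ^ 2 * width (θ t) (clamp 1 (P t)) ^ 2) t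

theorem exists_flow : ∃ Y : ℝ × ℝ × ℝ × ℝ → ℝ → ℝ × ℝ × ℝ × ℝ,
    (∀ x, Y x 0 = x) ∧ (∀ x t, HasDerivAt (Y x) (c.field (Y x t)) t) ∧
      Continuous fun q : (ℝ × ℝ × ℝ × ℝ) × ℝ => Y q.1 q.2 := by
  obtain ⟨K, L, hK, hL⟩ := c.exists_lipschitzWith_field
  exact exists_flow_of_lipschitz hK hL

/-- The flow of the clamped geodesic field. -/
noncomputable def flow : ℝ × ℝ × ℝ × ℝ → ℝ → ℝ × ℝ × ℝ × ℝ := c.exists_flow.choose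

theorem flow_zero (x : ℝ × ℝ × ℝ × ℝ) : c.flow x 0 = x := c.exists_flow.choose_spec.1 x

theorem hasDerivAt_flow (x : ℝ × ℝ × ℝ × ℝ) (t : ℝ) :
    HasDerivAt (c.flow x) (c.field (c.flow x t)) t := c.exists_flow.choose_spec.2.1 x t

theorem continuous_flow : Continuous fun q : (ℝ × ℝ × ℝ × ℝ) × ℝ => c.flow q.1 q.2 :=
  c.exists_flow.choose_spec.2.2

theorem isOrbit_flow (x : ℝ × ℝ × ℝ × ℝ) : c.IsOrbit (fun t => (c.flow x t).1)
    (fun t => (c.flow x t).2.1) (fun t => (c.flow x t).2.2.1) (fun t => (c.flow x t).2.2.2) where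
  hθ t := (c.hasDerivAt_flow x t).fst
  hr t := (c.hasDerivAt_flow x t).snd.fst
  hP t := (c.hasDerivAt_flow x t).snd.snd.fst
  hS t := (c.hasDerivAt_flow x t).snd.snd.snd

theorem flow_eq_of_isOrbit {θ r P S : ℝ → ℝ} (h : c.IsOrbit θ r P S) :
    c.flow (θ 0, r 0, P 0, S 0) = fun t => (θ t, r t, P t, S t) := by
  obtain ⟨K, L, hK, hL⟩ := c.exists_lipschitzWith_field
  refine ODE_solution_unique_univ (v := fun _ => c.field) (s := fun _ => univ) (K := K) (t₀ := 0)
    (fun _ => hK.lipschitzOnWith) (fun t => ⟨c.hasDerivAt_flow _ t, trivial⟩)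
    (fun t => ⟨(h.hθ t).prodMk ((h.hr t).prodMk ((h.hP t).prodMk (h.hS t))), trivial⟩)
    (c.flow_zero _)

end Collar

/-! ### Orbits that cross height `0` and orbits that lose their momentum. -/

theorem sub_sin_mono {x y : ℝ} (h : x ≤ y) : x - Real.sin x ≤ y - Real.sin y := by
  have := Real.lipschitzWith_sin.dist_le_mul y x
  rw [Real.dist_eq, Real.dist_eq, NNReal.coe_one, one_mul, abs_of_nonneg (sub_nonneg.2 h)] at this
  linarith [le_abs_self (Real.sin y - Real.sin x)]

namespace Collar

variable {l : ℝ → ℝ} (c : Collar l)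

/-- An orbit at height `r` with vertical momentum below this threshold turns back before it
reaches height `0`. -/
noncomputable def threshold (r : ℝ) : ℝ :=
  min (1 / 2) (c.b * r * (r / (4 * c.B) - Real.sin (r / (4 * c.B))) / 4)

theorem threshold_mono {x y : ℝ} (hx : 0 ≤ x) (h : x ≤ y) : c.threshold x ≤ c.threshold y := by
  have hB := c.B_pos
  have hb := c.b_pos
  have h1 : x / (4 * c.B) ≤ y / (4 * c.B) := by gcongr
  have h2 := sub_sin_mono h1
  have h3 : 0 ≤ x / (4 * c.B) - Real.sin (x / (4 * c.B)) := by
    simpa using sub_sin_mono (show 0 ≤ x / (4 * c.B) by positivity)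
  have h4 : 0 ≤ c.b * y := mul_nonneg hb.le (hx.trans h)
  unfold threshold
  refine min_le_min le_rfl ?_
  gcongr

theorem threshold_zero : c.threshold 0 = 0 := by
  simp [threshold]

theorem threshold_pos {x : ℝ} (hx : 0 < x) : 0 < c.threshold x := by
  have hB := c.B_pos
  have hb := c.b_pos
  have h1 : Real.sin (x / (4 * c.B)) < x / (4 * c.B) := Real.sin_lt (by positivity)
  have h2 : 0 < x / (4 * c.B) - Real.sin (x / (4 * c.B)) := by linarith
  unfold threshold
  positivity

theorem continuous_threshold : Continuous c.threshold := by
  unfold threshold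
  fun_prop

theorem threshold_le (x : ℝ) : c.threshold x ≤ 1 / 2 := min_le_left _ _

namespace IsOrbit

variable {c} {θ r P S : ℝ → ℝ}

/-- Because `mu ≤ 1` on the collar, the correction term is at most half the width, so the angle
advances at a rate comparable to the width. -/
theorem deriv_theta_bounds (θ₀ r₀ P₀ : ℝ) (c : Collar l) :
    width θ₀ (clamp 1 P₀) / 2 ≤ width θ₀ (clamp 1 P₀) +
        c.mu r₀ * (Real.cos θ₀ * Real.sin θ₀ * clamp 1 P₀) ∧
      width θ₀ (clamp 1 P₀) + c.mu r₀ * (Real.cos θ₀ * Real.sin θ₀ * clamp 1 P₀) ≤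
        3 / 2 * width θ₀ (clamp 1 P₀) := by
  have hp := clamp_mem zero_le_one P₀
  have h1 := abs_cos_sin_mul_le (θ := θ₀) hp.1 hp.2
  have h2 := c.mu_nonneg r₀
  have h3 := c.mu_le_one r₀
  have h4 := width_nonneg θ₀ (clamp 1 P₀)
  set q := Real.cos θ₀ * Real.sin θ₀ * clamp 1 P₀
  have h5 : |c.mu r₀ * q| ≤ width θ₀ (clamp 1 P₀) / 2 := by
    rw [abs_mul, abs_of_nonneg h2]
    nlinarith [abs_nonneg q]
  constructor <;> linarith [neg_abs_le (c.mu r₀ * q), le_abs_self (c.mu r₀ * q)]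

theorem neg_deriv_P_le (c : Collar l) (θ₀ P₀ : ℝ) {r₀ : ℝ} (hr : 0 ≤ r₀) :
    c.mu r₀ * ((1 - clamp 1 P₀ ^ 2) * Real.sin θ₀ ^ 2) ≤
      2 * c.C * r₀ * Real.sin θ₀ ^ 2 := by
  have hp := clamp_mem zero_le_one P₀
  have h1 := c.mu_le r₀
  have h2 := clamp_le_self (m := c.ε) hr
  have h3 := c.C_pos
  have h4 : c.mu r₀ ≤ 2 * c.C * r₀ := by nlinarith
  have h5 : (1 - clamp 1 P₀ ^ 2) * Real.sin θ₀ ^ 2 ≤ Real.sin θ₀ ^ 2 := by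
    nlinarith [mul_nonneg (sq_nonneg (clamp 1 P₀)) (sq_nonneg (Real.sin θ₀))]
  have h6 : 0 ≤ (1 - clamp 1 P₀ ^ 2) * Real.sin θ₀ ^ 2 :=
    mul_nonneg (by nlinarith [hp.1, hp.2]) (sq_nonneg _)
  exact mul_le_mul h4 h5 h6 (by positivity)

variable (h : c.IsOrbit θ r P S)
include h

theorem monotone_theta : Monotone θ := by
  refine monotoneOn_univ.1 (monotoneOn_of_hasDerivAt convex_univ (fun t _ => h.hθ t) fun t _ => ?_)
  linarith [(deriv_theta_bounds (θ t) (r t) (P t) c).1, width_nonneg (θ t) (clamp 1 (P t))]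

theorem antitone_r : Antitone r := by
  refine antitoneOn_univ.1 (antitoneOn_of_hasDerivAt convex_univ (fun t _ => h.hr t) fun t _ => ?_)
  have := mul_nonneg (c.lam_pos (r t)).le (clamp_nonneg 1 (P t))
  linarith

theorem antitone_P : Antitone P := by
  refine antitoneOn_univ.1 (antitoneOn_of_hasDerivAt convex_univ (fun t _ => h.hP t) fun t _ => ?_)
  have hp := clamp_mem zero_le_one (P t)
  have : 0 ≤ (1 - clamp 1 (P t) ^ 2) * Real.sin (θ t) ^ 2 :=
    mul_nonneg (by nlinarith [hp.1, hp.2]) (sq_nonneg _)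
  linarith [mul_nonneg (c.mu_nonneg (r t)) this]

theorem continuous_theta : Continuous θ :=
  continuous_iff_continuousAt.2 fun t => (h.hθ t).continuousAt

/-- Orbits which are steep compared to their height reach height `0`. -/
theorem exists_neg_of_steep {t₁ : ℝ} (h1 : P t₁ ≤ 1) (hK : c.K * r t₁ < P t₁) :
    ∃ t ≥ t₁, r t < 0 := by
  by_contra! hcon
  have ha := c.a_pos
  have hKp := c.K_pos
  set κ := c.K * c.a with hκ
  -- While `r ≥ 0`, the quantity `z = P - K r` satisfies `z' ≥ κ z`: the loss of momentum, at most
  -- `2 C r`, is covered by `K² a r` thanks to `cone`. So `P` stays above the initial value of `z`,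
  -- and `r` falls at least linearly.
  have hmono : MonotoneOn (fun t => (P t - c.K * r t) * Real.exp (-κ * t)) (Ici t₁) := by
    refine monotoneOn_of_hasDerivAt (convex_Ici _) (fun t _ =>
      (((h.hP t).sub ((h.hr t).const_mul c.K))).mul
        (((hasDerivAt_id t).const_mul (-κ)).exp)) fun t ht => ?_
    have hr0 : 0 ≤ r t := hcon t ht
    have hP1 : P t ≤ 1 := (h.antitone_P ht).trans h1
    have e1 := neg_deriv_P_le c (θ t) (P t) hr0
    have e2 : 2 * c.C * r t * Real.sin (θ t) ^ 2 ≤ 2 * c.C * r t := by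
      have := Real.sin_sq_le_one (θ t)
      have h0 : 0 ≤ 2 * c.C * r t := by have := c.C_pos; positivity
      nlinarith
    have e3 : c.a * P t ≤ c.lam (r t) * clamp 1 (P t) := by
      have := c.a_le_lam (r t)
      nlinarith [le_clamp hP1, clamp_nonneg 1 (P t)]
    have e4 := c.cone
    have e5 : 0 ≤ -(c.mu (r t) * ((1 - clamp 1 (P t) ^ 2) * Real.sin (θ t) ^ 2)) -
        c.K * -(c.lam (r t) * clamp 1 (P t)) - κ * (P t - c.K * r t) := by
      nlinarith [mul_le_mul_of_nonneg_left e3 hKp.le, mul_le_mul_of_nonneg_right e4 hr0]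
    have := mul_nonneg e5 (Real.exp_pos (-κ * t)).le
    simp only [id, mul_one, Pi.sub_apply]
    linarith
  set z := P t₁ - c.K * r t₁ with hz
  have hz0 : 0 < z := by linarith
  have hPz : ∀ t ≥ t₁, z ≤ P t := by
    intro t ht
    have hm : z * Real.exp (-κ * t₁) ≤ (P t - c.K * r t) * Real.exp (-κ * t) :=
      hmono self_mem_Ici ht ht
    have hexp : Real.exp (-κ * t) ≤ Real.exp (-κ * t₁) :=
      Real.exp_le_exp.2 (by have : 0 < κ := by positivity
                            nlinarith)
    have h3 : 0 ≤ c.K * r t := mul_nonneg hKp.le (hcon t ht)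
    by_contra! hlt
    have h4 := Real.exp_pos (-κ * t)
    nlinarith
  obtain ⟨t, ht, hlt⟩ := exists_lt_of_deriv_le_neg (f := r) (k := c.a * z) (t₁ := t₁)
    (by positivity) (fun t _ => h.hr t) (fun t ht => by
      have := c.a_le_lam (r t)
      have h5 := (hPz t ht).trans (le_clamp ((h.antitone_P ht).trans h1))
      nlinarith [clamp_nonneg 1 (P t)]) 0
  exact absurd hlt (not_lt.2 (hcon t ht))

/-- Height is lost at rate at most `B · width`, because `P ≤ width`, while the angle advances at
rate at least `width / 2`: a descent costs a proportional rotation. -/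
theorem r_add_theta_mono : Monotone fun t => r t + 2 * c.B * θ t := by
  refine monotoneOn_univ.1 (monotoneOn_of_hasDerivAt convex_univ
    (fun t _ => (h.hr t).add ((h.hθ t).const_mul (2 * c.B))) fun t _ => ?_)
  have hp := clamp_mem zero_le_one (P t)
  have h1 := (deriv_theta_bounds (θ t) (r t) (P t) c).1
  have h2 := le_width (θ := θ t) hp.1 hp.2
  have h3 := c.lam_le_B (r t)
  have hB := c.B_pos
  nlinarith [mul_le_mul_of_nonneg_left h1 hB.le, mul_le_mul h3 h2 hp.1 hB.le]

/-- Orbits below the threshold stay at positive height. -/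
theorem pos_of_lt_threshold {t₁ : ℝ} (hr0 : 0 < r t₁) (hrε : r t₁ ≤ c.ε)
    (hP : P t₁ < c.threshold (r t₁)) : ∀ t ≥ t₁, 0 < r t := by
  have hB := c.B_pos
  have hb := c.b_pos
  set ρ := r t₁ with hρ
  -- While the angle advances by `w`, the height drops by at most `2 B w = ρ / 2`.
  set w := ρ / (4 * c.B) with hw
  have hwpos : 0 < w := by positivity
  have hwB : 2 * c.B * w = ρ / 2 := by rw [hw]; field_simp; norm_num
  have near : ∀ t ≥ t₁, θ t ≤ θ t₁ + w → ρ / 2 ≤ r t := by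
    intro t ht hθ
    have := h.r_add_theta_mono ht
    simp only at this
    nlinarith
  intro t ht
  rcases le_total (θ t) (θ t₁ + w) with hθ | hθ
  · linarith [near t ht hθ]
  obtain ⟨t₂, ht₂, hθ₂⟩ := intermediate_value_Icc ht h.continuous_theta.continuousOn
    (show θ t₁ + w ∈ Icc (θ t₁) (θ t) from ⟨by linarith, hθ⟩)
  have hP₂ : P t₂ < 0 := by
    -- On this window `mu ≥ b ρ`, `1 - P² ≥ 3/4` and `dθ/dt ≤ 3/2`, so `P` loses at least `b ρ / 2`
    -- times the integral of `sin²` over the angle; `θ/2 - sin (2θ)/4` is the primitive of `sin²`.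
    have hanti : AntitoneOn (fun u => P u + c.b * ρ / 2 *
        (θ u / 2 - Real.sin (2 * θ u) / 4)) (Icc t₁ t₂) := by
      refine antitoneOn_of_hasDerivAt (convex_Icc _ _) (fun u _ => (h.hP u).add
        ((((h.hθ u).div_const 2).sub
          ((((h.hθ u).const_mul 2).sin).div_const 4)).const_mul (c.b * ρ / 2))) fun u hu => ?_
      have hθu : θ u ≤ θ t₁ + w := (h.monotone_theta hu.2).trans hθ₂.le
      have hru := near u hu.1 hθu
      have hmu : c.b * ρ ≤ c.mu (r u) := by
        have h1 := c.le_mu (r u)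
        have h2 : r u ≤ clamp c.ε (r u) := le_clamp ((h.antitone_r hu.1).trans hrε)
        nlinarith
      have hp := clamp_mem zero_le_one (P u)
      have hp2 : clamp 1 (P u) ≤ 1 / 2 := by
        refine max_le (by norm_num) ((min_le_right _ _).trans ?_)
        exact (h.antitone_P hu.1).trans (hP.le.trans (c.threshold_le _))
      have hup := (deriv_theta_bounds (θ u) (r u) (P u) c).2
      have hw1 := width_le_one (θ := θ u) hp.1 hp.2
      set T := width (θ u) (clamp 1 (P u)) +
        c.mu (r u) * (Real.cos (θ u) * Real.sin (θ u) * clamp 1 (P u)) with hT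
      have hT1 : T ≤ 3 / 2 := by linarith
      have hs : T / 2 - Real.cos (2 * θ u) * (2 * T) / 4 = Real.sin (θ u) ^ 2 * T := by
        rw [Real.cos_two_mul, Real.sin_sq]; ring
      rw [hs]
      have e1 : 3 / 4 * Real.sin (θ u) ^ 2 ≤ (1 - clamp 1 (P u) ^ 2) * Real.sin (θ u) ^ 2 := by
        have : 3 / 4 ≤ 1 - clamp 1 (P u) ^ 2 := by nlinarith [hp.1]
        gcongr
      have e2 : c.b * ρ * (3 / 4 * Real.sin (θ u) ^ 2) ≤
          c.mu (r u) * ((1 - clamp 1 (P u) ^ 2) * Real.sin (θ u) ^ 2) :=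
        mul_le_mul hmu e1 (by positivity) (c.mu_nonneg _)
      have e3 : c.b * ρ / 2 * (Real.sin (θ u) ^ 2 * T) ≤
          c.b * ρ / 2 * (Real.sin (θ u) ^ 2 * (3 / 2)) := by gcongr
      linarith
    have hle := hanti (left_mem_Icc.2 ht₂.1) (right_mem_Icc.2 ht₂.1) ht₂.1
    simp only [hθ₂] at hle
    -- Wherever it lies, an interval of length `w` carries at least `(w - sin w) / 2` of the
    -- integral of `sin²`. Times `b ρ / 2`, this is the second entry of `threshold`.
    have hsin : Real.sin (2 * (θ t₁ + w)) - Real.sin (2 * θ t₁) ≤ 2 * Real.sin w := by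
      rw [Real.sin_sub_sin]
      have e1 : (2 * (θ t₁ + w) - 2 * θ t₁) / 2 = w := by ring
      rw [e1]
      have hw4 : w ≤ Real.pi := by
        have h1 : ρ ≤ 1 * (4 * c.B) := by linarith [c.ε_le]
        rw [← div_le_iff₀ (by positivity)] at h1
        linarith [Real.pi_gt_three]
      have h0 : 0 ≤ Real.sin w := Real.sin_nonneg_of_nonneg_of_le_pi hwpos.le hw4
      nlinarith [Real.cos_le_one ((2 * (θ t₁ + w) + 2 * θ t₁) / 2)]
    have hthr : P t₁ < c.b * ρ * (w - Real.sin w) / 4 := hP.trans_le (min_le_right _ _)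
    nlinarith [mul_le_mul_of_nonneg_left hsin (show 0 ≤ c.b * ρ / 8 by positivity)]
  -- With `P` negative the clamped field no longer moves `r`.
  have hconst : MonotoneOn r (Ici t₂) := by
    refine monotoneOn_of_hasDerivAt (convex_Ici _) (fun u _ => h.hr u) fun u hu => ?_
    rw [clamp_of_nonpos ((h.antitone_P hu).trans hP₂.le)]
    simp
  have := hconst self_mem_Ici ht₂.2 ht₂.2
  linarith [near t₂ ht₂.1 hθ₂.le]

end IsOrbit

end Collar

/-! ### Stable orbits and their asymptotics. -/

namespace Collar

variable {l : ℝ → ℝ} (c : Collar l)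

/-- Orbits starting at the outer boundary of the collar which neither cross height `0` nor drop
below the threshold. -/
structure IsStable (θ r P S : ℝ → ℝ) : Prop extends c.IsOrbit θ r P S where
  r_zero : r 0 = c.ε
  P_zero_pos : 0 < P 0
  P_zero_lt : P 0 < 1
  r_nonneg : ∀ t ≥ 0, 0 ≤ r t
  threshold_le_P : ∀ t ≥ 0, c.threshold (r t) ≤ P t

theorem abs_sin_le_deriv_theta (θ₀ r₀ P₀ : ℝ) : |Real.sin θ₀| / 2 ≤
    width θ₀ (clamp 1 P₀) + c.mu r₀ * (Real.cos θ₀ * Real.sin θ₀ * clamp 1 P₀) := by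
  linarith [(IsOrbit.deriv_theta_bounds θ₀ r₀ P₀ c).1, abs_sin_le_width θ₀ (clamp 1 P₀)]

namespace IsStable

variable {c} {θ r P S : ℝ → ℝ} (h : c.IsStable θ r P S)
include h

theorem P_lt_one {t : ℝ} (ht : 0 ≤ t) : P t < 1 := (h.antitone_P ht).trans_lt h.P_zero_lt

theorem P_nonneg {t : ℝ} (ht : 0 ≤ t) : 0 ≤ P t := by
  refine le_trans ?_ (h.threshold_le_P t ht)
  simpa [c.threshold_zero] using c.threshold_mono le_rfl (h.r_nonneg t ht)

theorem clamp_P {t : ℝ} (ht : 0 ≤ t) : clamp 1 (P t) = P t :=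
  clamp_of_mem ⟨h.P_nonneg ht, (h.P_lt_one ht).le⟩

theorem r_le {t : ℝ} (ht : 0 ≤ t) : r t ≤ c.ε := h.r_zero ▸ h.antitone_r ht

theorem clamp_r {t : ℝ} (ht : 0 ≤ t) : clamp c.ε (r t) = r t :=
  clamp_of_mem ⟨h.r_nonneg t ht, h.r_le ht⟩

/-- The set `r = P = 0` is invariant, hence not reached in finite time; quantitatively, `(r + P)' ≥
-M (r + P)`. -/
theorem r_add_P_pos {t : ℝ} (ht : 0 ≤ t) : 0 < r t + P t := by
  set M := c.B + 2 * c.C with hM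
  have hB := c.B_pos
  have hC := c.C_pos
  have hmono : MonotoneOn (fun t => (r t + P t) * Real.exp (M * t)) (Ici 0) := by
    refine monotoneOn_of_hasDerivAt (convex_Ici _) (fun t _ =>
      (((h.hr t).add (h.hP t))).mul
        (((hasDerivAt_id t).const_mul M).exp)) fun t ht => ?_
    have hr0 := h.r_nonneg t ht
    have hP0 := h.P_nonneg ht
    have e1 := IsOrbit.neg_deriv_P_le c (θ t) (P t) hr0
    have e2 : 2 * c.C * r t * Real.sin (θ t) ^ 2 ≤ 2 * c.C * r t := by
      have := Real.sin_sq_le_one (θ t)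
      have h0 : 0 ≤ 2 * c.C * r t := by positivity
      nlinarith
    have e3 : c.lam (r t) * clamp 1 (P t) ≤ c.B * P t := by
      rw [h.clamp_P ht]
      exact mul_le_mul_of_nonneg_right (c.lam_le_B _) hP0
    have e5 : 0 ≤ -(c.lam (r t) * clamp 1 (P t)) +
        -(c.mu (r t) * ((1 - clamp 1 (P t) ^ 2) * Real.sin (θ t) ^ 2)) + M * (r t + P t) := by
      nlinarith [mul_nonneg hB.le hr0, mul_nonneg hC.le hP0]
    have := mul_nonneg e5 (Real.exp_pos (M * t)).le
    simp only [id, mul_one, Pi.add_apply]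
    linarith
  have h1 := hmono self_mem_Ici ht ht
  simp only [mul_zero, Real.exp_zero, mul_one] at h1
  have h2 : 0 < r 0 + P 0 := by rw [h.r_zero]; linarith [c.ε_pos, h.P_zero_pos]
  exact pos_of_mul_pos_left (h2.trans_le h1) (Real.exp_pos _).le

/-- A zero of `r` would persist by monotonicity and sign, so `r' = -lam · P` would force `P = 0` as
well, against `r_add_P_pos`. -/
theorem r_pos {t : ℝ} (ht : 0 ≤ t) : 0 < r t := by
  refine (h.r_nonneg t ht).lt_of_ne fun h0 => ?_
  have hz : ∀ u ≥ t, r u = 0 := fun u hu =>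
    le_antisymm (h0 ▸ h.antitone_r hu) (h.r_nonneg u (ht.trans hu))
  have hd : HasDerivAt r 0 (t + 1) := by
    refine (hasDerivAt_const (t + 1) (0 : ℝ)).congr_of_eventuallyEq ?_
    filter_upwards [lt_mem_nhds (show t < t + 1 by linarith)] with u hu using hz u hu.le
  have h1 := hd.unique (h.hr (t + 1))
  rw [h.clamp_P (by linarith)] at h1
  have h2 := c.lam_pos (r (t + 1))
  have h3 : P (t + 1) = 0 := by
    have : c.lam (r (t + 1)) * P (t + 1) = 0 := by linarith
    exact (mul_eq_zero.1 this).resolve_left h2.ne'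
  have h4 := h.r_add_P_pos (show 0 ≤ t + 1 by linarith)
  rw [h3, hz (t + 1) (by linarith)] at h4
  simp at h4

theorem P_pos {t : ℝ} (ht : 0 ≤ t) : 0 < P t :=
  (c.threshold_pos (h.r_pos ht)).trans_le (h.threshold_le_P t ht)

/-- A steeper orbit would cross height `0`. Hence `P` tends to `0` together with `r`. -/
theorem P_le {t : ℝ} (ht : 0 ≤ t) : P t ≤ c.K * r t := by
  by_contra! hlt
  obtain ⟨u, hu, hneg⟩ := h.toIsOrbit.exists_neg_of_steep (h.P_lt_one ht).le hlt
  exact absurd hneg (not_lt.2 (h.r_nonneg u (ht.trans hu)))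

/-- If `r` stayed above `m > 0`, then `P` would stay above `threshold m > 0` and `r` would fall at a
definite rate. -/
theorem tendsto_r : Tendsto r atTop (𝓝 0) := by
  rw [tendsto_order]
  refine ⟨fun m hm => ?_, fun m hm => ?_⟩
  · filter_upwards [eventually_ge_atTop 0] with t ht using hm.trans (h.r_pos ht)
  · suffices ∃ t ≥ 0, r t < m by
      obtain ⟨t, -, hlt⟩ := this
      filter_upwards [eventually_ge_atTop t] with u hu using (h.antitone_r hu).trans_lt hlt
    by_contra! hcon
    obtain ⟨t, ht, hlt⟩ := exists_lt_of_deriv_le_neg (f := r) (k := c.a * c.threshold m) (t₁ := 0)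
      (mul_pos c.a_pos (c.threshold_pos hm)) (fun t _ => h.hr t) (fun t ht => by
        have h1 := (c.threshold_mono hm.le (hcon t ht)).trans (h.threshold_le_P t ht)
        rw [h.clamp_P ht]
        have h2 := mul_le_mul (c.a_le_lam (r t)) h1 (c.threshold_pos hm).le (c.lam_pos _).le
        linarith) 0
    exact absurd hlt (not_lt.2 (h.r_nonneg t ht))

theorem tendsto_P : Tendsto P atTop (𝓝 0) := by
  have h1 : Tendsto (fun t => c.K * r t) atTop (𝓝 0) := by simpa using h.tendsto_r.const_mul c.K
  refine tendsto_of_tendsto_of_tendsto_of_le_of_le' tendsto_const_nhds h1 ?_ ?_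
  · filter_upwards [eventually_ge_atTop 0] with t ht using h.P_nonneg ht
  · filter_upwards [eventually_ge_atTop 0] with t ht using h.P_le ht

/-- The angle of a stable orbit cannot converge to a multiple of `π`. -/
theorem not_tendsto_of_sin_eq_zero {θ₁ : ℝ} (hlim : Tendsto θ atTop (𝓝 θ₁))
    (hs : Real.sin θ₁ = 0) : False := by
  have hle : ∀ t, θ t ≤ θ₁ := fun t => h.monotone_theta.ge_of_tendsto hlim t
  have hcos : Real.cos θ₁ ^ 2 = 1 := by have := Real.sin_sq_add_cos_sq θ₁; nlinarith
  have hev : ∀ᶠ t in atTop, θ₁ - Real.pi / 2 < θ t ∧ 1 / 4 < Real.cos (θ t) ^ 2 := by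
    refine (hlim.eventually (lt_mem_nhds (by linarith [Real.pi_pos]))).and ?_
    have : Tendsto (fun t => Real.cos (θ t) ^ 2) atTop (𝓝 (Real.cos θ₁ ^ 2)) :=
      ((Real.continuous_cos.tendsto _).comp hlim).pow 2
    rw [hcos] at this
    exact this.eventually (lt_mem_nhds (by norm_num))
  obtain ⟨t₁, ht₁⟩ := eventually_atTop.1 (hev.and (eventually_ge_atTop 0))
  have ht₁0 : 0 ≤ t₁ := (ht₁ t₁ le_rfl).2
  have hB := c.B_pos
  have hC := c.C_pos
  have hwd : ∀ t, HasDerivAt (fun t => Real.sin (θ t) ^ 2) (2 * Real.sin (θ t) *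
      (Real.cos (θ t) * (width (θ t) (clamp 1 (P t)) + c.mu (r t) *
      (Real.cos (θ t) * Real.sin (θ t) * clamp 1 (P t))))) t := fun t => by
    simpa using ((h.hθ t).sin).fun_pow 2
  -- As the angle creeps up to a zero of the sine, `(sin² θ)' ≤ -sin² θ / 2`: the product `sin θ cos
  -- θ` is nonpositive, `|cos θ| ≥ 1/2`, and `θ' ≥ |sin θ| / 2`.
  have hw : ∀ t ≥ t₁, 2 * Real.sin (θ t) *
      (Real.cos (θ t) * (width (θ t) (clamp 1 (P t)) + c.mu (r t) *
      (Real.cos (θ t) * Real.sin (θ t) * clamp 1 (P t)))) ≤ -(Real.sin (θ t) ^ 2) / 2 := by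
    intro t ht
    obtain ⟨⟨hθ, hc⟩, -⟩ := ht₁ t ht
    have hT := c.abs_sin_le_deriv_theta (θ t) (r t) (P t)
    set T := width (θ t) (clamp 1 (P t)) + c.mu (r t) *
      (Real.cos (θ t) * Real.sin (θ t) * clamp 1 (P t))
    have hsc : Real.sin (θ t) * Real.cos (θ t) ≤ 0 := by
      have e1 : Real.sin (θ t) * Real.cos (θ t) =
          Real.sin (θ t - θ₁) * Real.cos (θ t - θ₁) := by
        have e2 : θ t = (θ t - θ₁) + θ₁ := by ring
        conv_lhs => rw [e2]
        rw [Real.sin_add (θ t - θ₁), Real.cos_add (θ t - θ₁), hs]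
        linear_combination Real.sin (θ t - θ₁) * Real.cos (θ t - θ₁) * hcos
      rw [e1]
      exact mul_nonpos_of_nonpos_of_nonneg
        (Real.sin_nonpos_of_nonpos_of_neg_pi_le (by linarith [hle t]) (by linarith [Real.pi_pos]))
        (Real.cos_nonneg_of_neg_pi_div_two_le_of_le (by linarith) (by linarith [hle t, Real.pi_pos]))
    have habs : |Real.sin (θ t)| / 2 ≤ -(Real.sin (θ t) * Real.cos (θ t)) := by
      rw [← abs_of_nonpos hsc, abs_mul]
      have : 1 / 2 ≤ |Real.cos (θ t)| := by
        rw [← sq_abs] at hc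
        by_contra! hlt
        nlinarith [abs_nonneg (Real.cos (θ t))]
      nlinarith [abs_nonneg (Real.sin (θ t))]
    have h0 := abs_nonneg (Real.sin (θ t))
    have hprod := mul_le_mul habs hT (by linarith) (by linarith)
    rw [← sq_abs (Real.sin (θ t))]
    nlinarith
  -- As `P → 0`, its value is the momentum still to be lost, which the decay of `sin² θ` controls:
  -- `P - 4 C r sin² θ` is nondecreasing with limit `0`.
  have hPle : ∀ t ≥ t₁, P t ≤ 4 * c.C * r t * Real.sin (θ t) ^ 2 := by
    have hmono : MonotoneOn (fun t => P t - 4 * c.C * (r t * Real.sin (θ t) ^ 2)) (Ici t₁) := by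
      refine monotoneOn_of_hasDerivAt (convex_Ici _) (fun t _ =>
        (h.hP t).sub (((h.hr t).mul (hwd t)).const_mul (4 * c.C))) fun t ht => ?_
      have ht0 : 0 ≤ t := ht₁0.trans ht
      have hr0 := h.r_nonneg t ht0
      have e1 := IsOrbit.neg_deriv_P_le c (θ t) (P t) hr0
      have e2 := mul_le_mul_of_nonneg_left (hw t ht) hr0
      have e3 : 0 ≤ c.lam (r t) * clamp 1 (P t) * Real.sin (θ t) ^ 2 := by
        have := c.lam_pos (r t)
        have := clamp_nonneg 1 (P t)
        positivity
      have e4 := mul_le_mul_of_nonneg_left e2 hC.le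
      have e5 := mul_nonneg hC.le e3
      linarith
    have hlim0 : Tendsto (fun t => P t - 4 * c.C * (r t * Real.sin (θ t) ^ 2)) atTop (𝓝 0) := by
      have := h.tendsto_P.sub (((h.tendsto_r).mul
        (((Real.continuous_sin.tendsto _).comp hlim).pow 2)).const_mul (4 * c.C))
      simpa using this
    intro t ht
    have : P t - 4 * c.C * (r t * Real.sin (θ t) ^ 2) ≤ 0 := by
      refine ge_of_tendsto hlim0 ?_
      filter_upwards [eventually_ge_atTop t] with u hu
      exact hmono ht (mem_Ici.2 (le_trans ht hu)) hu
    linarith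
  -- Now `(log r)' = -lam P / r ≥ -4 B C sin² θ ≥ 8 B C (sin² θ)'`, so `log r` is bounded below,
  -- which contradicts `r → 0`.
  have hU : MonotoneOn (fun t => Real.log (r t) - 8 * c.B * c.C * Real.sin (θ t) ^ 2)
      (Ici t₁) := by
    refine monotoneOn_of_hasDerivAt (convex_Ici _) (fun t ht =>
        ((h.hr t).log (h.r_pos (ht₁0.trans ht)).ne').sub ((hwd t).const_mul (8 * c.B * c.C)))
        fun t ht => ?_
    have ht0 : 0 ≤ t := ht₁0.trans ht
    have hr0 := h.r_pos ht0
    have e1 : c.lam (r t) * clamp 1 (P t) ≤ c.B * (4 * c.C * r t * Real.sin (θ t) ^ 2) := by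
      rw [h.clamp_P ht0]
      exact mul_le_mul (c.lam_le_B _) (hPle t ht) (h.P_nonneg ht0) hB.le
    have e2 : c.lam (r t) * clamp 1 (P t) / r t ≤ 4 * c.B * c.C * Real.sin (θ t) ^ 2 := by
      rw [div_le_iff₀ hr0]; linarith
    have e3 := mul_le_mul_of_nonneg_left (hw t ht) (show 0 ≤ 8 * c.B * c.C by positivity)
    rw [neg_div]
    linarith
  set u := Real.log (r t₁) - 8 * c.B * c.C * Real.sin (θ t₁) ^ 2 with hu
  have hlow : ∀ t ≥ t₁, Real.exp u ≤ r t := by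
    intro t ht
    rw [← Real.le_log_iff_exp_le (h.r_pos (ht₁0.trans ht))]
    have h1 : u ≤ Real.log (r t) - 8 * c.B * c.C * Real.sin (θ t) ^ 2 := hU self_mem_Ici ht ht
    have : 0 ≤ 8 * c.B * c.C * Real.sin (θ t) ^ 2 := by positivity
    linarith
  obtain ⟨t, ht⟩ := ((h.tendsto_r.eventually (gt_mem_nhds (Real.exp_pos u))).and
    (eventually_ge_atTop t₁)).exists
  exact absurd ht.1 (not_lt.2 (hlow t ht.2))

/-- A finite limit with nonzero sine is impossible because `θ' ≥ |sin θ| / 2` would stay away from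
`0`; the remaining limits are excluded by `not_tendsto_of_sin_eq_zero`. -/
theorem tendsto_theta : Tendsto θ atTop atTop := by
  rcases tendsto_atTop_of_monotone h.monotone_theta with h1 | ⟨θ₁, hlim⟩
  · exact h1
  exfalso
  by_cases hs : Real.sin θ₁ = 0
  · exact h.not_tendsto_of_sin_eq_zero hlim hs
  · have hpos : 0 < |Real.sin θ₁| := abs_pos.2 hs
    have hev : ∀ᶠ t in atTop, |Real.sin θ₁| / 2 < |Real.sin (θ t)| :=
      (((Real.continuous_sin.abs.tendsto _).comp hlim)).eventually (lt_mem_nhds (by linarith))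
    obtain ⟨t₁, ht₁⟩ := eventually_atTop.1 hev
    obtain ⟨t, -, ht⟩ := exists_gt_of_le_deriv (f := θ) (k := |Real.sin θ₁| / 4) (t₁ := t₁)
      (by positivity) (fun t _ => h.hθ t)
      (fun t ht => by linarith [ht₁ t ht, c.abs_sin_le_deriv_theta (θ t) (r t) (P t)]) θ₁
    exact absurd ht (not_lt.2 (h.monotone_theta.ge_of_tendsto hlim t))

/-- Negative times enter only because `θ` and `S` are inverted on the whole line. -/
theorem clamp_P_pos (t : ℝ) : 0 < clamp 1 (P t) := by
  rcases le_total 0 t with ht | ht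
  · rw [h.clamp_P ht]; exact h.P_pos ht
  · have h1 : 0 < P t := h.P_zero_pos.trans_le (h.antitone_P ht)
    exact lt_max_of_lt_right (lt_min one_pos h1)

theorem width_pos (t : ℝ) : 0 < width (θ t) (clamp 1 (P t)) :=
  (h.clamp_P_pos t).trans_le
    (le_width (clamp_nonneg 1 (P t)) (clamp_le zero_le_one (P t)))

theorem deriv_theta_pos (t : ℝ) : 0 < width (θ t) (clamp 1 (P t)) +
    c.mu (r t) * (Real.cos (θ t) * Real.sin (θ t) * clamp 1 (P t)) := by
  linarith [(IsOrbit.deriv_theta_bounds (θ t) (r t) (P t) c).1, h.width_pos t]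

theorem strictMono_S : StrictMono S :=
  strictMono_of_hasDerivAt_pos h.hS fun t => by
    have := c.lam_pos (r t)
    have := h.width_pos t
    positivity

theorem P_zero_le_clamp {t : ℝ} (ht : t ≤ 0) : P 0 ≤ clamp 1 (P t) := by
  refine le_max_of_le_right (le_min h.P_zero_lt.le (h.antitone_P ht))

theorem P_zero_le_width {t : ℝ} (ht : t ≤ 0) : P 0 ≤ width (θ t) (clamp 1 (P t)) :=
  (h.P_zero_le_clamp ht).trans (le_width (clamp_nonneg 1 (P t)) (clamp_le zero_le_one (P t)))

omit h in
theorem tendsto_atBot_of_le_deriv {f f' : ℝ → ℝ} {k : ℝ} (hk : 0 < k) (hf : Monotone f)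
    (h : ∀ t, HasDerivAt f (f' t) t) (h' : ∀ t ≤ 0, k ≤ f' t) : Tendsto f atBot atBot := by
  refine tendsto_atBot_atBot_of_monotone hf fun m => ?_
  obtain ⟨t, ht, hlt⟩ := exists_lt_of_deriv_le_neg (f := fun t => f (-t)) (k := k) (t₁ := 0) hk
    (fun t _ => by simpa [Function.comp_def] using (h (-t)).scomp t (hasDerivAt_neg t))
    (fun t ht => by simpa using h' (-t) (by simpa using ht)) m
  exact ⟨-t, hlt.le⟩

theorem tendsto_theta_atBot : Tendsto θ atBot atBot :=
  tendsto_atBot_of_le_deriv (k := P 0 / 2) (by linarith [h.P_zero_pos]) h.monotone_theta h.hθ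
    fun t ht => by
      linarith [(IsOrbit.deriv_theta_bounds (θ t) (r t) (P t) c).1, h.P_zero_le_width ht]

theorem tendsto_S_atBot : Tendsto S atBot atBot :=
  tendsto_atBot_of_le_deriv (k := c.a ^ 2 * P 0 ^ 2)
    (by have := c.a_pos; have := h.P_zero_pos; positivity) h.strictMono_S.monotone h.hS
    fun t ht => by
      have := c.a_pos
      have := h.P_zero_pos
      have := c.a_le_lam (r t)
      have := h.P_zero_le_width ht
      gcongr

/-- Since `S' ≥ a² sin² θ` and `θ' ≤ 3/2`, arclength grows by at least `2a²/3` times the integral of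
`sin²` over the angle, which diverges because `θ → ∞`. -/
theorem tendsto_S : Tendsto S atTop atTop := by
  have ha := c.a_pos
  have hmono : Monotone fun t => S t - 2 / 3 * c.a ^ 2 * (θ t / 2 - Real.sin (2 * θ t) / 4) := by
    refine monotoneOn_univ.1 (monotoneOn_of_hasDerivAt convex_univ (fun t _ => (h.hS t).sub
        ((((h.hθ t).div_const 2).sub
          ((((h.hθ t).const_mul 2).sin).div_const 4)).const_mul (2 / 3 * c.a ^ 2))) fun t _ => ?_)
    have hp := clamp_mem zero_le_one (P t)
    have hup := (IsOrbit.deriv_theta_bounds (θ t) (r t) (P t) c).2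
    have hw1 := width_le_one (θ := θ t) hp.1 hp.2
    have hsw := abs_sin_le_width (θ t) (clamp 1 (P t))
    set T := width (θ t) (clamp 1 (P t)) +
      c.mu (r t) * (Real.cos (θ t) * Real.sin (θ t) * clamp 1 (P t)) with hT
    have hs : T / 2 - Real.cos (2 * θ t) * (2 * T) / 4 = Real.sin (θ t) ^ 2 * T := by
      rw [Real.cos_two_mul, Real.sin_sq]; ring
    rw [hs]
    have e1 : c.a ^ 2 * Real.sin (θ t) ^ 2 ≤
        c.lam (r t) ^ 2 * width (θ t) (clamp 1 (P t)) ^ 2 := by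
      rw [← sq_abs (Real.sin _)]
      have := c.a_le_lam (r t)
      gcongr
    have e2 : Real.sin (θ t) ^ 2 * T ≤ Real.sin (θ t) ^ 2 * (3 / 2) := by
      gcongr; linarith
    have e3 := mul_le_mul_of_nonneg_left e2 (show 0 ≤ 2 / 3 * c.a ^ 2 by positivity)
    linarith
  have hlin : Tendsto (fun t => c.a ^ 2 / 3 * θ t +
      (S 0 - 2 / 3 * c.a ^ 2 * (θ 0 / 2 - Real.sin (2 * θ 0) / 4) - c.a ^ 2 / 6))
      atTop atTop :=
    tendsto_atTop_add_const_right _ _ (h.tendsto_theta.const_mul_atTop (by positivity))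
  refine tendsto_atTop_mono' _ ?_ hlin
  filter_upwards [eventually_ge_atTop 0] with t ht
  have h1 := hmono ht
  simp only at h1
  have h2 := Real.sin_le_one (2 * θ t)
  have h3 := mul_le_mul_of_nonneg_left h2 (sq_nonneg c.a)
  linarith

end IsStable

end Collar

/-! ### Orbits as functions of the angle: comparison and uniqueness. -/

/-- Increasing diffeomorphisms of the line have differentiable inverses. -/
theorem exists_inverse {f f' : ℝ → ℝ} (hf : ∀ t, HasDerivAt f (f' t) t) (hpos : ∀ t, 0 < f' t)
    (htop : Tendsto f atTop atTop) (hbot : Tendsto f atBot atBot) :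
    ∃ g : ℝ → ℝ, (∀ u, f (g u) = u) ∧ (∀ t, g (f t) = t) ∧ StrictMono g ∧
      ∀ u, HasDerivAt g (f' (g u))⁻¹ u := by
  have hmono := strictMono_of_hasDerivAt_pos hf hpos
  have hcont : Continuous f := continuous_iff_continuousAt.2 fun t => (hf t).continuousAt
  have hsurj := hcont.surjective htop hbot
  set e := hmono.orderIsoOfSurjective f hsurj with he
  have hfg : ∀ u, f (e.symm u) = u := fun u => e.apply_symm_apply u
  refine ⟨e.symm, hfg, fun t => e.symm_apply_apply t, e.symm.strictMono, fun u => ?_⟩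
  exact HasDerivAt.of_local_left_inverse e.symm.continuous.continuousAt (hf _) (hpos _).ne'
    (Eventually.of_forall hfg)

/-- Squaring removes the corner of the positive part, so a one-sided inequality can be propagated by
a differentiable Gronwall energy. -/
theorem hasDerivAt_max_zero_sq (x : ℝ) : HasDerivAt (fun x : ℝ => max x 0 ^ 2) (2 * max x 0) x := by
  rcases lt_trichotomy x 0 with hx | rfl | hx
  · rw [max_eq_right hx.le, mul_zero]
    refine (hasDerivAt_const x (0 : ℝ)).congr_of_eventuallyEq ?_
    filter_upwards [gt_mem_nhds hx] with y hy
    rw [max_eq_right hy.le]; ring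
  · rw [max_self, mul_zero, hasDerivAt_iff_isLittleO_nhds_zero]
    simp only [zero_add, max_self, ne_eq, OfNat.ofNat_ne_zero, not_false_eq_true, zero_pow,
      sub_zero, smul_zero]
    have h1 : (fun h : ℝ => max h 0 ^ 2) =O[𝓝 0] fun h : ℝ => h ^ 2 := by
      refine Asymptotics.IsBigO.of_norm_le fun h => ?_
      rw [norm_pow, Real.norm_eq_abs, abs_of_nonneg (le_max_right _ _), ← sq_abs h]
      have := max_le (le_abs_self h) (abs_nonneg h)
      have := le_max_right h 0
      gcongr
    exact h1.trans_isLittleO (Asymptotics.isLittleO_pow_id one_lt_two)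
  · rw [max_eq_left hx.le]
    have : HasDerivAt (fun x : ℝ => x ^ 2) (2 * x) x := by simpa using hasDerivAt_pow 2 x
    refine this.congr_of_eventuallyEq ?_
    filter_upwards [lt_mem_nhds hx] with y hy
    rw [max_eq_left hy.le]

/-- Factor both sides of `width(p)² - width(q)² = cos² u · (p² - q²)` and use `p + q ≤ width(p) +
width(q)`. -/
theorem abs_width_sub_le {p q : ℝ} (u : ℝ) (hp : 0 < p) (hq : 0 < q) (hp1 : p ≤ 1) (hq1 : q ≤ 1) :
    |width u p - width u q| ≤ |p - q| := by
  have h1 := le_width (θ := u) hp.le hp1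
  have h2 := le_width (θ := u) hq.le hq1
  have h3 : (width u p - width u q) * (width u p + width u q) =
      Real.cos u ^ 2 * ((p - q) * (p + q)) := by
    linear_combination width_sq u p - width_sq u q
  have h4 : |width u p - width u q| * (width u p + width u q) =
      Real.cos u ^ 2 * (|p - q| * (p + q)) := by
    rw [← abs_of_pos (show 0 < width u p + width u q by linarith), ← abs_mul, h3, abs_mul, abs_mul,
      abs_of_nonneg (sq_nonneg (Real.cos u)), abs_of_pos (show 0 < p + q by linarith)]
  have h5 := Real.cos_sq_le_one u
  have h6 : Real.cos u ^ 2 * (|p - q| * (p + q)) ≤ 1 * (|p - q| * (p + q)) := by gcongr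
  have h7 : |p - q| * (p + q) ≤ |p - q| * (width u p + width u q) := by gcongr
  by_contra! hlt
  have h8 : |p - q| * (width u p + width u q) < |width u p - width u q| *
    (width u p + width u q) := mul_lt_mul_of_pos_right hlt (by linarith)
  linarith

/-- In other words `p / width u p` is nondecreasing in `p`: after squaring, the cosine terms cancel
and `p² sin² u ≤ q² sin² u` is left. This makes `slopeR` monotone in the momentum. -/
theorem mul_width_le {p q : ℝ} (u : ℝ) (hp : 0 < p) (hpq : p ≤ q) :
    p * width u q ≤ q * width u p := by
  refine le_of_sq_le_sq ?_ (mul_nonneg (hp.le.trans hpq) (width_nonneg _ _))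
  rw [mul_pow, mul_pow, width_sq, width_sq]
  nlinarith [mul_le_mul_of_nonneg_left (show p ^ 2 ≤ q ^ 2 by gcongr) (sq_nonneg (Real.sin u))]

theorem mul_width_lt {p q : ℝ} {u : ℝ} (hp : 0 < p) (hpq : p < q) (hu : Real.sin u ≠ 0) :
    p * width u q < q * width u p := by
  refine lt_of_pow_lt_pow_left₀ 2 (mul_nonneg (hp.trans hpq).le (width_nonneg _ _)) ?_
  rw [mul_pow, mul_pow, width_sq, width_sq]
  nlinarith [mul_lt_mul_of_pos_left (show p ^ 2 < q ^ 2 by gcongr) (pow_pos (abs_pos.2 hu) 2),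
    sq_abs (Real.sin u)]

namespace Collar

variable {l : ℝ → ℝ} (c : Collar l)

/-- `dθ/dt` along orbits. -/
noncomputable def speed (u r p : ℝ) : ℝ := width u p + c.mu r * (Real.cos u * Real.sin u * p)

/-- `-dr/dθ` along orbits. -/
noncomputable def slopeR (u r p : ℝ) : ℝ := c.lam r * p / c.speed u r p

/-- `-dP/dθ` along orbits. -/
noncomputable def slopeP (u r p : ℝ) : ℝ :=
  c.mu r * ((1 - p ^ 2) * Real.sin u ^ 2) / c.speed u r p

section Estimates

variable {u r s p q κ : ℝ}

theorem width_half_le_speed (u r : ℝ) {p : ℝ} (hp : 0 < p) (hp1 : p ≤ 1) :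
    width u p / 2 ≤ c.speed u r p ∧ c.speed u r p ≤ 3 / 2 * width u p := by
  have := IsOrbit.deriv_theta_bounds u r p c
  rwa [clamp_of_mem ⟨hp.le, hp1⟩] at this

theorem speed_pos (u r : ℝ) {p : ℝ} (hp : 0 < p) (hp1 : p ≤ 1) : 0 < c.speed u r p := by
  linarith [(c.width_half_le_speed u r hp hp1).1, le_width (θ := u) hp.le hp1]

/-- The `mu` part of `speed` is proportional to the momentum, so it drops out of the cross product
and only the widths remain. -/
theorem slopeR_sub (u r : ℝ) (hp : 0 < p) (hp1 : p ≤ 1) (hq : 0 < q) (hq1 : q ≤ 1) :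
    c.slopeR u r q - c.slopeR u r p = c.lam r * (q * width u p - p * width u q) /
      (c.speed u r q * c.speed u r p) := by
  have h1 := c.speed_pos u r hp hp1
  have h2 := c.speed_pos u r hq hq1
  rw [slopeR, slopeR, div_sub_div _ _ h2.ne' h1.ne']
  congr 1
  unfold speed
  ring

theorem slopeR_mono (u r : ℝ) (hp : 0 < p) (hpq : p ≤ q) (hq1 : q ≤ 1) :
    c.slopeR u r p ≤ c.slopeR u r q := by
  have hp1 := hpq.trans hq1
  have hq := hp.trans_le hpq
  rw [← sub_nonneg, c.slopeR_sub u r hp hp1 hq hq1]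
  exact div_nonneg (mul_nonneg (c.lam_pos r).le (by linarith [mul_width_le u hp hpq]))
    (mul_pos (c.speed_pos u r hq hq1) (c.speed_pos u r hp hp1)).le

theorem slopeR_strictMono (hu : Real.sin u ≠ 0) (hp : 0 < p) (hpq : p < q) (hq1 : q ≤ 1) :
    c.slopeR u r p < c.slopeR u r q := by
  have hp1 := hpq.le.trans hq1
  have hq := hp.trans hpq
  rw [← sub_pos, c.slopeR_sub u r hp hp1 hq hq1]
  exact div_pos (mul_pos (c.lam_pos r) (by linarith [mul_width_lt hp hpq hu]))
    (mul_pos (c.speed_pos u r hq hq1) (c.speed_pos u r hp hp1))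

theorem kappa_sq_le (u r s : ℝ) (hκ : 0 < κ) (hp : κ ≤ p) (hp1 : p ≤ 1) (hq : κ ≤ q)
    (hq1 : q ≤ 1) : κ ^ 2 / 4 ≤ c.speed u r q * c.speed u s p := by
  have h1 := (c.width_half_le_speed u s (hκ.trans_le hp) hp1).1
  have h2 := (c.width_half_le_speed u r (hκ.trans_le hq) hq1).1
  have h3 := le_width (θ := u) (hκ.trans_le hp).le hp1
  have h4 := le_width (θ := u) (hκ.trans_le hq).le hq1
  calc κ ^ 2 / 4 = κ / 2 * (κ / 2) := by ring
    _ ≤ _ := by gcongr <;> linarith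

theorem abs_slopeR_sub_le (u r : ℝ) (hκ : 0 < κ) (hp : κ ≤ p) (hp1 : p ≤ 1) (hq : κ ≤ q)
    (hq1 : q ≤ 1) : |c.slopeR u r q - c.slopeR u r p| ≤ 8 * c.B / κ ^ 2 * |q - p| := by
  have hp0 := hκ.trans_le hp
  have hq0 := hκ.trans_le hq
  rw [c.slopeR_sub u r hp0 hp1 hq0 hq1, abs_div, abs_mul, abs_of_pos (c.lam_pos r),
    abs_of_pos (mul_pos (c.speed_pos u r hq0 hq1) (c.speed_pos u r hp0 hp1))]
  have h1 := c.kappa_sq_le u r r hκ hp hp1 hq hq1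
  have h2 : |q * width u p - p * width u q| ≤ 2 * |q - p| := by
    have e : q * width u p - p * width u q =
      (q - p) * width u p + p * (width u p - width u q) := by ring
    have h3 := abs_width_sub_le u hp0 hq0 hp1 hq1
    have h4 := width_le_one (θ := u) hp0.le hp1
    rw [abs_sub_comm p q] at h3
    calc _ ≤ |(q - p) * width u p| + |p * (width u p - width u q)| := by
          rw [e]; exact abs_add_le _ _
      _ = |q - p| * width u p + p * |width u p - width u q| := by
          rw [abs_mul, abs_mul, abs_of_nonneg (width_nonneg u p), abs_of_pos hp0]
      _ ≤ |q - p| * 1 + 1 * |q - p| := by gcongr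
      _ = 2 * |q - p| := by ring
  calc _ ≤ c.B * (2 * |q - p|) / (κ ^ 2 / 4) := by
        have := c.lam_le_B r
        have := c.B_pos
        gcongr
    _ = 8 * c.B / κ ^ 2 * |q - p| := by field_simp; ring

/-- The factor `p / width u p` is kept instead of being bounded by `1`: it is dominated by a
multiple of `slopeR`, so its integral along an orbit is controlled by the total descent, which is
finite. The uniqueness of stable orbits rests on this. -/
theorem abs_slopeR_sub_le' (u r s : ℝ) (hp : 0 < p) (hp1 : p ≤ 1) :
    |c.slopeR u r p - c.slopeR u s p| ≤ 4 * (2 + c.B * c.C) * (p / width u p) * |r - s| := by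
  have h1 := c.width_half_le_speed u r hp hp1
  have h2 := c.width_half_le_speed u s hp hp1
  have h3 := le_width (θ := u) hp.le hp1
  have hw : 0 < width u p := hp.trans_le h3
  have hr := c.speed_pos u r hp hp1
  have hs := c.speed_pos u s hp hp1
  have hB := c.B_pos
  have hC := c.C_pos
  set k := Real.cos u * Real.sin u * p with hk
  have hk2 : |k| ≤ width u p / 2 := abs_cos_sin_mul_le hp.le hp1
  have e : c.slopeR u r p - c.slopeR u s p = p * (width u p * (c.lam r - c.lam s) +
      k * (c.lam r * (c.mu s - c.mu r) + c.mu r * (c.lam r - c.lam s))) /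
      (c.speed u r p * c.speed u s p) := by
    rw [slopeR, slopeR, div_sub_div _ _ hr.ne' hs.ne']
    congr 1
    simp only [speed, ← hk]
    ring
  have hnum : |width u p * (c.lam r - c.lam s) +
      k * (c.lam r * (c.mu s - c.mu r) + c.mu r * (c.lam r - c.lam s))| ≤
      width u p * ((2 + c.B * c.C) * |r - s|) := by
    have a1 := c.abs_lam_sub_le r s
    have a2 := c.abs_mu_sub_le s r
    rw [abs_sub_comm s r] at a2
    calc _ ≤ |width u p * (c.lam r - c.lam s)| +
          |k * (c.lam r * (c.mu s - c.mu r) + c.mu r * (c.lam r - c.lam s))| := abs_add_le _ _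
      _ = width u p * |c.lam r - c.lam s| +
          |k| * |c.lam r * (c.mu s - c.mu r) + c.mu r * (c.lam r - c.lam s)| := by
        rw [abs_mul, abs_mul, abs_of_pos hw]
      _ ≤ width u p * |c.lam r - c.lam s| +
          |k| * (|c.lam r * (c.mu s - c.mu r)| + |c.mu r * (c.lam r - c.lam s)|) := by
        gcongr; exact abs_add_le _ _
      _ = width u p * |c.lam r - c.lam s| +
          |k| * (c.lam r * |c.mu s - c.mu r| + c.mu r * |c.lam r - c.lam s|) := by
        rw [abs_mul (c.lam r), abs_mul (c.mu r), abs_of_pos (c.lam_pos r),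
          abs_of_nonneg (c.mu_nonneg r)]
      _ ≤ width u p * |r - s| +
          width u p / 2 * (c.B * (2 * c.C * |r - s|) + 1 * |r - s|) := by
        gcongr
        exacts [add_nonneg (mul_nonneg (c.lam_pos r).le (abs_nonneg _))
          (mul_nonneg (c.mu_nonneg r) (abs_nonneg _)), c.lam_le_B r, c.mu_le_one r]
      _ ≤ width u p * ((2 + c.B * c.C) * |r - s|) := by
        nlinarith [mul_nonneg hw.le (abs_nonneg (r - s))]
  rw [e, abs_div, abs_mul, abs_of_pos hp, abs_of_pos (mul_pos hr hs)]
  calc _ ≤ p * (width u p * ((2 + c.B * c.C) * |r - s|)) / (width u p / 2 * (width u p / 2)) := by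
        gcongr
        exacts [h1.1, h2.1]
    _ = _ := by field_simp; ring

theorem slopeP_sub (u r s : ℝ) (hp : 0 < p) (hp1 : p ≤ 1) :
    c.slopeP u r p - c.slopeP u s p = (1 - p ^ 2) * Real.sin u ^ 2 *
      (width u p * (c.mu r - c.mu s)) / (c.speed u r p * c.speed u s p) := by
  have hr := c.speed_pos u r hp hp1
  have hs := c.speed_pos u s hp hp1
  rw [slopeP, slopeP, div_sub_div _ _ hr.ne' hs.ne']
  congr 1
  unfold speed
  ring

theorem slopeP_mono (u : ℝ) (hp : 0 < p) (hp1 : p ≤ 1) (h : s ≤ r) :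
    c.slopeP u s p ≤ c.slopeP u r p := by
  rw [← sub_nonneg, c.slopeP_sub u r s hp hp1]
  have h1 : 0 ≤ 1 - p ^ 2 := by nlinarith
  have h2 : 0 ≤ c.mu r - c.mu s := sub_nonneg.2 (c.mu_mono h)
  have := width_nonneg u p
  have := c.speed_pos u r hp hp1
  have := c.speed_pos u s hp hp1
  positivity

theorem abs_slopeP_sub_le' (u r s : ℝ) (hκ : 0 < κ) (hp : κ ≤ p) (hp1 : p ≤ 1) :
    |c.slopeP u r p - c.slopeP u s p| ≤ 8 * c.C / κ ^ 2 * |r - s| := by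
  have hp0 := hκ.trans_le hp
  have h1 : 0 ≤ 1 - p ^ 2 := by nlinarith
  have hC := c.C_pos
  rw [c.slopeP_sub u r s hp0 hp1, abs_div, abs_mul, abs_mul, abs_mul, abs_of_nonneg h1,
    abs_of_nonneg (sq_nonneg (Real.sin u)), abs_of_nonneg (width_nonneg u p),
    abs_of_pos (mul_pos (c.speed_pos u r hp0 hp1) (c.speed_pos u s hp0 hp1))]
  calc _ ≤ 1 * 1 * (1 * (2 * c.C * |r - s|)) / (κ ^ 2 / 4) := by
        have := width_nonneg u p
        gcongr
        · nlinarith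
        · exact Real.sin_sq_le_one u
        · exact width_le_one hp0.le hp1
        · exact c.abs_mu_sub_le r s
        · exact c.kappa_sq_le u r s hκ hp hp1 hp hp1
    _ = _ := by field_simp; ring

theorem abs_slopeP_sub_le (u r : ℝ) (hκ : 0 < κ) (hp : κ ≤ p) (hp1 : p ≤ 1) (hq : κ ≤ q)
    (hq1 : q ≤ 1) : |c.slopeP u r q - c.slopeP u r p| ≤ 20 / κ ^ 2 * |q - p| := by
  have hp0 := hκ.trans_le hp
  have hq0 := hκ.trans_le hq
  have hr := c.speed_pos u r hp0 hp1
  have hs := c.speed_pos u r hq0 hq1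
  have e : c.slopeP u r q - c.slopeP u r p = c.mu r * (Real.sin u ^ 2 *
      ((1 - q ^ 2) * (c.speed u r p - c.speed u r q) + (p + q) * (p - q) * c.speed u r q)) /
      (c.speed u r q * c.speed u r p) := by
    rw [slopeP, slopeP, div_sub_div _ _ hs.ne' hr.ne']
    congr 1
    ring
  have hsp : |c.speed u r p - c.speed u r q| ≤ 2 * |q - p| := by
    have e2 : c.speed u r p - c.speed u r q =
        (width u p - width u q) + c.mu r * (Real.cos u * Real.sin u) * (p - q) := by
      unfold speed; ring
    have h3 := abs_width_sub_le u hp0 hq0 hp1 hq1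
    have h4 : |Real.cos u * Real.sin u| ≤ 1 := by
      rw [abs_mul]
      exact mul_le_one₀ (Real.abs_cos_le_one u) (abs_nonneg _) (Real.abs_sin_le_one u)
    calc _ ≤ |width u p - width u q| + |c.mu r * (Real.cos u * Real.sin u) * (p - q)| := by
          rw [e2]; exact abs_add_le _ _
      _ = |width u p - width u q| + c.mu r * |Real.cos u * Real.sin u| * |p - q| := by
          rw [abs_mul, abs_mul, abs_of_nonneg (c.mu_nonneg r)]
      _ ≤ |p - q| + 1 * 1 * |p - q| := by
          gcongr
          exact c.mu_le_one r
      _ = _ := by rw [abs_sub_comm p q]; ring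
  have hnum : |(1 - q ^ 2) * (c.speed u r p - c.speed u r q) +
      (p + q) * (p - q) * c.speed u r q| ≤ 5 * |q - p| := by
    have h3 : 0 ≤ 1 - q ^ 2 := by nlinarith
    have h4 : c.speed u r q ≤ 3 / 2 := by
      linarith [(c.width_half_le_speed u r hq0 hq1).2, width_le_one (θ := u) hq0.le hq1]
    calc _ ≤ |(1 - q ^ 2) * (c.speed u r p - c.speed u r q)| +
          |(p + q) * (p - q) * c.speed u r q| := abs_add_le _ _
      _ = (1 - q ^ 2) * |c.speed u r p - c.speed u r q| + (p + q) * |q - p| * c.speed u r q := by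
          rw [abs_mul, abs_mul, abs_mul, abs_of_nonneg h3, abs_of_pos hs, abs_sub_comm p q,
            abs_of_pos (show 0 < p + q by linarith)]
      _ ≤ 1 * (2 * |q - p|) + 2 * |q - p| * (3 / 2) := by
          gcongr
          · nlinarith
          · linarith
      _ = _ := by ring
  rw [e, abs_div, abs_mul, abs_mul, abs_of_nonneg (c.mu_nonneg r),
    abs_of_nonneg (sq_nonneg (Real.sin u)), abs_of_pos (mul_pos hs hr)]
  calc _ ≤ 1 * (1 * (5 * |q - p|)) / (κ ^ 2 / 4) := by
        gcongr
        · exact c.mu_le_one r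
        · exact Real.sin_sq_le_one u
        · exact c.kappa_sq_le u r r hκ hp hp1 hq hq1
    _ = _ := by field_simp; ring

end Estimates

/-- The system is competitive: a higher and less steep orbit stays higher and less steep. -/
theorem comparison {R₁ R₂ Q₁ Q₂ : ℝ → ℝ} {u₀ u₁ κ : ℝ} (hκ : 0 < κ)
    (hR₁ : ∀ u ∈ Icc u₀ u₁, HasDerivAt R₁ (-c.slopeR u (R₁ u) (Q₁ u)) u)
    (hR₂ : ∀ u ∈ Icc u₀ u₁, HasDerivAt R₂ (-c.slopeR u (R₂ u) (Q₂ u)) u)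
    (hQ₁ : ∀ u ∈ Icc u₀ u₁, HasDerivAt Q₁ (-c.slopeP u (R₁ u) (Q₁ u)) u)
    (hQ₂ : ∀ u ∈ Icc u₀ u₁, HasDerivAt Q₂ (-c.slopeP u (R₂ u) (Q₂ u)) u)
    (hm₁ : ∀ u ∈ Icc u₀ u₁, Q₁ u ∈ Icc κ 1) (hm₂ : ∀ u ∈ Icc u₀ u₁, Q₂ u ∈ Icc κ 1)
    (hR : R₂ u₀ ≤ R₁ u₀) (hQ : Q₁ u₀ ≤ Q₂ u₀) :
    ∀ u ∈ Icc u₀ u₁, R₂ u ≤ R₁ u ∧ Q₁ u ≤ Q₂ u := by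
  have hB := c.B_pos
  have hC := c.C_pos
  obtain ⟨M, hM0, hM1, hM2, hM3, hM4⟩ : ∃ M : ℝ, 0 ≤ M ∧ 8 * c.B / κ ^ 2 ≤ M ∧
      4 * (2 + c.B * c.C) ≤ M ∧ 8 * c.C / κ ^ 2 ≤ M ∧ 20 / κ ^ 2 ≤ M := by
    refine ⟨8 * c.B / κ ^ 2 + 4 * (2 + c.B * c.C) + 8 * c.C / κ ^ 2 + 20 / κ ^ 2,
      by positivity, ?_, ?_, ?_, ?_⟩
    all_goals
      have e1 : 0 ≤ 8 * c.B / κ ^ 2 := by positivity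
      have e2 : 0 ≤ 4 * (2 + c.B * c.C) := by positivity
      have e3 : 0 ≤ 8 * c.C / κ ^ 2 := by positivity
      have e4 : 0 ≤ 20 / κ ^ 2 := by positivity
      linarith
  -- Energy of the violation of the order. As `slopeR` increases with the momentum and `slopeP` with
  -- the height, each cross term is harmful only where the other inequality is violated too, so
  -- Lipschitz bounds give `E' ≤ 4 M E`.
  set E : ℝ → ℝ := fun u => max (R₂ u - R₁ u) 0 ^ 2 + max (Q₁ u - Q₂ u) 0 ^ 2 with hE
  have hanti : AntitoneOn (fun u => E u * Real.exp (-(4 * M) * u)) (Icc u₀ u₁) := by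
    refine antitoneOn_of_hasDerivAt (convex_Icc _ _) (fun u hu =>
      ((((hasDerivAt_max_zero_sq _).comp u ((hR₂ u hu).sub (hR₁ u hu))).add
        ((hasDerivAt_max_zero_sq _).comp u ((hQ₁ u hu).sub (hQ₂ u hu))))).mul
        (((hasDerivAt_id u).const_mul (-(4 * M))).exp)) fun u hu => ?_
    obtain ⟨k1, l1⟩ := hm₁ u hu
    obtain ⟨k2, l2⟩ := hm₂ u hu
    simp only [Pi.sub_apply, Function.comp_def, Pi.add_apply, id, mul_one]
    set x := R₂ u - R₁ u with hx
    set y := Q₁ u - Q₂ u with hy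
    set X := max x 0 with hX
    set Y := max y 0 with hY
    have hX0 : 0 ≤ X := le_max_right _ _
    have hY0 : 0 ≤ Y := le_max_right _ _
    have d1 : c.slopeR u (R₁ u) (Q₁ u) - c.slopeR u (R₁ u) (Q₂ u) ≤ M * Y := by
      rcases le_total (Q₁ u) (Q₂ u) with h | h
      · linarith [c.slopeR_mono u (R₁ u) (hκ.trans_le k1) h l2, mul_nonneg hM0 hY0]
      · have h1 := c.abs_slopeR_sub_le u (R₁ u) hκ k2 l2 k1 l1
        have h2 : |Q₁ u - Q₂ u| ≤ Y := by
          rw [abs_of_nonneg (by linarith)]; exact le_max_left _ _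
        refine (le_abs_self _).trans (h1.trans ?_)
        gcongr
    have d2 : X * (c.slopeR u (R₁ u) (Q₂ u) - c.slopeR u (R₂ u) (Q₂ u)) ≤ M * X ^ 2 := by
      rcases le_total x 0 with h | h
      · rw [hX, max_eq_right h]; simp
      · have h1 := c.abs_slopeR_sub_le' u (R₁ u) (R₂ u) (hκ.trans_le k2) l2
        have h2 : |R₁ u - R₂ u| = X := by
          rw [abs_sub_comm, ← hx, abs_of_nonneg h, hX, max_eq_left h]
        have h3 : Q₂ u / width u (Q₂ u) ≤ 1 :=
          div_le_one_of_le₀ (le_width (hκ.trans_le k2).le l2) (width_nonneg _ _)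
        have h4 : c.slopeR u (R₁ u) (Q₂ u) - c.slopeR u (R₂ u) (Q₂ u) ≤ M * 1 * X := by
          refine (le_abs_self _).trans (h1.trans ?_)
          rw [h2]
          have := div_nonneg (hκ.trans_le k2).le (width_nonneg u (Q₂ u))
          gcongr
        nlinarith
    have d3 : c.slopeP u (R₂ u) (Q₂ u) - c.slopeP u (R₁ u) (Q₂ u) ≤ M * X := by
      rcases le_total (R₂ u) (R₁ u) with h | h
      · linarith [c.slopeP_mono u (hκ.trans_le k2) l2 h, mul_nonneg hM0 hX0]
      · have h1 := c.abs_slopeP_sub_le' u (R₂ u) (R₁ u) hκ k2 l2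
        have h2 : |R₂ u - R₁ u| ≤ X := by
          rw [abs_of_nonneg (by linarith)]; exact le_max_left _ _
        refine (le_abs_self _).trans (h1.trans ?_)
        gcongr
    have d4 : Y * (c.slopeP u (R₁ u) (Q₂ u) - c.slopeP u (R₁ u) (Q₁ u)) ≤ M * Y ^ 2 := by
      rcases le_total y 0 with h | h
      · rw [hY, max_eq_right h]; simp
      · have h1 := c.abs_slopeP_sub_le u (R₁ u) hκ k1 l1 k2 l2
        have h2 : |Q₂ u - Q₁ u| = Y := by
          rw [abs_sub_comm, ← hy, abs_of_nonneg h, hY, max_eq_left h]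
        have h4 : c.slopeP u (R₁ u) (Q₂ u) - c.slopeP u (R₁ u) (Q₁ u) ≤ M * Y := by
          refine (le_abs_self _).trans (h1.trans ?_)
          rw [h2]
          gcongr
        nlinarith
    have d5 := mul_le_mul_of_nonneg_left d1 hX0
    have d6 := mul_le_mul_of_nonneg_left d3 hY0
    have d7 : 2 * X * (-c.slopeR u (R₂ u) (Q₂ u) - -c.slopeR u (R₁ u) (Q₁ u)) +
        2 * Y * (-c.slopeP u (R₁ u) (Q₁ u) - -c.slopeP u (R₂ u) (Q₂ u)) -
        4 * M * (X ^ 2 + Y ^ 2) ≤ 0 := by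
      nlinarith [mul_nonneg hM0 (sq_nonneg (X - Y))]
    have d8 := mul_nonpos_of_nonpos_of_nonneg d7 (Real.exp_pos (-(4 * M) * u)).le
    linarith
  intro u hu
  have h0 := hanti (left_mem_Icc.2 (hu.1.trans hu.2)) hu hu.1
  have hE0 : E u₀ = 0 := by
    simp only [hE]
    rw [max_eq_right (by linarith), max_eq_right (by linarith)]
    ring
  simp only [hE0, zero_mul] at h0
  have hEu : E u ≤ 0 := nonpos_of_mul_nonpos_left h0 (Real.exp_pos _)
  simp only [hE] at hEu
  have s1 := sq_nonneg (max (R₂ u - R₁ u) 0)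
  have s2 := sq_nonneg (max (Q₁ u - Q₂ u) 0)
  have t1 : max (R₂ u - R₁ u) 0 = 0 := pow_eq_zero_iff two_ne_zero |>.1 (by linarith)
  have t2 : max (Q₁ u - Q₂ u) 0 = 0 := pow_eq_zero_iff two_ne_zero |>.1 (by linarith)
  exact ⟨by linarith [max_eq_right_iff.1 t1], by linarith [max_eq_right_iff.1 t2]⟩


namespace IsStable

variable {c} {θ r P S : ℝ → ℝ}

/-- A stable orbit as a function of the angle. -/
theorem exists_angle_param (h : c.IsStable θ r P S) : ∃ T : ℝ → ℝ, (∀ t, T (θ t) = t) ∧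
    (∀ u, θ (T u) = u) ∧ StrictMono T ∧
    (∀ u ≥ θ 0, HasDerivAt (fun u => r (T u)) (-c.slopeR u (r (T u)) (P (T u))) u) ∧
    ∀ u ≥ θ 0, HasDerivAt (fun u => P (T u)) (-c.slopeP u (r (T u)) (P (T u))) u := by
  obtain ⟨T, hT1, hT2, hT3, hT4⟩ := exists_inverse h.hθ h.deriv_theta_pos h.tendsto_theta
    h.tendsto_theta_atBot
  refine ⟨T, hT2, hT1, hT3, fun u hu => ?_, fun u hu => ?_⟩
  · have h0 : 0 ≤ T u := by rw [← hT2 0]; exact hT3.monotone hu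
    have := (h.hr (T u)).comp u (hT4 u)
    simp only [h.clamp_P h0, hT1] at this
    rw [slopeR, speed, neg_div', div_eq_mul_inv]
    exact this
  · have h0 : 0 ≤ T u := by rw [← hT2 0]; exact hT3.monotone hu
    have := (h.hP (T u)).comp u (hT4 u)
    simp only [h.clamp_P h0, hT1] at this
    rw [slopeP, speed, neg_div', div_eq_mul_inv]
    exact this

theorem not_lt_of_theta_eq {θ' r' P' S' : ℝ → ℝ} (h : c.IsStable θ r P S)
    (h' : c.IsStable θ' r' P' S') (h0 : θ 0 = θ' 0) : ¬P 0 < P' 0 := by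
  intro hlt
  obtain ⟨T, hTθ, hθT, hT, hR, hQ⟩ := h.exists_angle_param
  obtain ⟨T', hTθ', hθT', hT', hR', hQ'⟩ := h'.exists_angle_param
  rw [← h0] at hR' hQ'
  have hT0 : T (θ 0) = 0 := hTθ 0
  have hT0' : T' (θ 0) = 0 := by rw [h0]; exact hTθ' 0
  have hTn : ∀ u ≥ θ 0, 0 ≤ T u := fun u hu => hT0 ▸ hT.monotone hu
  have hTn' : ∀ u ≥ θ 0, 0 ≤ T' u := fun u hu => hT0' ▸ hT'.monotone hu
  have order : ∀ u ≥ θ 0, r' (T' u) ≤ r (T u) ∧ P (T u) ≤ P' (T' u) := by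
    intro u hu
    -- Momenta decrease, so their values at the right end bound them below on the whole interval.
    refine c.comparison (κ := min (P (T u)) (P' (T' u))) (u₀ := θ 0) (u₁ := u)
      (lt_min (h.P_pos (hTn u hu)) (h'.P_pos (hTn' u hu))) (fun v hv => hR v hv.1)
      (fun v hv => hR' v hv.1) (fun v hv => hQ v hv.1) (fun v hv => hQ' v hv.1)
      (fun v hv => ⟨(min_le_left _ _).trans (h.antitone_P (hT.monotone hv.2)),
        (h.P_lt_one (hTn v hv.1)).le⟩)
      (fun v hv => ⟨(min_le_right _ _).trans (h'.antitone_P (hT'.monotone hv.2)),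
        (h'.P_lt_one (hTn' v hv.1)).le⟩) ?_ ?_ u ⟨hu, le_rfl⟩
    · simp only [hT0, hT0', h.r_zero, h'.r_zero, le_refl]
    · simp only [hT0, hT0']; exact hlt.le
  -- If the heights always agreed, so would their derivatives; but `P < P'` just after the start,
  -- and `slopeR` is strictly increasing in the momentum away from the zeros of the sine.
  have strict : ∃ u ≥ θ 0, r' (T' u) < r (T u) := by
    by_contra! hcon
    have heq : ∀ u ≥ θ 0, r (T u) = r' (T' u) := fun u hu => le_antisymm (hcon u hu) (order u hu).1
    have hc1 := (hQ (θ 0) le_rfl).continuousAt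
    have hc2 := (hQ' (θ 0) le_rfl).continuousAt
    have hev : ∀ᶠ u in 𝓝 (θ 0), P (T u) < P' (T' u) := by
      refine hc1.eventually_lt hc2 ?_
      simp only [hT0, hT0']; exact hlt
    obtain ⟨δ, hδ, hb⟩ := Metric.eventually_nhds_iff.1 hev
    have hsin : ∀ u > θ 0, u < θ 0 + δ → Real.sin u = 0 := by
      intro u hu hu'
      by_contra hne
      have e1 : HasDerivAt (fun u => r (T u)) (-c.slopeR u (r' (T' u)) (P' (T' u))) u := by
        refine (hR' u hu.le).congr_of_eventuallyEq ?_
        filter_upwards [lt_mem_nhds hu] with v hv using heq v hv.le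
      have e2 := (hR u hu.le).unique e1
      rw [← heq u hu.le] at e2
      have e3 := c.slopeR_strictMono (r := r (T u)) hne (h.P_pos (hTn u hu.le))
        (hb (by rw [Real.dist_eq, abs_of_pos (by linarith)]; linarith))
        (h'.P_lt_one (hTn' u hu.le)).le
      linarith
    set d := min δ 1 with hd
    have hd0 : 0 < d := lt_min hδ one_pos
    have hdδ : d ≤ δ := min_le_left _ _
    have hd1 : d ≤ 1 := min_le_right _ _
    have s1 := hsin (θ 0 + d / 3) (by linarith) (by linarith)
    have s2 := hsin (θ 0 + d / 3 + d / 3) (by linarith) (by linarith)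
    have s3 : Real.sin (d / 3) = 0 := by
      have := Real.sin_sub (θ 0 + d / 3 + d / 3) (θ 0 + d / 3)
      rw [s1, s2] at this
      simpa using this
    exact (Real.sin_pos_of_pos_of_lt_pi (by positivity) (by linarith [Real.pi_gt_three])).ne' s3
  obtain ⟨u₁, hu₁, hlt₁⟩ := strict
  have ha := c.a_pos
  have hB := c.B_pos
  have hC := c.C_pos
  set M := 4 * (2 + c.B * c.C) with hM
  set k := M * (3 / (2 * c.a)) with hk
  -- The gap shrinks at relative rate at most `M x` with `x = P / width`, and `M x ≤ k · slopeR`,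
  -- which is `-k` times the derivative of the height. So the gap stays above a positive constant,
  -- whereas `r → 0` and `r' ≥ 0`.
  have hmono : MonotoneOn (fun u => (r (T u) - r' (T' u)) * Real.exp (-k * r (T u)))
      (Ici u₁) := by
    refine monotoneOn_of_hasDerivAt (convex_Ici _) (fun u hu =>
      ((hR u (hu₁.trans hu)).sub (hR' u (hu₁.trans hu))).mul
        (((hR u (hu₁.trans hu)).const_mul (-k)).exp)) fun u hu => ?_
    have hu0 : θ 0 ≤ u := hu₁.trans hu
    have p1 := h.P_pos (hTn u hu0)
    have l1 := (h.P_lt_one (hTn u hu0)).le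
    have l2 := (h'.P_lt_one (hTn' u hu0)).le
    obtain ⟨o1, o2⟩ := order u hu0
    have w1 := le_width (θ := u) p1.le l1
    simp only [Pi.sub_apply]
    set x := P (T u) / width u (P (T u)) with hx
    have hx0 : 0 ≤ x := div_nonneg p1.le (width_nonneg _ _)
    have e1 := c.slopeR_mono u (r' (T' u)) p1 o2 l2
    have e2 := c.abs_slopeR_sub_le' u (r (T u)) (r' (T' u)) p1 l1
    rw [abs_of_nonneg (show 0 ≤ r (T u) - r' (T' u) by linarith)] at e2
    have e3 := (le_abs_self _).trans e2
    have e4 : 2 * c.a / 3 * x ≤ c.slopeR u (r (T u)) (P (T u)) := by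
      have hs := c.width_half_le_speed u (r (T u)) p1 l1
      have hs0 := c.speed_pos u (r (T u)) p1 l1
      calc 2 * c.a / 3 * x = c.a * P (T u) / (3 / 2 * width u (P (T u))) := by
            rw [hx]; field_simp
        _ ≤ _ := by
            unfold slopeR
            have := c.lam_pos (r (T u))
            have := c.a_le_lam (r (T u))
            gcongr
            exact hs.2
    have e5 : M * x ≤ k * c.slopeR u (r (T u)) (P (T u)) := by
      have hk0 : 0 ≤ k := by positivity
      have := mul_le_mul_of_nonneg_left e4 hk0
      have e6 : k * (2 * c.a / 3 * x) = M * x := by rw [hk]; field_simp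
      linarith
    have e7 := mul_le_mul_of_nonneg_right e5 (show 0 ≤ r (T u) - r' (T' u) by linarith)
    have e8 : 0 ≤ -c.slopeR u (r (T u)) (P (T u)) - -c.slopeR u (r' (T' u)) (P' (T' u)) +
        k * c.slopeR u (r (T u)) (P (T u)) * (r (T u) - r' (T' u)) := by linarith
    have e9 := mul_nonneg e8 (Real.exp_pos (-k * r (T u))).le
    linarith
  set z := (r (T u₁) - r' (T' u₁)) * Real.exp (-k * r (T u₁)) with hz
  have hz0 : 0 < z := mul_pos (by linarith) (Real.exp_pos _)
  have hk0 : 0 ≤ k := by positivity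
  have hlow : ∀ u ≥ u₁, z ≤ r (T u) := by
    intro u hu
    have h1 : z ≤ (r (T u) - r' (T' u)) * Real.exp (-k * r (T u)) := hmono self_mem_Ici hu hu
    have hu0 : θ 0 ≤ u := hu₁.trans hu
    have h2 := (order u hu0).1
    have h3 := h'.r_nonneg _ (hTn' u hu0)
    have h4 := h.r_nonneg _ (hTn u hu0)
    have h5 : Real.exp (-k * r (T u)) ≤ 1 := Real.exp_le_one_iff.2 (by nlinarith)
    calc z ≤ _ := h1
      _ ≤ (r (T u) - r' (T' u)) * 1 := by gcongr
      _ ≤ r (T u) := by linarith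
  obtain ⟨t, ht1, ht2⟩ := ((h.tendsto_r.eventually (gt_mem_nhds hz0)).and
    (h.tendsto_theta.eventually (eventually_ge_atTop u₁))).exists
  have := hlow _ ht2
  rw [hTθ] at this
  linarith

/-- For each starting angle there is at most one stable orbit. -/
theorem P_zero_eq {θ' r' P' S' : ℝ → ℝ} (h : c.IsStable θ r P S)
    (h' : c.IsStable θ' r' P' S') (h0 : θ 0 = θ' 0) : P 0 = P' 0 :=
  le_antisymm (not_lt.1 (h'.not_lt_of_theta_eq h h0.symm)) (not_lt.1 (h.not_lt_of_theta_eq h' h0))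

end IsStable

end Collar

/-! ### Shooting: existence, continuity and periodicity of the stable momentum. -/

namespace Collar

variable {l : ℝ → ℝ} {c : Collar l}

namespace IsOrbit

variable {θ r P S : ℝ → ℝ} (h : c.IsOrbit θ r P S)
include h

/-- In the clamped system `r` is frozen once `P < 0`, and `P` is frozen once `r ≤ 0` because `mu`
vanishes there. So `P` can turn negative neither below height `0` nor before the orbit gets there.
-/
theorem P_nonneg_of_r_nonpos (hP : 0 ≤ P 0) {t : ℝ} (ht : 0 ≤ t) (hr : r t ≤ 0) : 0 ≤ P t := by
  by_contra! hneg
  obtain ⟨u, hu, hPu⟩ := intermediate_value_Icc' ht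
    (fun s _ => (h.hP s).continuousAt.continuousWithinAt)
    (show P t / 2 ∈ Icc (P t) (P 0) from ⟨by linarith, by linarith⟩)
  have h1 : MonotoneOn r (Ici u) := by
    refine monotoneOn_of_hasDerivAt (convex_Ici _) (fun v _ => h.hr v) fun v hv => ?_
    rw [clamp_of_nonpos ((h.antitone_P hv).trans (by linarith))]
    simp
  have h2 : r u ≤ 0 := (h1 self_mem_Ici hu.2 hu.2).trans hr
  have h3 : MonotoneOn P (Ici u) := by
    refine monotoneOn_of_hasDerivAt (convex_Ici _) (fun v _ => h.hP v) fun v hv => ?_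
    rw [mu, clamp_of_nonpos ((h.antitone_r hv).trans h2), c.deriv_zero]
    simp
  have h4 := h3 self_mem_Ici hu.2 hu.2
  linarith

theorem shift : c.IsOrbit (fun t => θ t + 2 * Real.pi) r P S where
  hθ t := by
    have := (h.hθ t).add_const (2 * Real.pi)
    simpa [width] using this
  hr := h.hr
  hP t := by simpa using h.hP t
  hS t := by simpa [width] using h.hS t

end IsOrbit

theorem IsStable.shift {θ r P S : ℝ → ℝ} (h : c.IsStable θ r P S) :
    c.IsStable (fun t => θ t + 2 * Real.pi) r P S :=
  { h.toIsOrbit.shift with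
    r_zero := h.r_zero
    P_zero_pos := h.P_zero_pos
    P_zero_lt := h.P_zero_lt
    r_nonneg := h.r_nonneg
    threshold_le_P := h.threshold_le_P }

variable (c)

/-- The orbit issuing from the outer boundary of the collar with angle `q.1` and vertical momentum
`q.2`. -/
noncomputable def orbit (q : ℝ × ℝ) (t : ℝ) : ℝ × ℝ × ℝ × ℝ := c.flow (q.1, c.ε, q.2, 0) t

/-- Stability of the orbit with initial data `q`. -/
def Stable (q : ℝ × ℝ) : Prop := c.IsStable (fun t => (c.orbit q t).1) (fun t => (c.orbit q t).2.1)
  (fun t => (c.orbit q t).2.2.1) (fun t => (c.orbit q t).2.2.2)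

theorem orbit_zero (q : ℝ × ℝ) : c.orbit q 0 = (q.1, c.ε, q.2, 0) := c.flow_zero _

theorem continuous_orbit : Continuous fun p : (ℝ × ℝ) × ℝ => c.orbit p.1 p.2 :=
  c.continuous_flow.comp (by fun_prop : Continuous fun p : (ℝ × ℝ) × ℝ =>
    ((p.1.1, c.ε, p.1.2, (0 : ℝ)), p.2))

theorem isOrbit_orbit (q : ℝ × ℝ) : c.IsOrbit (fun t => (c.orbit q t).1)
    (fun t => (c.orbit q t).2.1) (fun t => (c.orbit q t).2.2.1) (fun t => (c.orbit q t).2.2.2) :=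
  c.isOrbit_flow _

/-- Initial data of the orbits which cross height `0`. -/
def crossing : Set (ℝ × ℝ) := {q | ∃ t ≥ 0, (c.orbit q t).2.1 < 0}

/-- Initial data of the orbits which drop below the threshold. -/
def dropping : Set (ℝ × ℝ) := {q | ∃ t ≥ 0, 0 < (c.orbit q t).2.1 ∧
  (c.orbit q t).2.2.1 < c.threshold (c.orbit q t).2.1}

theorem continuous_orbit_left (t : ℝ) : Continuous fun q => c.orbit q t :=
  c.continuous_orbit.comp (by fun_prop : Continuous fun q : ℝ × ℝ => (q, t))

theorem isOpen_crossing : IsOpen c.crossing := by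
  have : c.crossing = ⋃ t ∈ Ici (0 : ℝ), {q | (c.orbit q t).2.1 < 0} := by
    ext q; simp [crossing]
  rw [this]
  refine isOpen_biUnion fun t _ => isOpen_lt ?_ continuous_const
  have := c.continuous_orbit_left t
  fun_prop

theorem isOpen_dropping : IsOpen c.dropping := by
  have : c.dropping = ⋃ t ∈ Ici (0 : ℝ), ({q | 0 < (c.orbit q t).2.1} ∩
      {q | (c.orbit q t).2.2.1 < c.threshold (c.orbit q t).2.1}) := by
    ext q; simp [dropping, and_left_comm]
  rw [this]
  have h1 := c.continuous_threshold
  refine isOpen_biUnion fun t _ => ?_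
  have := c.continuous_orbit_left t
  exact (isOpen_lt continuous_const (by fun_prop)).inter (isOpen_lt (by fun_prop) (by fun_prop))

/-- After the drop the height stays positive by `pos_of_lt_threshold`; before it the height was at
least as large. -/
theorem disjoint_dropping_crossing {q : ℝ × ℝ} (hd : q ∈ c.dropping) : q ∉ c.crossing := by
  rintro ⟨t, ht, hneg⟩
  obtain ⟨u, hu, hpos, hlt⟩ := hd
  have h := c.isOrbit_orbit q
  have hε : (c.orbit q u).2.1 ≤ c.ε := by
    have := h.antitone_r hu
    simpa [c.orbit_zero] using this
  rcases le_total u t with hut | htu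
  · exact absurd hneg (not_lt.2 (h.pos_of_lt_threshold hpos hε hlt t hut).le)
  · have : (c.orbit q u).2.1 ≤ (c.orbit q t).2.1 := h.antitone_r htu
    linarith

theorem stable_of_notMem {q : ℝ × ℝ} (h0 : 0 < q.2) (h1 : q.2 < 1) (hc : q ∉ c.crossing)
    (hd : q ∉ c.dropping) : c.Stable q := by
  have hr : ∀ t ≥ 0, 0 ≤ (c.orbit q t).2.1 := fun t ht => by
    by_contra! hlt
    exact hc ⟨t, ht, hlt⟩
  refine { c.isOrbit_orbit q with
    r_zero := by simp [c.orbit_zero]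
    P_zero_pos := by simpa [c.orbit_zero] using h0
    P_zero_lt := by simpa [c.orbit_zero] using h1
    r_nonneg := hr
    threshold_le_P := fun t ht => ?_ }
  by_contra! hlt
  -- Height exactly `0` is not covered by `dropping`; there the threshold is `0` and `P ≥ 0` holds
  -- by the clamped dynamics.
  rcases (hr t ht).eq_or_lt with h2 | h2
  · have h3 := (c.isOrbit_orbit q).P_nonneg_of_r_nonpos (by simpa [c.orbit_zero] using h0.le) ht
      h2.ge
    simp only [← h2, c.threshold_zero] at hlt
    linarith
  · exact hd ⟨t, ht, h2, hlt⟩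

theorem Stable.notMem_crossing {c : Collar l} {q : ℝ × ℝ} (h : c.Stable q) : q ∉ c.crossing := by
  rintro ⟨t, ht, hlt⟩
  exact absurd hlt (not_lt.2 (h.r_nonneg t ht))

theorem Stable.notMem_dropping {c : Collar l} {q : ℝ × ℝ} (h : c.Stable q) : q ∉ c.dropping := by
  rintro ⟨t, ht, -, hlt⟩
  exact absurd hlt (not_lt.2 (h.threshold_le_P t ht))

theorem mem_dropping_of_lt {q : ℝ × ℝ} (h : q.2 < c.threshold c.ε) : q ∈ c.dropping :=
  ⟨0, le_rfl, by simpa [c.orbit_zero] using ⟨c.ε_pos, h⟩⟩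

theorem mem_crossing_of_lt {q : ℝ × ℝ} (h : c.K * c.ε < q.2) (h1 : q.2 ≤ 1) :
    q ∈ c.crossing :=
  (c.isOrbit_orbit q).exists_neg_of_steep (t₁ := 0) (by simpa [c.orbit_zero] using h1)
    (by simpa [c.orbit_zero] using h)

/-- A connected set of vertical momenta without stable orbits does not meet both open sets. -/
theorem not_dropping_and_crossing (θ₀ : ℝ) {I : Set ℝ} (hI : IsPreconnected I)
    (hsub : ∀ p ∈ I, (θ₀, p) ∈ c.dropping ∪ c.crossing) {p q : ℝ} (hp : p ∈ I) (hq : q ∈ I)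
    (hpd : (θ₀, p) ∈ c.dropping) (hqc : (θ₀, q) ∈ c.crossing) : False := by
  have hcont : Continuous fun p : ℝ => (θ₀, p) := by fun_prop
  obtain ⟨x, -, hx1, hx2⟩ := hI _ _ (c.isOpen_dropping.preimage hcont)
    (c.isOpen_crossing.preimage hcont) hsub ⟨p, hp, hpd⟩ ⟨q, hq, hqc⟩
  exact c.disjoint_dropping_crossing hx1 hx2

/-- Momenta below `threshold ε` drop and momenta between `K ε` and `1` cross. The interval is
connected, so it is not covered by these two disjoint open conditions. -/
theorem exists_stable (θ₀ : ℝ) : ∃ p, p ∈ Ioo (0 : ℝ) 1 ∧ c.Stable (θ₀, p) := by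
  by_contra! hcon
  have ht := c.threshold_pos c.ε_pos
  have ht2 := c.threshold_le c.ε
  have hK := c.K_lt
  have hKε := mul_pos c.K_pos c.ε_pos
  refine c.not_dropping_and_crossing θ₀ (isPreconnected_Ioo (a := (0 : ℝ)) (b := 1))
    (p := c.threshold c.ε / 2) (q := (c.K * c.ε + 1) / 2) (fun p hp => ?_)
    ⟨by linarith, by linarith⟩ ⟨by linarith, by linarith⟩
    (c.mem_dropping_of_lt (by dsimp only; linarith))
    (c.mem_crossing_of_lt (by dsimp only; linarith) (by dsimp only; linarith))
  by_contra hn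
  rw [mem_union, not_or] at hn
  exact hcon p hp (c.stable_of_notMem hp.1 hp.2 hn.2 hn.1)

/-- The vertical momentum of the stable orbit with given starting angle. -/
noncomputable def momentum (θ₀ : ℝ) : ℝ := (c.exists_stable θ₀).choose

theorem momentum_mem (θ₀ : ℝ) : c.momentum θ₀ ∈ Ioo (0 : ℝ) 1 :=
  (c.exists_stable θ₀).choose_spec.1

theorem stable_momentum (θ₀ : ℝ) : c.Stable (θ₀, c.momentum θ₀) :=
  (c.exists_stable θ₀).choose_spec.2

theorem eq_momentum {θ₀ p : ℝ} (h : c.Stable (θ₀, p)) : p = c.momentum θ₀ := by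
  have := h.P_zero_eq (c.stable_momentum θ₀) (by simp [c.orbit_zero])
  simpa [c.orbit_zero] using this

theorem mem_dropping_or_crossing {θ₀ p : ℝ} (hp : p ∈ Ioo (0 : ℝ) 1) (hne : p ≠ c.momentum θ₀) :
    (θ₀, p) ∈ c.dropping ∪ c.crossing := by
  by_contra hn
  rw [mem_union, not_or] at hn
  exact hne (c.eq_momentum (c.stable_of_notMem hp.1 hp.2 hn.2 hn.1))

/-- By uniqueness there is no stable momentum below the chosen one, so that connected interval lies
on a single side, and its small elements drop. -/
theorem mem_dropping_of_lt_momentum {θ₀ p : ℝ} (hp : 0 < p) (h : p < c.momentum θ₀) :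
    (θ₀, p) ∈ c.dropping := by
  have hm := c.momentum_mem θ₀
  have ht := c.threshold_pos c.ε_pos
  have hsub : ∀ x ∈ Ioo 0 (c.momentum θ₀), (θ₀, x) ∈ c.dropping ∪ c.crossing := fun x hx =>
    c.mem_dropping_or_crossing ⟨hx.1, hx.2.trans hm.2⟩ hx.2.ne
  refine (hsub p ⟨hp, h⟩).resolve_right fun hcr => ?_
  refine c.not_dropping_and_crossing θ₀ isPreconnected_Ioo
    (p := min p (c.threshold c.ε / 2)) hsub ⟨by positivity, (min_le_left _ _).trans_lt h⟩ ⟨hp, h⟩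
    (c.mem_dropping_of_lt ?_) hcr
  exact (min_le_right _ _).trans_lt (by linarith)

theorem mem_crossing_of_momentum_lt {θ₀ p : ℝ} (hp : p < 1) (h : c.momentum θ₀ < p) :
    (θ₀, p) ∈ c.crossing := by
  have hm := c.momentum_mem θ₀
  have hK := c.K_lt
  have hsub : ∀ x ∈ Ioo (c.momentum θ₀) 1, (θ₀, x) ∈ c.dropping ∪ c.crossing := fun x hx =>
    c.mem_dropping_or_crossing ⟨hm.1.trans hx.1, hx.2⟩ hx.1.ne'
  refine (hsub p ⟨h, hp⟩).resolve_left fun hdr => ?_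
  refine c.not_dropping_and_crossing θ₀ isPreconnected_Ioo
    (q := max p ((c.K * c.ε + 1) / 2)) hsub ⟨h, hp⟩
    ⟨h.trans_le (le_max_left _ _), max_lt hp (by linarith)⟩ hdr
    (c.mem_crossing_of_lt ?_ (max_lt hp (by linarith)).le)
  exact lt_max_of_lt_right (by linarith)

/-- For `0 < a < 1`, `a < momentum θ` means that `(θ, a)` drops and `momentum θ < a` that it
crosses; both are open conditions on `θ`. -/
theorem continuous_momentum : Continuous c.momentum := by
  refine continuous_iff_continuousAt.2 fun θ₀ => tendsto_order.2 ⟨fun a ha => ?_, fun a ha => ?_⟩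
  · rcases le_or_gt a 0 with h0 | h0
    · exact Eventually.of_forall fun θ => h0.trans_lt (c.momentum_mem θ).1
    · have hopen := c.isOpen_dropping.preimage (by fun_prop : Continuous fun θ : ℝ => (θ, a))
      filter_upwards [hopen.mem_nhds (c.mem_dropping_of_lt_momentum h0 ha)] with θ hθ
      by_contra! hle
      rcases hle.eq_or_lt with he | hlt
      · subst he; exact (c.stable_momentum θ).notMem_dropping hθ
      · exact c.disjoint_dropping_crossing hθ
          (c.mem_crossing_of_momentum_lt (ha.trans (c.momentum_mem θ₀).2) hlt)
  · rcases le_or_gt 1 a with h0 | h0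
    · exact Eventually.of_forall fun θ => (c.momentum_mem θ).2.trans_le h0
    · have hopen := c.isOpen_crossing.preimage (by fun_prop : Continuous fun θ : ℝ => (θ, a))
      filter_upwards [hopen.mem_nhds (c.mem_crossing_of_momentum_lt h0 ha)] with θ hθ
      by_contra! hle
      rcases hle.eq_or_lt with he | hlt
      · subst he; exact (c.stable_momentum θ).notMem_crossing hθ
      · exact c.disjoint_dropping_crossing
          (c.mem_dropping_of_lt_momentum ((c.momentum_mem θ₀).1.trans ha) hlt) hθ

theorem orbit_shift (θ₀ p t : ℝ) : c.orbit (θ₀ + 2 * Real.pi, p) t =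
    ((c.orbit (θ₀, p) t).1 + 2 * Real.pi, (c.orbit (θ₀, p) t).2) := by
  have := congrFun (c.flow_eq_of_isOrbit (c.isOrbit_orbit (θ₀, p)).shift) t
  simp only [c.orbit_zero] at this
  exact this

/-- The system is `2π`-periodic in the angle and the stable momentum is unique. -/
theorem momentum_periodic : Function.Periodic c.momentum (2 * Real.pi) := by
  intro θ₀
  refine (c.eq_momentum ?_).symm
  have := (c.stable_momentum θ₀).shift
  unfold Stable
  simp only [c.orbit_shift]
  exact this

end Collar

/-! ### Stable orbits parametrized by arclength. -/

/-- The geodesic field in arclength, in the coordinates `(θ, r, P)`. -/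
noncomputable def arcField (l : ℝ → ℝ) (y : ℝ × ℝ × ℝ) : ℝ × ℝ × ℝ :=
  ((width y.1 y.2.2 + 2 * deriv l y.2.1 * (Real.cos y.1 * Real.sin y.1 * y.2.2)) /
      (l y.2.1 ^ 2 * width y.1 y.2.2 ^ 2),
    -(l y.2.1 * y.2.2) / (l y.2.1 ^ 2 * width y.1 y.2.2 ^ 2),
    -(2 * deriv l y.2.1 * ((1 - y.2.2 ^ 2) * Real.sin y.1 ^ 2)) /
      (l y.2.1 ^ 2 * width y.1 y.2.2 ^ 2))

theorem width_arg_pos {θ P : ℝ} (h : P ≠ 0) : 0 < Real.sin θ ^ 2 + (P * Real.cos θ) ^ 2 := by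
  by_cases hc : Real.cos θ = 0
  · have := Real.sin_sq_add_cos_sq θ
    rw [hc] at this ⊢
    nlinarith
  · have := mul_ne_zero h hc
    positivity

theorem width_pos_of_ne_zero {θ P : ℝ} (h : P ≠ 0) : 0 < width θ P :=
  Real.sqrt_pos.2 (width_arg_pos h)

theorem contDiffOn_arcField {l : ℝ → ℝ} (hl : ContDiff ℝ ∞ l) (hpos : ∀ r, 0 < l r) :
    ContDiffOn ℝ ∞ (arcField l) {y | 0 < y.2.2} := by
  intro y hy
  have hy' : y.2.2 ≠ 0 := ne_of_gt hy
  have hd : ContDiff ℝ ∞ (deriv l) := by simpa using hl.iterate_deriv 1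
  have f1 : ContDiffAt ℝ ∞ (fun y : ℝ × ℝ × ℝ => y.1) y := contDiffAt_fst
  have f2 : ContDiffAt ℝ ∞ (fun y : ℝ × ℝ × ℝ => y.2.1) y := contDiffAt_fst.comp y contDiffAt_snd
  have f3 : ContDiffAt ℝ ∞ (fun y : ℝ × ℝ × ℝ => y.2.2) y := contDiffAt_snd.comp y contDiffAt_snd
  have hs : ContDiffAt ℝ ∞ (fun y : ℝ × ℝ × ℝ => Real.sin y.1) y :=
    Real.contDiff_sin.contDiffAt.comp y f1
  have hc : ContDiffAt ℝ ∞ (fun y : ℝ × ℝ × ℝ => Real.cos y.1) y :=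
    Real.contDiff_cos.contDiffAt.comp y f1
  have hw : ContDiffAt ℝ ∞ (fun y : ℝ × ℝ × ℝ => width y.1 y.2.2) y :=
    ((hs.pow 2).add ((f3.mul hc).pow 2)).sqrt (width_arg_pos hy').ne'
  have h1 : ContDiffAt ℝ ∞ (fun y : ℝ × ℝ × ℝ => l y.2.1) y := hl.contDiffAt.comp y f2
  have h2 : ContDiffAt ℝ ∞ (fun y : ℝ × ℝ × ℝ => deriv l y.2.1) y := hd.contDiffAt.comp y f2
  have hden : l y.2.1 ^ 2 * width y.1 y.2.2 ^ 2 ≠ 0 := by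
    have := hpos y.2.1
    have := width_pos_of_ne_zero (θ := y.1) hy'
    positivity
  have hd2 := (h1.pow 2).mul (hw.pow 2)
  have g1 := (hw.add ((contDiffAt_const (c := (2 : ℝ))).mul h2 |>.mul ((hc.mul hs).mul f3))).div
    hd2 hden
  have g2 := (h1.mul f3).neg.div hd2 hden
  have g3 := (((contDiffAt_const (c := (2 : ℝ))).mul h2).mul
    ((contDiffAt_const (c := (1 : ℝ)) |>.sub (f3.pow 2)).mul (hs.pow 2))).neg.div hd2 hden
  exact (g1.prodMk (g2.prodMk g3)).contDiffWithinAt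

namespace Collar

variable {l : ℝ → ℝ} (c : Collar l)

/-- The stable orbit with starting angle `θ₀`. -/
noncomputable def stableOrbit (θ₀ t : ℝ) : ℝ × ℝ × ℝ × ℝ := c.orbit (θ₀, c.momentum θ₀) t

theorem isStable_stableOrbit (θ₀ : ℝ) : c.IsStable (fun t => (c.stableOrbit θ₀ t).1)
    (fun t => (c.stableOrbit θ₀ t).2.1) (fun t => (c.stableOrbit θ₀ t).2.2.1)
    (fun t => (c.stableOrbit θ₀ t).2.2.2) := c.stable_momentum θ₀

theorem stableOrbit_zero (θ₀ : ℝ) : c.stableOrbit θ₀ 0 = (θ₀, c.ε, c.momentum θ₀, 0) :=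
  c.orbit_zero _

theorem continuous_stableOrbit : Continuous fun q : ℝ × ℝ => c.stableOrbit q.1 q.2 := by
  have := c.continuous_momentum
  exact c.continuous_orbit.comp (by fun_prop : Continuous fun q : ℝ × ℝ =>
    ((q.1, c.momentum q.1), q.2))

theorem exists_arcTime (θ₀ : ℝ) : ∃ T : ℝ → ℝ, (∀ u, (c.stableOrbit θ₀ (T u)).2.2.2 = u) ∧
    (∀ t, T (c.stableOrbit θ₀ t).2.2.2 = t) ∧ StrictMono T ∧
    ∀ u, HasDerivAt T (c.lam (c.stableOrbit θ₀ (T u)).2.1 ^ 2 *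
      width (c.stableOrbit θ₀ (T u)).1 (clamp 1 (c.stableOrbit θ₀ (T u)).2.2.1) ^ 2)⁻¹ u := by
  have h := c.isStable_stableOrbit θ₀
  exact exists_inverse h.hS (fun t => by
    have := c.lam_pos (c.stableOrbit θ₀ t).2.1
    have := h.width_pos t
    positivity) h.tendsto_S h.tendsto_S_atBot

/-- The time at which the stable orbit has a given arclength. -/
noncomputable def arcTime (θ₀ : ℝ) : ℝ → ℝ := (c.exists_arcTime θ₀).choose

theorem arclength_arcTime (θ₀ u : ℝ) : (c.stableOrbit θ₀ (c.arcTime θ₀ u)).2.2.2 = u :=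
  (c.exists_arcTime θ₀).choose_spec.1 u

theorem arcTime_arclength (θ₀ t : ℝ) : c.arcTime θ₀ (c.stableOrbit θ₀ t).2.2.2 = t :=
  (c.exists_arcTime θ₀).choose_spec.2.1 t

theorem strictMono_arcTime (θ₀ : ℝ) : StrictMono (c.arcTime θ₀) :=
  (c.exists_arcTime θ₀).choose_spec.2.2.1

theorem hasDerivAt_arcTime (θ₀ u : ℝ) : HasDerivAt (c.arcTime θ₀)
    (c.lam (c.stableOrbit θ₀ (c.arcTime θ₀ u)).2.1 ^ 2 *
      width (c.stableOrbit θ₀ (c.arcTime θ₀ u)).1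
        (clamp 1 (c.stableOrbit θ₀ (c.arcTime θ₀ u)).2.2.1) ^ 2)⁻¹ u :=
  (c.exists_arcTime θ₀).choose_spec.2.2.2 u

theorem arcTime_zero (θ₀ : ℝ) : c.arcTime θ₀ 0 = 0 := by
  have := c.arcTime_arclength θ₀ 0
  rwa [c.stableOrbit_zero] at this

theorem arcTime_pos (θ₀ : ℝ) {u : ℝ} (hu : 0 < u) : 0 < c.arcTime θ₀ u := by
  rw [← c.arcTime_zero θ₀]; exact c.strictMono_arcTime θ₀ hu

theorem lt_arcTime_iff {θ₀ u t : ℝ} :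
    t < c.arcTime θ₀ u ↔ (c.stableOrbit θ₀ t).2.2.2 < u := by
  conv_lhs => rw [← c.arcTime_arclength θ₀ t]
  exact (c.strictMono_arcTime θ₀).lt_iff_lt

theorem arcTime_lt_iff {θ₀ u t : ℝ} :
    c.arcTime θ₀ u < t ↔ u < (c.stableOrbit θ₀ t).2.2.2 := by
  conv_lhs => rw [← c.arcTime_arclength θ₀ t]
  exact (c.strictMono_arcTime θ₀).lt_iff_lt

/-- Joint continuity of an inverse: by monotonicity, `arcTime` lies above or below a given `t`
according to a strict inequality between `u` and the arclength at `t`, which is open in `(θ₀, u)`.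
-/
theorem continuous_arcTime : Continuous fun q : ℝ × ℝ => c.arcTime q.1 q.2 := by
  have hS : ∀ t : ℝ, Continuous fun q : ℝ × ℝ => (c.stableOrbit q.1 t).2.2.2 := fun t => by
    have := c.continuous_stableOrbit.comp (by fun_prop : Continuous fun q : ℝ × ℝ => (q.1, t))
    simp only [Function.comp_def] at this
    fun_prop
  refine continuous_iff_continuousAt.2 fun q => tendsto_order.2 ⟨fun a ha => ?_, fun a ha => ?_⟩
  · filter_upwards [(isOpen_lt (hS a) continuous_snd).mem_nhds (c.lt_arcTime_iff.1 ha)] with p hp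
    exact c.lt_arcTime_iff.2 hp
  · filter_upwards [(isOpen_lt continuous_snd (hS a)).mem_nhds (c.arcTime_lt_iff.1 ha)] with p hp
    exact c.arcTime_lt_iff.2 hp

/-- The stable orbit `(θ, r, P)` parametrized by arclength. -/
noncomputable def arc (θ₀ u : ℝ) : ℝ × ℝ × ℝ :=
  ((c.stableOrbit θ₀ (c.arcTime θ₀ u)).1, (c.stableOrbit θ₀ (c.arcTime θ₀ u)).2.1,
    (c.stableOrbit θ₀ (c.arcTime θ₀ u)).2.2.1)

theorem continuous_arc : Continuous fun q : ℝ × ℝ => c.arc q.1 q.2 := by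
  have h1 := c.continuous_arcTime
  have := c.continuous_stableOrbit.comp
    (by fun_prop : Continuous fun q : ℝ × ℝ => (q.1, c.arcTime q.1 q.2))
  simp only [Function.comp_def] at this
  unfold arc
  fun_prop

theorem arc_zero (θ₀ : ℝ) : c.arc θ₀ 0 = (θ₀, c.ε, c.momentum θ₀) := by
  rw [arc, c.arcTime_zero, c.stableOrbit_zero]

/-- Stable orbits stay inside the clamping ranges at nonnegative times, so here the clamped field is
the true one. -/
theorem hasDerivAt_arc (θ₀ : ℝ) {u : ℝ} (hu : 0 < u) :
    HasDerivAt (c.arc θ₀) (arcField l (c.arc θ₀ u)) u := by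
  have h := c.isStable_stableOrbit θ₀
  have ht := (c.arcTime_pos θ₀ hu).le
  have hT := c.hasDerivAt_arcTime θ₀ u
  have h1 := (h.hθ (c.arcTime θ₀ u)).comp u hT
  have h2 := (h.hr (c.arcTime θ₀ u)).comp u hT
  have h3 := (h.hP (c.arcTime θ₀ u)).comp u hT
  have e1 := h.clamp_P ht
  have e2 := h.clamp_r ht
  simp only [mu, lam, e1, e2] at h1 h2 h3
  have := h1.prodMk (h2.prodMk h3)
  simp only [← div_eq_mul_inv] at this
  exact this

theorem arc_P_pos (θ₀ : ℝ) {u : ℝ} (hu : 0 ≤ u) : 0 < (c.arc θ₀ u).2.2 :=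
  (c.isStable_stableOrbit θ₀).P_pos
    (by rw [← c.arcTime_zero θ₀]; exact (c.strictMono_arcTime θ₀).monotone hu)

theorem arc_P_lt_one (θ₀ : ℝ) {u : ℝ} (hu : 0 ≤ u) : (c.arc θ₀ u).2.2 < 1 :=
  (c.isStable_stableOrbit θ₀).P_lt_one
    (by rw [← c.arcTime_zero θ₀]; exact (c.strictMono_arcTime θ₀).monotone hu)

theorem arc_r_pos (θ₀ : ℝ) {u : ℝ} (hu : 0 ≤ u) : 0 < (c.arc θ₀ u).2.1 :=
  (c.isStable_stableOrbit θ₀).r_pos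
    (by rw [← c.arcTime_zero θ₀]; exact (c.strictMono_arcTime θ₀).monotone hu)

theorem tendsto_arcTime (θ₀ : ℝ) : Tendsto (c.arcTime θ₀) atTop atTop := by
  refine tendsto_atTop.2 fun m => ?_
  filter_upwards [eventually_gt_atTop (c.stableOrbit θ₀ m).2.2.2] with u hu
  exact (c.lt_arcTime_iff.2 hu).le

theorem tendsto_arc_theta (θ₀ : ℝ) : Tendsto (fun u => (c.arc θ₀ u).1) atTop atTop :=
  (c.isStable_stableOrbit θ₀).tendsto_theta.comp (c.tendsto_arcTime θ₀)

theorem tendsto_arc_r (θ₀ : ℝ) : Tendsto (fun u => (c.arc θ₀ u).2.1) atTop (𝓝 0) :=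
  (c.isStable_stableOrbit θ₀).tendsto_r.comp (c.tendsto_arcTime θ₀)

theorem tendsto_arc_P (θ₀ : ℝ) : Tendsto (fun u => (c.arc θ₀ u).2.2) atTop (𝓝 0) :=
  (c.isStable_stableOrbit θ₀).tendsto_P.comp (c.tendsto_arcTime θ₀)

theorem arc_shift (θ₀ u : ℝ) : c.arc (θ₀ + 2 * Real.pi) u =
    ((c.arc θ₀ u).1 + 2 * Real.pi, (c.arc θ₀ u).2) := by
  have hs : ∀ t, c.stableOrbit (θ₀ + 2 * Real.pi) t =
      ((c.stableOrbit θ₀ t).1 + 2 * Real.pi, (c.stableOrbit θ₀ t).2) := fun t => by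
    rw [stableOrbit, c.momentum_periodic, c.orbit_shift]; rfl
  have hT : c.arcTime (θ₀ + 2 * Real.pi) u = c.arcTime θ₀ u := by
    have h1 := c.arcTime_arclength (θ₀ + 2 * Real.pi) (c.arcTime θ₀ u)
    rw [hs] at h1
    simp only [c.arclength_arcTime] at h1
    exact h1
  rw [arc, hT, hs]
  rfl

end Collar

/-! ### The profile curve -/

/-- The spherical angle as a function of `θ` and `P`. -/
noncomputable def sphericalAngle (y : ℝ × ℝ × ℝ) : ℝ :=
  Real.arccos (Real.sqrt (1 - y.2.2 ^ 2) * Real.cos y.1)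

section Angle

variable {y : ℝ × ℝ × ℝ}

theorem abs_sqrt_mul_cos_lt (h0 : 0 < y.2.2) (h1 : y.2.2 < 1) :
    |Real.sqrt (1 - y.2.2 ^ 2) * Real.cos y.1| < 1 := by
  rw [abs_mul, abs_of_nonneg (Real.sqrt_nonneg _)]
  have h2 : Real.sqrt (1 - y.2.2 ^ 2) < 1 := by
    rw [Real.sqrt_lt' one_pos]; nlinarith
  have := Real.abs_cos_le_one y.1
  nlinarith [Real.sqrt_nonneg (1 - y.2.2 ^ 2), abs_nonneg (Real.cos y.1)]

theorem cos_sphericalAngle (h0 : 0 < y.2.2) (h1 : y.2.2 < 1) :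
    Real.cos (sphericalAngle y) = Real.sqrt (1 - y.2.2 ^ 2) * Real.cos y.1 := by
  have := abs_lt.1 (abs_sqrt_mul_cos_lt h0 h1)
  exact Real.cos_arccos this.1.le this.2.le

theorem sin_sphericalAngle (h0 : 0 < y.2.2) (h1 : y.2.2 < 1) :
    Real.sin (sphericalAngle y) = width y.1 y.2.2 := by
  rw [sphericalAngle, Real.sin_arccos, width, mul_pow, Real.sq_sqrt (by nlinarith)]
  congr 1
  have := Real.sin_sq_add_cos_sq y.1
  linear_combination (-1 : ℝ) * this

theorem sphericalAngle_mem (h0 : 0 < y.2.2) (h1 : y.2.2 < 1) :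
    sphericalAngle y ∈ Ioo 0 Real.pi := by
  have := abs_lt.1 (abs_sqrt_mul_cos_lt h0 h1)
  exact ⟨Real.arccos_pos.2 this.2, Real.arccos_lt_pi.2 this.1⟩

theorem contDiffAt_sphericalAngle (h0 : 0 < y.2.2) (h1 : y.2.2 < 1) :
    ContDiffAt ℝ ∞ sphericalAngle y := by
  have h2 := abs_lt.1 (abs_sqrt_mul_cos_lt h0 h1)
  have f1 : ContDiffAt ℝ ∞ (fun y : ℝ × ℝ × ℝ => y.1) y := contDiffAt_fst
  have f3 : ContDiffAt ℝ ∞ (fun y : ℝ × ℝ × ℝ => y.2.2) y := contDiffAt_snd.comp y contDiffAt_snd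
  have g : ContDiffAt ℝ ∞ (fun y : ℝ × ℝ × ℝ => Real.sqrt (1 - y.2.2 ^ 2) * Real.cos y.1) y :=
    (((contDiffAt_const (c := (1 : ℝ))).sub (f3.pow 2)).sqrt (by nlinarith)).mul
      (Real.contDiff_cos.contDiffAt.comp y f1)
  exact (Real.contDiffAt_arccos h2.1.ne' h2.2.ne).comp y g

theorem continuous_sphericalAngle : Continuous sphericalAngle := by
  unfold sphericalAngle
  fun_prop

end Angle

/-! ### Momenta along the orbits and the geodesic equations. -/

section Momenta

variable {l : ℝ → ℝ} {y : ℝ → ℝ × ℝ × ℝ} {u : ℝ}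

theorem hasDerivAt_theta (hy : HasDerivAt y (arcField l (y u)) u) :
    HasDerivAt (fun v => (y v).1) (arcField l (y u)).1 u := hy.fst

theorem hasDerivAt_r (hy : HasDerivAt y (arcField l (y u)) u) :
    HasDerivAt (fun v => (y v).2.1) (arcField l (y u)).2.1 u := hy.snd.fst

theorem hasDerivAt_P (hy : HasDerivAt y (arcField l (y u)) u) :
    HasDerivAt (fun v => (y v).2.2) (arcField l (y u)).2.2 u := hy.snd.snd

theorem hasDerivAt_radius (hy : HasDerivAt y (arcField l (y u)) u) (h0 : 0 < (y u).2.2)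
    (h1 : (y u).2.2 < 1) : HasDerivAt (fun v => Real.sqrt (1 - (y v).2.2 ^ 2))
      ((y u).2.2 * (2 * deriv l (y u).2.1 * (Real.sqrt (1 - (y u).2.2 ^ 2) *
        Real.sin (y u).1 ^ 2)) / (l (y u).2.1 ^ 2 * width (y u).1 (y u).2.2 ^ 2)) u := by
  have hpos : 0 < 1 - (y u).2.2 ^ 2 := by nlinarith
  have h3 := ((((hasDerivAt_P hy).fun_pow 2).const_sub 1)).sqrt hpos.ne'
  refine h3.congr_deriv ?_
  have hR := Real.sqrt_pos.2 hpos
  have hR2 := Real.sq_sqrt hpos.le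
  set R := Real.sqrt (1 - (y u).2.2 ^ 2)
  simp only [arcField]
  field_simp
  simp only [← hR2]
  ring

/-- The change of the radius `√(1 - P²)` cancels the `deriv l` term of `θ'`, so `cos φ` changes only
through the width term. -/
theorem hasDerivAt_cos_mul (hy : HasDerivAt y (arcField l (y u)) u) (h0 : 0 < (y u).2.2)
    (h1 : (y u).2.2 < 1) :
    HasDerivAt (fun v => Real.sqrt (1 - (y v).2.2 ^ 2) * Real.cos (y v).1)
      (-(Real.sqrt (1 - (y u).2.2 ^ 2) * Real.sin (y u).1 * width (y u).1 (y u).2.2) /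
        (l (y u).2.1 ^ 2 * width (y u).1 (y u).2.2 ^ 2)) u := by
  have h3 := (hasDerivAt_radius hy h0 h1).mul (hasDerivAt_theta hy).cos
  refine h3.congr_deriv ?_
  simp only [arcField]
  ring

theorem hasDerivAt_sin_mul (hy : HasDerivAt y (arcField l (y u)) u) (h0 : 0 < (y u).2.2)
    (h1 : (y u).2.2 < 1) :
    HasDerivAt (fun v => Real.sqrt (1 - (y v).2.2 ^ 2) * Real.sin (y v).1)
      ((Real.sqrt (1 - (y u).2.2 ^ 2) * (Real.cos (y u).1 * width (y u).1 (y u).2.2 +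
        2 * deriv l (y u).2.1 * (Real.sin (y u).1 * (y u).2.2))) /
        (l (y u).2.1 ^ 2 * width (y u).1 (y u).2.2 ^ 2)) u := by
  have h3 := (hasDerivAt_radius hy h0 h1).mul (hasDerivAt_theta hy).sin
  refine h3.congr_deriv ?_
  simp only [arcField]
  have := Real.cos_sq' (y u).1
  linear_combination ((2 * deriv l (y u).2.1 * (y u).2.2 * Real.sqrt (1 - (y u).2.2 ^ 2) *
    Real.sin (y u).1) / (l (y u).2.1 ^ 2 * width (y u).1 (y u).2.2 ^ 2)) * this

theorem hasDerivAt_sphericalAngle (hy : HasDerivAt y (arcField l (y u)) u) (h0 : 0 < (y u).2.2)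
    (h1 : (y u).2.2 < 1) :
    HasDerivAt (fun v => sphericalAngle (y v)) (Real.sqrt (1 - (y u).2.2 ^ 2) * Real.sin (y u).1 /
      (l (y u).2.1 ^ 2 * width (y u).1 (y u).2.2 ^ 2)) u := by
  have h2 := abs_lt.1 (abs_sqrt_mul_cos_lt h0 h1)
  have h3 := (Real.hasDerivAt_arccos h2.1.ne' h2.2.ne).comp u (hasDerivAt_cos_mul hy h0 h1)
  have h4 : Real.sqrt (1 - (Real.sqrt (1 - (y u).2.2 ^ 2) * Real.cos (y u).1) ^ 2) =
      width (y u).1 (y u).2.2 := by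
    rw [← sin_sphericalAngle h0 h1, sphericalAngle, Real.sin_arccos]
  have hw := width_pos_of_ne_zero (θ := (y u).1) h0.ne'
  refine h3.congr_deriv ?_
  rw [h4]
  field_simp

theorem hasDerivAt_height (hl : l (y u).2.1 ≠ 0) (hy : HasDerivAt y (arcField l (y u)) u) :
    HasDerivAt (fun v => (y v).2.1)
      (-(y u).2.2 / (l (y u).2.1 * width (y u).1 (y u).2.2 ^ 2)) u := by
  refine (hasDerivAt_r hy).congr_deriv ?_
  simp only [arcField]
  field_simp

/-- Along an orbit the differentiated function is `coeffPhi · φ'`, and the one in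
`hasDerivAt_momentum_r` is `coeffR · r'`; with both derivatives known, the Euler–Lagrange equations
are algebra. -/
theorem hasDerivAt_momentum_phi (hlpos : 0 < l (y u).2.1) (hl : DifferentiableAt ℝ l (y u).2.1)
    (hy : HasDerivAt y (arcField l (y u)) u) (h0 : 0 < (y u).2.2) (h1 : (y u).2.2 < 1) :
    HasDerivAt (fun v => l (y v).2.1 ^ 2 * (Real.sqrt (1 - (y v).2.2 ^ 2) * Real.sin (y v).1))
      (Real.sqrt (1 - (y u).2.2 ^ 2) * Real.cos (y u).1 / width (y u).1 (y u).2.2) u := by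
  have h2 : HasDerivAt (fun v => l (y v).2.1) _ u := hl.hasDerivAt.comp u (hasDerivAt_height hlpos.ne' hy)
  have h3 := (h2.fun_pow 2).mul (hasDerivAt_sin_mul hy h0 h1)
  refine h3.congr_deriv ?_
  have hw := width_pos_of_ne_zero (θ := (y u).1) h0.ne'
  field_simp
  norm_num
  ring

theorem hasDerivAt_momentum_r (hlpos : 0 < l (y u).2.1) (hl : DifferentiableAt ℝ l (y u).2.1)
    (hy : HasDerivAt y (arcField l (y u)) u) :
    HasDerivAt (fun v => -(l (y v).2.1 * (y v).2.2))
      (deriv l (y u).2.1 * ((y u).2.2 ^ 2 + 2 * ((1 - (y u).2.2 ^ 2) * Real.sin (y u).1 ^ 2)) /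
        (l (y u).2.1 * width (y u).1 (y u).2.2 ^ 2)) u := by
  have h2 : HasDerivAt (fun v => l (y v).2.1) _ u := hl.hasDerivAt.comp u (hasDerivAt_height hlpos.ne' hy)
  have h3 := (h2.mul (hasDerivAt_P hy)).neg
  refine h3.congr_deriv ?_
  simp only [arcField]
  by_cases hw : width (y u).1 (y u).2.2 = 0
  · simp [hw]
  field_simp
  ring

end Momenta

theorem width_sq_eq {θ P : ℝ} (h0 : 0 < P) (h1 : P < 1) :
    P ^ 2 + (Real.sqrt (1 - P ^ 2) * Real.sin θ) ^ 2 = width θ P ^ 2 := by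
  rw [width_sq, mul_pow, Real.sq_sqrt (by nlinarith)]
  have := Real.sin_sq_add_cos_sq θ
  linear_combination (-P ^ 2) * this

theorem deriv_coeffPhi_left (l : ℝ → ℝ) (φ r : ℝ) :
    deriv (fun a => coeffPhi l a r) φ = l r ^ 4 * (2 * Real.sin φ * Real.cos φ) := by
  have := ((Real.hasDerivAt_sin φ).fun_pow 2).const_mul (l r ^ 4)
  simpa only [coeffPhi, Nat.cast_ofNat, Nat.add_one_sub_one, pow_one] using this.deriv

theorem deriv_coeffR_left (l : ℝ → ℝ) (φ r : ℝ) :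
    deriv (fun a => coeffR l a r) φ = l r ^ 2 * (2 * Real.sin φ * Real.cos φ) := by
  have := ((Real.hasDerivAt_sin φ).fun_pow 2).const_mul (l r ^ 2)
  simpa only [coeffR, Nat.cast_ofNat, Nat.add_one_sub_one, pow_one] using this.deriv

theorem deriv_coeffPhi_right {l : ℝ → ℝ} {r : ℝ} (hl : DifferentiableAt ℝ l r) (φ : ℝ) :
    deriv (fun b => coeffPhi l φ b) r = 4 * l r ^ 3 * deriv l r * Real.sin φ ^ 2 := by
  have := (hl.hasDerivAt.fun_pow 4).mul_const (Real.sin φ ^ 2)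
  simpa [coeffPhi] using this.deriv

theorem deriv_coeffR_right {l : ℝ → ℝ} {r : ℝ} (hl : DifferentiableAt ℝ l r) (φ : ℝ) :
    deriv (fun b => coeffR l φ b) r = 2 * l r * deriv l r * Real.sin φ ^ 2 := by
  have := (hl.hasDerivAt.fun_pow 2).mul_const (Real.sin φ ^ 2)
  simpa [coeffR] using this.deriv

/-- Integral curves of the arclength field project to unit speed geodesics of the strip. -/
theorem isStripGeodesic_of_arcField {l : ℝ → ℝ} (hl : ContDiff ℝ ∞ l) (hpos : ∀ r, 0 < l r)
    {y : ℝ → ℝ × ℝ × ℝ} (hy : ∀ u > 0, HasDerivAt y (arcField l (y u)) u)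
    (h0 : ∀ u > 0, 0 < (y u).2.2) (h1 : ∀ u > 0, (y u).2.2 < 1) :
    IsStripGeodesic l (fun u => sphericalAngle (y u)) (fun u => (y u).2.1) := by
  have hsm : ContDiffOn ℝ ∞ y (Ioi 0) :=
    contDiffOn_of_hasDerivAt isOpen_Ioi (contDiffOn_arcField hl hpos) h0 hy
  have hd : ∀ r, DifferentiableAt ℝ l r := fun r => hl.differentiable (by simp) r
  have dφ : ∀ u > 0, deriv (fun u => sphericalAngle (y u)) u = _ := fun u hu =>
    (hasDerivAt_sphericalAngle (hy u hu) (h0 u hu) (h1 u hu)).deriv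
  have dr : ∀ u > 0, deriv (fun u => (y u).2.1) u = _ := fun u hu =>
    (hasDerivAt_height (hpos _).ne' (hy u hu)).deriv
  have hs : ∀ u > 0, Real.sin (sphericalAngle (y u)) = width (y u).1 (y u).2.2 := fun u hu =>
    sin_sphericalAngle (h0 u hu) (h1 u hu)
  have hc : ∀ u > 0, Real.cos (sphericalAngle (y u)) = _ := fun u hu =>
    cos_sphericalAngle (h0 u hu) (h1 u hu)
  have hw : ∀ u > 0, 0 < width (y u).1 (y u).2.2 := fun u hu =>
    width_pos_of_ne_zero (h0 u hu).ne'
  refine ⟨fun u hu => ?_, fun u hu => ?_, fun u hu => sphericalAngle_mem (h0 u hu) (h1 u hu),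
    fun u hu => ?_, fun u hu => ?_, fun u hu => ?_⟩
  · exact (contDiffAt_sphericalAngle (h0 u hu) (h1 u hu)).comp_contDiffWithinAt u (hsm u hu)
  · exact contDiffWithinAt_fst.comp u (contDiffWithinAt_snd.comp u (hsm u hu) (mapsTo_univ _ _))
      (mapsTo_univ _ _)
  · rw [dφ u hu, dr u hu, coeffPhi, coeffR, hs u hu]
    have := width_sq_eq (θ := (y u).1) (h0 u hu) (h1 u hu)
    have hw := hw u hu
    have hl0 := hpos (y u).2.1
    set R := Real.sqrt (1 - (y u).2.2 ^ 2)
    field_simp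
    linear_combination this
  · have hev : (fun s => coeffPhi l (sphericalAngle (y s)) (y s).2.1 *
        deriv (fun u => sphericalAngle (y u)) s) =ᶠ[𝓝 u]
        fun v => l (y v).2.1 ^ 2 * (Real.sqrt (1 - (y v).2.2 ^ 2) * Real.sin (y v).1) := by
      filter_upwards [lt_mem_nhds hu] with v hv
      rw [dφ v hv, coeffPhi, hs v hv]
      have := hw v hv
      have := hpos (y v).2.1
      field_simp
    rw [hev.deriv_eq, (hasDerivAt_momentum_phi (hpos _) (hd _) (hy u hu) (h0 u hu)
      (h1 u hu)).deriv, deriv_coeffPhi_left, deriv_coeffR_left, dφ u hu, dr u hu, hs u hu, hc u hu]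
    have := width_sq_eq (θ := (y u).1) (h0 u hu) (h1 u hu)
    have hw := hw u hu
    have hl0 := hpos (y u).2.1
    set R := Real.sqrt (1 - (y u).2.2 ^ 2)
    field_simp
    linear_combination (-(R * Real.cos (y u).1)) * this
  · have hev : (fun s => coeffR l (sphericalAngle (y s)) (y s).2.1 *
        deriv (fun u => (y u).2.1) s) =ᶠ[𝓝 u] fun v => -(l (y v).2.1 * (y v).2.2) := by
      filter_upwards [lt_mem_nhds hu] with v hv
      rw [dr v hv, coeffR, hs v hv]
      have := hw v hv
      have := hpos (y v).2.1
      field_simp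
    rw [hev.deriv_eq, (hasDerivAt_momentum_r (hpos _) (hd _) (hy u hu)).deriv,
      deriv_coeffPhi_right (hd _), deriv_coeffR_right (hd _), dφ u hu, dr u hu, hs u hu]
    have hR2 := Real.sq_sqrt (show 0 ≤ 1 - (y u).2.2 ^ 2 by
      have := h0 u hu; have := h1 u hu; nlinarith)
    have hw := hw u hu
    have hl0 := hpos (y u).2.1
    set R := Real.sqrt (1 - (y u).2.2 ^ 2)
    field_simp
    linear_combination (-4 * deriv l (y u).2.1 * Real.sin (y u).1 ^ 2) * hR2

/-- Reflecting the side of the collar. -/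
theorem isStripGeodesic_of_side {lam : ℝ → ℝ} {e : ℝ} (he : e = 1 ∨ e = -1) {φ r : ℝ → ℝ}
    (h : IsStripGeodesic (fun ρ => lam (e * ρ)) φ r) :
    IsStripGeodesic lam φ (fun t => e * r t) := by
  rcases he with rfl | rfl
  · simpa using h
  · simp only [neg_mul, one_mul] at h ⊢
    have hR : ∀ a b, coeffR (fun ρ => lam (-ρ)) a b = coeffR lam a (-b) := fun _ _ => rfl
    have hP : ∀ a b, coeffPhi (fun ρ => lam (-ρ)) a b = coeffPhi lam a (-b) := fun _ _ => rfl
    refine ⟨h.smooth_phi, h.smooth_r.neg, h.mem, fun t ht => ?_, fun t ht => ?_, fun t ht => ?_⟩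
    · have := h.unit_speed t ht
      simp only [hR, hP] at this
      rw [deriv.fun_neg, neg_sq]
      exact this
    · have := h.eq_phi t ht
      simp only [hR, hP] at this
      rw [deriv.fun_neg, neg_sq]
      exact this
    · have := h.eq_r t ht
      simp only [hR, hP] at this
      simp only [deriv.fun_neg, neg_sq, mul_neg]
      rw [deriv_comp_neg (fun b => coeffPhi lam (φ t) b),
        deriv_comp_neg (fun b => coeffR lam (φ t) b)] at this
      rw [this]
      ring

namespace Collar

variable {l : ℝ → ℝ} (c : Collar l)

theorem isStripGeodesic_arc (θ₀ : ℝ) :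
    IsStripGeodesic l (fun u => sphericalAngle (c.arc θ₀ u)) (fun u => (c.arc θ₀ u).2.1) :=
  isStripGeodesic_of_arcField c.smooth c.pos (fun _ hu => c.hasDerivAt_arc θ₀ hu)
    (fun _ hu => c.arc_P_pos θ₀ (le_of_lt hu)) (fun _ hu => c.arc_P_lt_one θ₀ (le_of_lt hu))

theorem continuous_arc_right (θ₀ : ℝ) : Continuous (c.arc θ₀) :=
  c.continuous_arc.comp (by fun_prop : Continuous fun u : ℝ => (θ₀, u))

theorem deriv_arc_r_neg (θ₀ : ℝ) {u : ℝ} (hu : 0 < u) :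
    -(c.arc θ₀ u).2.2 / (l (c.arc θ₀ u).2.1 * width (c.arc θ₀ u).1 (c.arc θ₀ u).2.2 ^ 2) < 0 := by
  have hP := c.arc_P_pos θ₀ hu.le
  have hl := c.pos (c.arc θ₀ u).2.1
  have hw := width_pos_of_ne_zero (θ := (c.arc θ₀ u).1) hP.ne'
  rw [neg_div]
  have : 0 < (c.arc θ₀ u).2.2 / (l (c.arc θ₀ u).2.1 *
    width (c.arc θ₀ u).1 (c.arc θ₀ u).2.2 ^ 2) := by positivity
  linarith

theorem strictAntiOn_arc_r (θ₀ : ℝ) : StrictAntiOn (fun u => (c.arc θ₀ u).2.1) (Ici 0) := by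
  refine strictAntiOn_of_deriv_neg (convex_Ici 0)
    (c.continuous_arc_right θ₀).snd.fst.continuousOn fun u hu => ?_
  rw [interior_Ici] at hu
  rw [(hasDerivAt_height (c.pos _).ne' (c.hasDerivAt_arc θ₀ hu)).deriv]
  exact c.deriv_arc_r_neg θ₀ hu

theorem arc_r_lt (θ₀ : ℝ) {u : ℝ} (hu : 0 < u) : (c.arc θ₀ u).2.1 < c.ε := by
  have := c.strictAntiOn_arc_r θ₀ self_mem_Ici hu.le hu
  simpa [c.arc_zero] using this

/-- The spiraling profile curve on the side `e`. -/
noncomputable def profile (e θ₀ u : ℝ) : ℝ × ℝ :=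
  (sphericalAngle (c.arc θ₀ u), e * (c.arc θ₀ u).2.1)

/-- The velocity of the profile curve. -/
noncomputable def velocity (e θ₀ u : ℝ) : ℝ × ℝ :=
  (Real.sqrt (1 - (c.arc θ₀ u).2.2 ^ 2) * Real.sin (c.arc θ₀ u).1 /
      (l (c.arc θ₀ u).2.1 ^ 2 * width (c.arc θ₀ u).1 (c.arc θ₀ u).2.2 ^ 2),
    e * (-(c.arc θ₀ u).2.2 /
      (l (c.arc θ₀ u).2.1 * width (c.arc θ₀ u).1 (c.arc θ₀ u).2.2 ^ 2)))

theorem hasDerivAt_profile (e θ₀ : ℝ) {u : ℝ} (hu : 0 < u) :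
    HasDerivAt (c.profile e θ₀) (c.velocity e θ₀ u) u :=
  (hasDerivAt_sphericalAngle (c.hasDerivAt_arc θ₀ hu) (c.arc_P_pos θ₀ hu.le)
    (c.arc_P_lt_one θ₀ hu.le)).prodMk
    ((hasDerivAt_height (c.pos _).ne' (c.hasDerivAt_arc θ₀ hu)).const_mul e)

theorem continuous_profile (e : ℝ) : Continuous fun q : ℝ × ℝ => c.profile e q.1 q.2 := by
  exact (continuous_sphericalAngle.comp c.continuous_arc).prodMk
    (continuous_const.mul c.continuous_arc.snd.fst)

theorem continuousOn_velocity (e : ℝ) :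
    ContinuousOn (fun q : ℝ × ℝ => c.velocity e q.1 q.2) (univ ×ˢ Ioi 0) := by
  have hθ := c.continuous_arc.fst
  have hr := c.smooth.continuous.comp c.continuous_arc.snd.fst
  have hp := c.continuous_arc.snd.snd
  have hw : Continuous fun q : ℝ × ℝ => width (c.arc q.1 q.2).1 (c.arc q.1 q.2).2.2 :=
    Real.continuous_sqrt.comp (((Real.continuous_sin.comp hθ).pow 2).add
      ((hp.mul (Real.continuous_cos.comp hθ)).pow 2))
  have hP : ∀ q ∈ univ ×ˢ Ioi (0 : ℝ), (c.arc q.1 q.2).2.2 ≠ 0 := fun q hq =>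
    (c.arc_P_pos q.1 (le_of_lt hq.2)).ne'
  unfold velocity
  refine ContinuousOn.prodMk (ContinuousOn.div
      ((Real.continuous_sqrt.comp (continuous_const.sub (hp.pow 2))).mul
        (Real.continuous_sin.comp hθ)).continuousOn
      ((hr.pow 2).mul (hw.pow 2)).continuousOn fun q hq => ?_)
    (continuousOn_const.mul (ContinuousOn.div hp.neg.continuousOn
      (hr.mul (hw.pow 2)).continuousOn fun q hq => ?_))
  all_goals
    have := c.pos (c.arc q.1 q.2).2.1
    have := width_pos_of_ne_zero (θ := (c.arc q.1 q.2).1) (hP q hq)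
    positivity

theorem profile_periodic (e : ℝ) : Function.Periodic (c.profile e) (2 * Real.pi) := by
  intro θ₀
  funext u
  simp [profile, sphericalAngle, c.arc_shift]

theorem tendsto_profile_snd (e θ₀ : ℝ) :
    Tendsto (fun u => (c.profile e θ₀ u).2) atTop (𝓝 0) := by
  simpa [profile] using (c.tendsto_arc_r θ₀).const_mul e

/-- Since `cos φ = √(1 - P²) cos θ` with `P → 0`, while `θ` runs continuously to `∞`, the curve
approaches every `φ ∈ [0, π]` along times at which `θ ≡ φ` modulo `2π`. -/
theorem limitSet_profile (e θ₀ : ℝ) :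
    ⋂ t ∈ Ioi (0 : ℝ), closure (c.profile e θ₀ '' Ici t) = Icc 0 Real.pi ×ˢ {0} := by
  apply Subset.antisymm
  · intro p hp
    rw [mem_iInter₂] at hp
    constructor
    · have h1 : closure (c.profile e θ₀ '' Ici 1) ⊆ Icc 0 Real.pi ×ˢ univ := by
        refine closure_minimal ?_ (isClosed_Icc.prod isClosed_univ)
        rintro _ ⟨u, -, rfl⟩
        exact ⟨⟨Real.arccos_nonneg _, Real.arccos_le_pi _⟩, trivial⟩
      exact (h1 (hp 1 (mem_Ioi.2 one_pos))).1
    · have h2 : ∀ δ > 0, |p.2| ≤ δ := by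
        intro δ hδ
        have hev := (c.tendsto_profile_snd e θ₀).eventually
          (Metric.closedBall_mem_nhds (0 : ℝ) hδ)
        obtain ⟨t, ht⟩ := eventually_atTop.1 (hev.and (eventually_gt_atTop 0))
        have h3 : closure (c.profile e θ₀ '' Ici t) ⊆ {q | |q.2| ≤ δ} := by
          refine closure_minimal ?_ (isClosed_le (by fun_prop) continuous_const)
          rintro _ ⟨u, hu, rfl⟩
          simpa [Real.dist_eq] using (ht u hu).1
        exact h3 (hp t (ht t le_rfl).2)
      exact abs_nonpos_iff.1 (le_of_forall_pos_le_add fun δ hδ => by simpa using h2 δ hδ)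
  · rintro ⟨φ, z⟩ ⟨hφ, hz⟩
    obtain rfl : z = 0 := hz
    rw [mem_iInter₂]
    intro t ht
    have hev : ∀ n : ℕ, ∃ u ≥ t + n, (c.arc θ₀ u).1 = φ + ((⌈(c.arc θ₀ (t + n)).1⌉₊ : ℕ) : ℝ) *
        (2 * Real.pi) := by
      intro n
      set k := ⌈(c.arc θ₀ (t + n)).1⌉₊
      have hk : (c.arc θ₀ (t + n)).1 ≤ k := Nat.le_ceil _
      have hk0 : (0 : ℝ) ≤ k := k.cast_nonneg
      obtain ⟨v, hv⟩ := ((c.tendsto_arc_theta θ₀).eventually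
        (eventually_ge_atTop (φ + k * (2 * Real.pi)))).and (eventually_ge_atTop (t + n)) |>.exists
      obtain ⟨u, hu, hu'⟩ := intermediate_value_Icc hv.2
        (f := fun u => (c.arc θ₀ u).1) (c.continuous_arc_right θ₀).fst.continuousOn
        (show φ + k * (2 * Real.pi) ∈ Icc _ _ from
          ⟨by nlinarith [Real.pi_gt_three, hφ.1], hv.1⟩)
      exact ⟨u, hu.1, hu'⟩
    choose u hu hθ using hev
    have hutop : Tendsto u atTop atTop :=
      tendsto_atTop_mono hu (tendsto_atTop_add_const_left _ _ tendsto_natCast_atTop_atTop)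
    have hlim : Tendsto (fun n => c.profile e θ₀ (u n)) atTop (𝓝 (φ, 0)) := by
      refine Tendsto.prodMk_nhds ?_ ((c.tendsto_profile_snd e θ₀).comp hutop)
      have h1 : ∀ n, sphericalAngle (c.arc θ₀ (u n)) =
          Real.arccos (Real.sqrt (1 - (c.arc θ₀ (u n)).2.2 ^ 2) * Real.cos φ) := fun n => by
        rw [sphericalAngle, hθ, Real.cos_add_nat_mul_two_pi]
      have h2 : Tendsto (fun n => (c.arc θ₀ (u n)).2.2) atTop (𝓝 0) :=
        (c.tendsto_arc_P θ₀).comp hutop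
      have h3 : Continuous fun p : ℝ => Real.arccos (Real.sqrt (1 - p ^ 2) * Real.cos φ) := by
        fun_prop
      have h4 := (h3.tendsto 0).comp h2
      simp only [ne_eq, OfNat.ofNat_ne_zero, not_false_eq_true, zero_pow, sub_zero, Real.sqrt_one,
        one_mul, Real.arccos_cos hφ.1 hφ.2] at h4
      refine h4.congr fun n => (h1 n).symm
    refine mem_closure_of_tendsto hlim (Eventually.of_forall fun n => ⟨u n, ?_, rfl⟩)
    exact le_trans (le_add_of_nonneg_right n.cast_nonneg) (hu n)

theorem isSpiralingGeodesic_profile {lam : ℝ → ℝ} {e : ℝ} (he : e = 1 ∨ e = -1)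
    (c : Collar fun ρ => lam (e * ρ)) (θ₀ : ℝ) :
    IsSpiralingGeodesic lam e c.ε (c.profile e θ₀) := by
  have hee : ∀ x, e * (e * x) = x := fun x => by rcases he with rfl | rfl <;> ring
  refine ⟨isStripGeodesic_of_side he (c.isStripGeodesic_arc θ₀), fun t ht => ?_, ?_,
    c.limitSet_profile e θ₀⟩
  · simp only [profile, hee]
    exact ⟨c.arc_r_pos θ₀ ht.le, c.arc_r_lt θ₀ ht⟩
  · simp only [profile, hee]
    have := (c.continuous_arc_right θ₀).snd.fst.tendsto 0
    rw [c.arc_zero] at this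
    exact this.mono_left nhdsWithin_le_nhds

theorem image_arc_r (θ₀ : ℝ) {v : ℝ} (hv : v ∈ Ioo 0 c.ε) : ∃ u > 0, (c.arc θ₀ u).2.1 = v := by
  obtain ⟨m, hm1, hm2⟩ := (((c.tendsto_arc_r θ₀).eventually (gt_mem_nhds hv.1)).and
    (eventually_gt_atTop 0)).exists
  obtain ⟨u, hu, hu'⟩ := intermediate_value_Icc' hm2.le (f := fun u => (c.arc θ₀ u).2.1)
    (c.continuous_arc_right θ₀).snd.fst.continuousOn (show v ∈ Icc _ _ from ⟨hm1.le, by rw [c.arc_zero]; exact hv.2.le⟩)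
  refine ⟨u, hu.1.lt_of_ne fun h0 => ?_, hu'⟩
  rw [← h0] at hu'
  simp only [c.arc_zero] at hu'
  exact hv.2.ne hu'.symm

/-- A stable orbit is determined by the image of its profile curve. -/
theorem cos_sin_eq_of_image_eq {e θ₁ θ₂ : ℝ} (he : e ≠ 0)
    (h : c.profile e θ₁ '' Ioi 0 = c.profile e θ₂ '' Ioi 0) :
    Real.cos θ₁ = Real.cos θ₂ ∧ Real.sin θ₁ = Real.sin θ₂ := by
  have hex : ∀ u > 0, ∃ v > 0, c.profile e θ₁ v = c.profile e θ₂ u := fun u hu => by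
    obtain ⟨v, hv, hv'⟩ := h.symm ▸ mem_image_of_mem (c.profile e θ₂) (mem_Ioi.2 hu)
    exact ⟨v, hv, hv'⟩
  set r₁ : ℝ → ℝ := fun u => (c.arc θ₁ u).2.1 with hr₁
  set r₂ : ℝ → ℝ := fun u => (c.arc θ₂ u).2.1 with hr₂
  have c1 := c.continuous_arc_right θ₁
  have c2 := c.continuous_arc_right θ₂
  -- the inverse of `r₁`
  choose! η hη0 hη using fun v => fun hv : v ∈ Ioo 0 c.ε => c.image_arc_r θ₁ hv
  have hmem : ∀ u > 0, r₂ u ∈ Ioo 0 c.ε := fun u hu => ⟨c.arc_r_pos θ₂ hu.le, c.arc_r_lt θ₂ hu⟩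
  have hη_r : ∀ v > 0, η (r₁ v) = v := fun v hv => by
    have hm : r₁ v ∈ Ioo 0 c.ε := ⟨c.arc_r_pos θ₁ hv.le, c.arc_r_lt θ₁ hv⟩
    exact (c.strictAntiOn_arc_r θ₁).injOn (hη0 _ hm).le hv.le (hη _ hm)
  -- Heights are strictly monotone, so equal images make the second curve the reparametrization of
  -- the first by `g = r₁⁻¹ ∘ r₂`.
  set g : ℝ → ℝ := fun u => η (r₂ u) with hg
  have hg0 : ∀ u > 0, 0 < g u := fun u hu => hη0 _ (hmem u hu)
  have hrg : ∀ u > 0, r₁ (g u) = r₂ u := fun u hu => hη _ (hmem u hu)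
  have hpg : ∀ u > 0, c.profile e θ₁ (g u) = c.profile e θ₂ u := fun u hu => by
    obtain ⟨v, hv, hv'⟩ := hex u hu
    have h1 : r₁ v = r₂ u := mul_left_cancel₀ he (congrArg Prod.snd hv')
    have h2 : g u = v := by rw [hg]; simp only; rw [← h1, hη_r v hv]
    rw [h2, hv']
  have hanti : ∀ u > 0, ∀ a > 0, a < g u ↔ r₂ u < r₁ a := fun u hu a ha => by
    rw [← hrg u hu]
    exact ((c.strictAntiOn_arc_r θ₁).lt_iff_gt (hg0 u hu).le ha.le).symm
  have hanti' : ∀ u > 0, ∀ a > 0, g u < a ↔ r₁ a < r₂ u := fun u hu a ha => by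
    rw [← hrg u hu]
    exact ((c.strictAntiOn_arc_r θ₁).lt_iff_gt ha.le (hg0 u hu).le).symm
  have hcr2 : Continuous r₂ := c2.snd.fst
  have hgc : ∀ u > 0, ContinuousAt g u := fun u hu => by
    refine tendsto_order.2 ⟨fun a ha => ?_, fun a ha => ?_⟩
    · rcases le_or_gt a 0 with h0 | h0
      · filter_upwards [lt_mem_nhds hu] with v hv using h0.trans_lt (hg0 v hv)
      · filter_upwards [lt_mem_nhds hu, (isOpen_lt hcr2 continuous_const).mem_nhds
          ((hanti u hu a h0).1 ha)] with v hv hv'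
        exact (hanti v hv a h0).2 hv'
    · have h0 := (hg0 u hu).trans ha
      filter_upwards [lt_mem_nhds hu, (isOpen_lt continuous_const hcr2).mem_nhds
          ((hanti' u hu a h0).1 ha)] with v hv hv'
      exact (hanti' v hv a h0).2 hv'
  have hglim : Tendsto g (𝓝[>] 0) (𝓝 0) := by
    refine tendsto_order.2 ⟨fun a ha => ?_, fun a ha => ?_⟩
    · filter_upwards [self_mem_nhdsWithin] with v hv using ha.trans (hg0 v hv)
    · have h1 : r₁ a < r₂ 0 := by
        simp only [hr₂, c.arc_zero]; exact c.arc_r_lt θ₁ ha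
      filter_upwards [self_mem_nhdsWithin, nhdsWithin_le_nhds
        ((isOpen_lt continuous_const hcr2).mem_nhds h1)] with v hv hv'
      exact (hanti' v hv a ha).2 hv'
  -- the tangent directions agree
  have key : ∀ u > 0, (c.arc θ₁ (g u)).2.2 = (c.arc θ₂ u).2.2 ∧
      Real.cos (c.arc θ₁ (g u)).1 = Real.cos (c.arc θ₂ u).1 ∧
      Real.sin (c.arc θ₁ (g u)).1 = Real.sin (c.arc θ₂ u).1 := by
    intro u hu
    have hg' := hg0 u hu
    have P1 := c.arc_P_pos θ₁ hg'.le
    have P2 := c.arc_P_pos θ₂ hu.le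
    have L1 := c.arc_P_lt_one θ₁ hg'.le
    have L2 := c.arc_P_lt_one θ₂ hu.le
    have d1 := hasDerivAt_height (c.pos _).ne' (c.hasDerivAt_arc θ₁ hg')
    have d2 := hasDerivAt_height (c.pos _).ne' (c.hasDerivAt_arc θ₂ hu)
    have hne := (c.deriv_arc_r_neg θ₁ hg').ne
    have hlocal : ∀ᶠ w in 𝓝 (r₂ u), r₁ (η w) = w := by
      filter_upwards [isOpen_Ioo.mem_nhds (hmem u hu)] with w hw using hη w hw
    have hηc : ContinuousAt η (r₂ u) := by
      have hm := hmem u hu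
      refine tendsto_order.2 ⟨fun a ha => ?_, fun a ha => ?_⟩
      · rcases le_or_gt a 0 with h0 | h0
        · filter_upwards [isOpen_Ioo.mem_nhds hm] with v hv using h0.trans_lt (hη0 v hv)
        · filter_upwards [isOpen_Ioo.mem_nhds hm, gt_mem_nhds ((hanti u hu a h0).1 ha)] with v hv hv'
          rw [← hη v hv] at hv'
          exact ((c.strictAntiOn_arc_r θ₁).lt_iff_gt (hη0 v hv).le h0.le).1 hv'
      · have h0 := (hg0 u hu).trans ha
        filter_upwards [isOpen_Ioo.mem_nhds hm, lt_mem_nhds ((hanti' u hu a h0).1 ha)] with v hv hv'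
        rw [← hη v hv] at hv'
        exact ((c.strictAntiOn_arc_r θ₁).lt_iff_gt h0.le (hη0 v hv).le).1 hv'
    have dη := HasDerivAt.of_local_left_inverse hηc d1 hne hlocal
    have dg : HasDerivAt g _ u := dη.comp u d2
    have dp := ((c.hasDerivAt_profile e θ₁ hg').scomp u dg)
    have dp2 : HasDerivAt (c.profile e θ₁ ∘ g) (c.velocity e θ₂ u) u := by
      refine (c.hasDerivAt_profile e θ₂ hu).congr_of_eventuallyEq ?_
      filter_upwards [lt_mem_nhds hu] with v hv using hpg v hv
    have hvel := congrArg Prod.fst (dp.unique dp2)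
    have hcos := congrArg Prod.fst (hpg u hu)
    have hrr : (c.arc θ₁ (g u)).2.1 = (c.arc θ₂ u).2.1 := hrg u hu
    simp only [profile] at hcos
    have hX := congrArg Real.cos hcos
    have hY := congrArg Real.sin hcos
    rw [cos_sphericalAngle P1 L1, cos_sphericalAngle P2 L2] at hX
    rw [sin_sphericalAngle P1 L1, sin_sphericalAngle P2 L2] at hY
    simp only [velocity, Prod.smul_fst, smul_eq_mul] at hvel
    rw [hrr, hY] at hvel
    have q1 := width_sq_eq (θ := (c.arc θ₁ (g u)).1) P1 L1
    have q2 := width_sq_eq (θ := (c.arc θ₂ u).1) P2 L2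
    rw [hY] at q1
    have hw := width_pos_of_ne_zero (θ := (c.arc θ₂ u).1) P2.ne'
    have hl := c.pos (c.arc θ₂ u).2.1
    have R1 : 0 < Real.sqrt (1 - (c.arc θ₁ (g u)).2.2 ^ 2) := Real.sqrt_pos.2 (by nlinarith)
    -- Proportional velocities give `P₂ Q₁ = P₁ Q₂` with `Q = √(1 - P²) sin θ`. As `P² + Q² = sin²
    -- φ` is the same for both curves and the momenta are positive, `P` and `Q` agree.
    have hq : (c.arc θ₂ u).2.2 * (Real.sqrt (1 - (c.arc θ₁ (g u)).2.2 ^ 2) *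
        Real.sin (c.arc θ₁ (g u)).1) = (c.arc θ₁ (g u)).2.2 *
        (Real.sqrt (1 - (c.arc θ₂ u).2.2 ^ 2) * Real.sin (c.arc θ₂ u).1) := by
      field_simp at hvel
      linarith
    set p₁ := (c.arc θ₁ (g u)).2.2
    set p₂ := (c.arc θ₂ u).2.2
    set Q₁ := Real.sqrt (1 - p₁ ^ 2) * Real.sin (c.arc θ₁ (g u)).1
    set Q₂ := Real.sqrt (1 - p₂ ^ 2) * Real.sin (c.arc θ₂ u).1
    have hpp : p₁ = p₂ := by
      have e1 : p₂ ^ 2 * width (c.arc θ₂ u).1 p₂ ^ 2 = p₁ ^ 2 * width (c.arc θ₂ u).1 p₂ ^ 2 := by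
        have : (p₂ * Q₁) ^ 2 = (p₁ * Q₂) ^ 2 := by rw [hq]
        linear_combination (-p₂ ^ 2) * q1 + p₁ ^ 2 * q2 + this
      have e2 := mul_right_cancel₀ (pow_pos hw 2).ne' e1
      exact ((pow_left_inj₀ P2.le P1.le two_ne_zero).1 e2).symm
    have hR : Real.sqrt (1 - p₁ ^ 2) = Real.sqrt (1 - p₂ ^ 2) := by rw [hpp]
    refine ⟨hpp, ?_, ?_⟩
    · rw [← hR] at hX
      exact mul_left_cancel₀ R1.ne' hX
    · have hQ : Q₁ = Q₂ := by
        rw [hpp] at hq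
        exact mul_left_cancel₀ P2.ne' hq
      simp only [Q₁, Q₂, ← hR] at hQ
      exact mul_left_cancel₀ R1.ne' hQ
  -- At the entrance of the collar `g → 0`, so the agreement passes to the starting angles.
  have t1 : Tendsto (fun u => (c.arc θ₁ (g u)).1) (𝓝[>] 0) (𝓝 θ₁) := by
    have := (c1.fst.tendsto 0).comp hglim
    rwa [c.arc_zero] at this
  have t2 : Tendsto (fun u => (c.arc θ₂ u).1) (𝓝[>] 0) (𝓝 θ₂) := by
    have := (c2.fst.tendsto 0).mono_left (nhdsWithin_le_nhds (s := Ioi 0))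
    rwa [c.arc_zero] at this
  constructor
  · refine tendsto_nhds_unique ((Real.continuous_cos.tendsto _).comp t1)
      (((Real.continuous_cos.tendsto _).comp t2).congr' ?_)
    filter_upwards [self_mem_nhdsWithin] with u hu using (key u hu).2.1.symm
  · refine tendsto_nhds_unique ((Real.continuous_sin.tendsto _).comp t1)
      (((Real.continuous_sin.tendsto _).comp t2).congr' ?_)
    filter_upwards [self_mem_nhdsWithin] with u hu using (key u hu).2.2.symm

end Collar

/-! ### Differentiation under the integral and the divergence theorem -/

theorem hasDerivAt_setIntegral_of_isCompact {X : Type*} [TopologicalSpace X] [MeasurableSpace X]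
    [OpensMeasurableSpace X] {μ : Measure X} [IsFiniteMeasureOnCompacts μ] {K : Set X}
    (hK : IsCompact K) (hKm : MeasurableSet K) {F F' : ℝ → X → ℝ} {δ τ₀ : ℝ}
    (hτ₀ : τ₀ ∈ Ioo (-δ) δ)
    (hF : ∀ τ ∈ Icc (-δ) δ, ContinuousOn (F τ) K)
    (hF' : ContinuousOn (fun q : ℝ × X => F' q.1 q.2) (Icc (-δ) δ ×ˢ K))
    (hd : ∀ τ ∈ Icc (-δ) δ, ∀ z ∈ K, HasDerivAt (fun τ => F τ z) (F' τ z) τ) :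
    HasDerivAt (fun τ => ∫ z in K, F τ z ∂μ) (∫ z in K, F' τ₀ z ∂μ) τ₀ := by
  obtain ⟨B, hB⟩ := (isCompact_Icc.prod hK).exists_bound_of_continuousOn hF'
  have hτ₁ : τ₀ ∈ Icc (-δ) δ := Ioo_subset_Icc_self hτ₀
  have hn : Icc (-δ) δ ∈ 𝓝 τ₀ := Icc_mem_nhds hτ₀.1 hτ₀.2
  refine (hasDerivAt_integral_of_dominated_loc_of_deriv_le (F := F) (F' := F')
    (bound := fun _ => B) (x₀ := τ₀) hn ?_ ?_ ?_ ?_ ?_ ?_).2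
  · filter_upwards [hn] with τ hτ using (hF τ hτ).aestronglyMeasurable hKm
  · exact (hF τ₀ hτ₁).integrableOn_compact' hK hKm
  · refine ContinuousOn.aestronglyMeasurable ?_ hKm
    exact hF'.comp (f := fun z => (τ₀, z)) (by fun_prop) fun z hz => ⟨hτ₁, hz⟩
  · filter_upwards [ae_restrict_mem hKm] with z hz τ hτ using hB (τ, z) ⟨hτ, hz⟩
  · exact integrableOn_const hK.measure_lt_top.ne
  · filter_upwards [ae_restrict_mem hKm] with z hz τ hτ using hd τ hτ z hz

/-- The area functional of a smooth family with Gram determinant `H`, normalised at `τ = 0`. -/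
theorem hasDerivAt_setIntegral_sqrt {U K : Set (ℝ × ℝ)} (hU : IsOpen U) (hK : IsCompact K)
    (hKU : K ⊆ U) {H : ℝ × (ℝ × ℝ) → ℝ} (hH : ContDiffOn ℝ ∞ H (univ ×ˢ U))
    (h1 : ∀ z ∈ K, H (0, z) = 1) :
    HasDerivAt (fun τ => ∫ z in K, Real.sqrt (H (τ, z)))
      (∫ z in K, fderiv ℝ H (0, z) (1, 0) / 2) 0 := by
  have hO : IsOpen ((univ : Set ℝ) ×ˢ U) := isOpen_univ.prod hU
  have hpos : IsOpen ((univ ×ˢ U) ∩ H ⁻¹' Ioi 0) :=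
    hH.continuousOn.isOpen_inter_preimage hO isOpen_Ioi
  -- By compactness `H` stays positive over `K` for a uniform range of `τ`, where the square root is
  -- smooth.
  obtain ⟨A, B, hA, hB, h0A, hKB, hAB⟩ := generalized_tube_lemma (s := {(0 : ℝ)})
    isCompact_singleton hK hpos (by
      rintro ⟨τ, z⟩ ⟨hτ, hz⟩
      obtain rfl : τ = 0 := hτ
      exact ⟨⟨trivial, hKU hz⟩, by simp [h1 z hz]⟩)
  obtain ⟨δ', hδ', hball⟩ := Metric.isOpen_iff.1 hA 0 (h0A rfl)
  have hδ : 0 < δ' / 2 := by positivity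
  have hmem : ∀ τ ∈ Icc (-(δ' / 2)) (δ' / 2), ∀ z ∈ K, (τ, z) ∈ (univ ×ˢ U) ∩ H ⁻¹' Ioi 0 :=
    fun τ hτ z hz => hAB ⟨hball (by
      rw [Metric.mem_ball, Real.dist_eq, sub_zero]
      exact (abs_le.2 hτ).trans_lt (by linarith)), hKB hz⟩
  have hdiff : ∀ q ∈ (univ : Set ℝ) ×ˢ U, DifferentiableAt ℝ H q := fun q hq =>
    (hH.contDiffAt (hO.mem_nhds hq)).differentiableAt (by simp)
  have hf : ContinuousOn (fun q => fderiv ℝ H q (1, 0)) ((univ : Set ℝ) ×ˢ U) :=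
    (hH.continuousOn_fderiv_of_isOpen hO (by simp)).clm_apply continuousOn_const
  have key := hasDerivAt_setIntegral_of_isCompact (μ := volume) hK hK.measurableSet
    (F := fun τ z => Real.sqrt (H (τ, z)))
    (F' := fun τ z => fderiv ℝ H (τ, z) (1, 0) / (2 * Real.sqrt (H (τ, z))))
    (δ := δ' / 2) (τ₀ := 0) ⟨by linarith, hδ⟩ ?_ ?_ ?_
  · refine key.congr_deriv (setIntegral_congr_fun hK.measurableSet fun z hz => ?_)
    simp [h1 z hz]
  · intro τ hτ
    exact Real.continuous_sqrt.comp_continuousOn (hH.continuousOn.comp (by fun_prop)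
      fun z hz => ⟨trivial, hKU hz⟩)
  · have hsub : Icc (-(δ' / 2)) (δ' / 2) ×ˢ K ⊆ univ ×ˢ U := prod_mono (subset_univ _) hKU
    refine (hf.mono hsub).div (continuousOn_const.mul
      (Real.continuous_sqrt.comp_continuousOn (hH.continuousOn.mono hsub))) fun q hq => ?_
    have : 0 < H q := (hmem q.1 hq.1 q.2 hq.2).2
    have := Real.sqrt_pos.2 this
    positivity
  · intro τ hτ z hz
    have hp : 0 < H (τ, z) := (hmem τ hτ z hz).2
    have h2 : HasDerivAt (fun τ => H (τ, z)) (fderiv ℝ H (τ, z) (1, 0)) τ := by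
      have h3 : HasDerivAt (fun τ : ℝ => (τ, z)) (1, 0) τ :=
        (hasDerivAt_id τ).prodMk (hasDerivAt_const τ z)
      exact (hdiff (τ, z) ⟨trivial, hKU hz⟩).hasFDerivAt.comp_hasDerivAt τ h3
    exact h2.sqrt hp.ne'

/-- Extended by zero, `g` is a compactly supported `C¹` function on the plane, and integration by
parts against the constant `1` applies. No regularity of the boundary of `K` is needed. -/
theorem setIntegral_fderiv_eq_zero {U K : Set (ℝ × ℝ)} (hU : IsOpen U) (hK : IsCompact K)
    (hKU : K ⊆ U) {g : ℝ × ℝ → ℝ} (hg : ContDiffOn ℝ 1 g U) (h0 : ∀ z ∈ U \ K, g z = 0)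
    (v : ℝ × ℝ) : ∫ z in K, fderiv ℝ g z v = 0 := by
  set G := K.indicator g with hG
  have e1 : ∀ z ∈ U, G =ᶠ[𝓝 z] g := fun z hz => by
    filter_upwards [hU.mem_nhds hz] with y hy
    by_cases hyK : y ∈ K
    · simp [hG, hyK]
    · simp [hG, hyK, h0 y ⟨hy, hyK⟩]
  have e2 : ∀ z ∉ K, G =ᶠ[𝓝 z] fun _ => 0 := fun z hz => by
    filter_upwards [hK.isClosed.isOpen_compl.mem_nhds hz] with y hy
    simp [hG, show y ∉ K from hy]
  have hGs : ContDiff ℝ 1 G := contDiff_iff_contDiffAt.2 fun z => by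
    by_cases hz : z ∈ K
    · exact (hg.contDiffAt (hU.mem_nhds (hKU hz))).congr_of_eventuallyEq (e1 z (hKU hz))
    · exact contDiffAt_const.congr_of_eventuallyEq (e2 z hz)
  have hsupp : HasCompactSupport G := HasCompactSupport.intro hK fun z hz => by simp [hG, hz]
  have hint : Integrable (fun z => fderiv ℝ G z v) :=
    ((hGs.continuous_fderiv (by simp)).clm_apply continuous_const).integrable_of_hasCompactSupport
      (hsupp.fderiv_apply ℝ v)
  have h1 := integral_mul_fderiv_eq_neg_fderiv_mul_of_integrable (μ := (volume : Measure (ℝ × ℝ)))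
    (f := fun _ => (1 : ℝ)) (g := G) (v := v) (by simp)
    (by simpa using hint) (by simpa using hGs.continuous.integrable_of_hasCompactSupport hsupp)
    (fun _ _ => by fun_prop) (fun z _ => hGs.differentiable (by simp) z)
  simp only [one_mul, fderiv_fun_const, Pi.zero_apply, zero_apply, zero_mul,
    integral_zero, neg_zero] at h1
  rw [← h1, ← setIntegral_eq_integral_of_forall_compl_eq_zero (s := K)
    (f := fun z => fderiv ℝ G z v) fun z hz => by simp [(e2 z hz).fderiv_eq]]
  refine setIntegral_congr_fun hK.measurableSet fun z hz => ?_
  simp only [(e1 z (hKU hz)).fderiv_eq]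

/-! ### Variation fields -/

section variation

variable {F : Type*} [NormedAddCommGroup F] [NormedSpace ℝ F]
  {U : Set (ℝ × ℝ)} {Ψ : ℝ → ℝ × ℝ → F}

/-- The variation field of the family `Ψ`. -/
noncomputable def variationField (Ψ : ℝ → ℝ × ℝ → F) (z : ℝ × ℝ) : F :=
  fderiv ℝ (fun q : ℝ × (ℝ × ℝ) => Ψ q.1 q.2) (0, z) (1, 0)

theorem fderiv_slice (hU : IsOpen U)
    (hΨ : ContDiffOn ℝ ∞ (fun q : ℝ × (ℝ × ℝ) => Ψ q.1 q.2) (univ ×ˢ U)) (τ : ℝ) {z : ℝ × ℝ}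
    (hz : z ∈ U) (v : ℝ × ℝ) :
    fderiv ℝ (Ψ τ) z v = fderiv ℝ (fun q : ℝ × (ℝ × ℝ) => Ψ q.1 q.2) (τ, z) (0, v) := by
  have h1 := ((hΨ.contDiffAt ((isOpen_univ.prod hU).mem_nhds
    (show (τ, z) ∈ univ ×ˢ U from ⟨trivial, hz⟩))).differentiableAt (by simp)).hasFDerivAt
  have h2 : HasFDerivAt (fun z : ℝ × ℝ => (τ, z)) (ContinuousLinearMap.inr ℝ ℝ (ℝ × ℝ)) z :=
    hasFDerivAt_prodMk_right τ z
  have := (h1.comp z h2).fderiv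
  rw [show Ψ τ = (fun q : ℝ × (ℝ × ℝ) => Ψ q.1 q.2) ∘ fun z => (τ, z) from rfl, this]
  rfl

theorem contDiffOn_variationField (hU : IsOpen U)
    (hΨ : ContDiffOn ℝ ∞ (fun q : ℝ × (ℝ × ℝ) => Ψ q.1 q.2) (univ ×ˢ U)) :
    ContDiffOn ℝ ∞ (variationField Ψ) U := by
  have h1 : ContDiffOn ℝ ∞ (fderiv ℝ fun q : ℝ × (ℝ × ℝ) => Ψ q.1 q.2) (univ ×ˢ U) :=
    hΨ.fderiv_of_isOpen (isOpen_univ.prod hU) (by simp)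
  have h2 : ContDiffOn ℝ ∞ (fun z => fderiv ℝ (fun q : ℝ × (ℝ × ℝ) => Ψ q.1 q.2) ((0 : ℝ), z)) U :=
    h1.comp (by fun_prop) fun z hz => ⟨trivial, hz⟩
  exact h2.clm_apply contDiffOn_const

theorem hasDerivAt_variation (hU : IsOpen U)
    (hΨ : ContDiffOn ℝ ∞ (fun q : ℝ × (ℝ × ℝ) => Ψ q.1 q.2) (univ ×ˢ U)) {z : ℝ × ℝ}
    (hz : z ∈ U) : HasDerivAt (fun τ => Ψ τ z) (variationField Ψ z) 0 := by
  have h1 := ((hΨ.contDiffAt ((isOpen_univ.prod hU).mem_nhds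
    (show (0, z) ∈ univ ×ˢ U from ⟨trivial, hz⟩))).differentiableAt (by simp)).hasFDerivAt
  have h3 : HasDerivAt (fun τ : ℝ => (τ, z)) (1, 0) 0 :=
    (hasDerivAt_id _).prodMk (hasDerivAt_const _ z)
  exact h1.comp_hasDerivAt (0 : ℝ) h3

/-- This is the symmetry of second derivatives, exchanging the variation parameter with the surface
parameters. -/
theorem hasDerivAt_fderiv_slice {f : ℝ × (ℝ × ℝ) → F} {z : ℝ × ℝ} (hf : ContDiffAt ℝ ∞ f (0, z))
    (v : ℝ × ℝ) : HasDerivAt (fun τ => fderiv ℝ f (τ, z) (0, v))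
      (fderiv ℝ (fun y => fderiv ℝ f (0, y) (1, 0)) z v) 0 := by
  have hsymm : IsSymmSndFDerivAt ℝ f (0, z) := hf.isSymmSndFDerivAt (by
      rw [minSmoothness_of_isRCLikeNormedField]; exact WithTop.coe_le_coe.2 le_top)
  have hd : HasFDerivAt (fderiv ℝ f) (fderiv ℝ (fderiv ℝ f) (0, z)) (0, z) :=
    ((hf.fderiv_right (m := 1) (WithTop.coe_le_coe.2 le_top)).differentiableAt
      (by simp)).hasFDerivAt
  have h3 : HasDerivAt (fun τ : ℝ => (τ, z)) (1, 0) 0 :=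
    (hasDerivAt_id _).prodMk (hasDerivAt_const _ z)
  have h4 : HasFDerivAt (fun z : ℝ × ℝ => ((0 : ℝ), z)) (ContinuousLinearMap.inr ℝ ℝ (ℝ × ℝ)) z :=
    hasFDerivAt_prodMk_right _ z
  have h5 : HasDerivAt (fun τ => fderiv ℝ f (τ, z)) (fderiv ℝ (fderiv ℝ f) (0, z) (1, 0)) 0 :=
    hd.comp_hasDerivAt (0 : ℝ) h3
  have h6 : HasFDerivAt (fun y => fderiv ℝ f (0, y))
      ((fderiv ℝ (fderiv ℝ f) (0, z)).comp (ContinuousLinearMap.inr ℝ ℝ (ℝ × ℝ))) z :=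
    hd.comp z h4
  have h7 := (h6.clm_apply (hasFDerivAt_const ((1 : ℝ), (0 : ℝ × ℝ)) z)).fderiv
  rw [h7]
  refine (h5.clm_apply (hasDerivAt_const (0 : ℝ) ((0 : ℝ), v))).congr_deriv ?_
  simp [hsymm (1, 0) (0, v)]

theorem hasDerivAt_fderiv_variation (hU : IsOpen U)
    (hΨ : ContDiffOn ℝ ∞ (fun q : ℝ × (ℝ × ℝ) => Ψ q.1 q.2) (univ ×ˢ U)) {z : ℝ × ℝ}
    (hz : z ∈ U) (v : ℝ × ℝ) :
    HasDerivAt (fun τ => fderiv ℝ (Ψ τ) z v) (fderiv ℝ (variationField Ψ) z v) 0 := by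
  have h1 : ContDiffAt ℝ ∞ (fun q : ℝ × (ℝ × ℝ) => Ψ q.1 q.2) (0, z) :=
    hΨ.contDiffAt ((isOpen_univ.prod hU).mem_nhds ⟨trivial, hz⟩)
  exact (hasDerivAt_fderiv_slice h1 v).congr_of_eventuallyEq
    (Eventually.of_forall fun τ => fderiv_slice hU hΨ τ hz v)

end variation

/-! ### Surfaces of revolution -/

/-- An orthonormal frame of Euclidean space. -/
structure Frame (x e₁ e₂ : E3) : Prop where
  xx : inner ℝ x x = 1
  aa : inner ℝ e₁ e₁ = 1
  bb : inner ℝ e₂ e₂ = 1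
  xa : inner ℝ x e₁ = 0
  xb : inner ℝ x e₂ = 0
  ab : inner ℝ e₁ e₂ = 0
  repr : ∀ y : E3, y = inner ℝ x y • x + inner ℝ e₁ y • e₁ + inner ℝ e₂ y • e₂

theorem exists_frame (x : S2) : ∃ e₁ e₂ : E3, Frame x e₁ e₂ := by
  have hx : ‖(x : E3)‖ = 1 := mem_sphere_zero_iff_norm.1 x.2
  have ho : Orthonormal ℝ (({0} : Set (Fin 3)).domRestrict fun _ => (x : E3)) :=
    ⟨fun _ => hx, fun i j hij => absurd (Subsingleton.elim i j) hij⟩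
  obtain ⟨b, hb⟩ := ho.exists_orthonormalBasis_extension_of_card_eq (by simp)
  have h0 : b 0 = x := hb 0 rfl
  have hn : ∀ i, inner ℝ (b i) (b i) = 1 := fun i => by
    rw [real_inner_self_eq_norm_sq, b.norm_eq_one, one_pow]
  refine ⟨b 1, b 2, ?_, hn 1, hn 2, ?_, ?_, b.orthonormal.2 (by decide), fun y => ?_⟩
  · rw [← h0, hn]
  · rw [← h0, b.orthonormal.2 (by decide)]
  · rw [← h0, b.orthonormal.2 (by decide)]
  · conv_lhs => rw [← b.sum_repr' y]
    rw [Fin.sum_univ_three, h0]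

theorem Frame.ax {x e₁ e₂ : E3} (h : Frame x e₁ e₂) : inner ℝ e₁ x = 0 := by
  rw [real_inner_comm, h.xa]

theorem Frame.bx {x e₁ e₂ : E3} (h : Frame x e₁ e₂) : inner ℝ e₂ x = 0 := by
  rw [real_inner_comm, h.xb]

theorem Frame.ba {x e₁ e₂ : E3} (h : Frame x e₁ e₂) : inner ℝ e₂ e₁ = 0 := by
  rw [real_inner_comm, h.ab]

/-- The meridian at longitude `θ`, as a function of the angle `φ` to the axis `x`. -/
noncomputable def meridian (x e₁ e₂ : E3) (φ θ : ℝ) : E3 :=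
  Real.cos φ • x + Real.sin φ • (Real.cos θ • e₁ + Real.sin θ • e₂)

/-- The surface of revolution about `x` with profile `(φ, r)`. -/
noncomputable def revolution (x e₁ e₂ : E3) (φ r : ℝ → ℝ) (z : ℝ × ℝ) : E3 × ℝ :=
  (meridian x e₁ e₂ (φ z.1) z.2, r z.1)

/-- The unit tangent vector of the parallels. -/
noncomputable def parallel (e₁ e₂ : E3) (θ : ℝ) : E3 := -Real.sin θ • e₁ + Real.cos θ • e₂

theorem hasDerivAt_meridian_left (x e₁ e₂ : E3) (φ θ : ℝ) :
    HasDerivAt (fun φ => meridian x e₁ e₂ φ θ) (meridian x e₁ e₂ (φ + Real.pi / 2) θ) φ := by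
  have := ((Real.hasDerivAt_cos φ).smul_const x).add
    ((Real.hasDerivAt_sin φ).smul_const (Real.cos θ • e₁ + Real.sin θ • e₂))
  refine this.congr_deriv ?_
  rw [meridian, Real.cos_add_pi_div_two, Real.sin_add_pi_div_two]

theorem hasDerivAt_meridian_right (x e₁ e₂ : E3) (φ θ : ℝ) :
    HasDerivAt (fun θ => meridian x e₁ e₂ φ θ) (Real.sin φ • parallel e₁ e₂ θ) θ := by
  have := ((((Real.hasDerivAt_cos θ).smul_const e₁).add
    ((Real.hasDerivAt_sin θ).smul_const e₂)).const_smul (Real.sin φ)).const_add (Real.cos φ • x)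
  exact this

theorem hasDerivAt_parallel (e₁ e₂ : E3) (θ : ℝ) :
    HasDerivAt (parallel e₁ e₂) (-(Real.cos θ • e₁ + Real.sin θ • e₂)) θ := by
  have := ((Real.hasDerivAt_sin θ).neg.smul_const e₁).add ((Real.hasDerivAt_cos θ).smul_const e₂)
  refine this.congr_deriv ?_
  module

theorem contDiff_meridian (x e₁ e₂ : E3) :
    ContDiff ℝ ∞ fun q : ℝ × ℝ => meridian x e₁ e₂ q.1 q.2 := by
  unfold meridian
  fun_prop

theorem contDiff_parallel (e₁ e₂ : E3) : ContDiff ℝ ∞ (parallel e₁ e₂) := by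
  unfold parallel
  fun_prop

section frame

variable {x e₁ e₂ : E3} (h : Frame x e₁ e₂) (φ θ : ℝ)
include h

theorem Frame.inner_meridian : inner ℝ (meridian x e₁ e₂ φ θ) (meridian x e₁ e₂ φ θ) = 1 := by
  simp only [meridian, inner_add_left, inner_add_right, real_inner_smul_left,
    real_inner_smul_right, h.xx, h.aa, h.bb, h.xa, h.xb, h.ab, h.ax, h.bx, h.ba]
  linear_combination Real.sin_sq_add_cos_sq φ + Real.sin φ ^ 2 * Real.sin_sq_add_cos_sq θ

theorem Frame.inner_parallel : inner ℝ (parallel e₁ e₂ θ) (parallel e₁ e₂ θ) = 1 := by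
  simp only [parallel, inner_add_left, inner_add_right, real_inner_smul_left,
    real_inner_smul_right, h.aa, h.bb, h.ab, h.ba]
  linear_combination Real.sin_sq_add_cos_sq θ

theorem Frame.inner_meridian_parallel :
    inner ℝ (meridian x e₁ e₂ φ θ) (parallel e₁ e₂ θ) = 0 := by
  simp only [meridian, parallel, inner_add_left, inner_add_right, real_inner_smul_left,
    real_inner_smul_right, h.aa, h.bb, h.xa, h.xb, h.ab, h.ba]
  ring

theorem Frame.norm_meridian : ‖meridian x e₁ e₂ φ θ‖ = 1 := by
  have := h.inner_meridian φ θ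
  rw [real_inner_self_eq_norm_sq] at this
  exact (pow_eq_one_iff_of_nonneg (norm_nonneg _) two_ne_zero).1 this

theorem Frame.inner_x_meridian : inner ℝ x (meridian x e₁ e₂ φ θ) = Real.cos φ := by
  simp only [meridian, inner_add_right, real_inner_smul_right, h.xx, h.xa, h.xb]
  ring

end frame

/-! ### Derivatives of parametrized surfaces -/

section partials

variable {F : Type*} [NormedAddCommGroup F] [NormedSpace ℝ F] {g : ℝ × ℝ → F} {z : ℝ × ℝ}

theorem hasDerivAt_partial_fst (hg : DifferentiableAt ℝ g z) :
    HasDerivAt (fun t => g (t, z.2)) (fderiv ℝ g z (1, 0)) z.1 :=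
  HasFDerivAt.comp_hasDerivAt (l := g) (l' := fderiv ℝ g z) z.1 hg.hasFDerivAt
    ((hasDerivAt_id z.1).prodMk (hasDerivAt_const z.1 z.2))

theorem hasDerivAt_partial_snd (hg : DifferentiableAt ℝ g z) :
    HasDerivAt (fun θ => g (z.1, θ)) (fderiv ℝ g z (0, 1)) z.2 :=
  HasFDerivAt.comp_hasDerivAt (l := g) (l' := fderiv ℝ g z) z.2 hg.hasFDerivAt
    ((hasDerivAt_const z.2 z.1).prodMk (hasDerivAt_id z.2))

end partials

theorem hasDerivAt_fst {f : ℝ → E3 × ℝ} {f' : E3 × ℝ} {t : ℝ} (h : HasDerivAt f f' t) :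
    HasDerivAt (fun t => (f t).1) f'.1 t :=
  (ContinuousLinearMap.fst ℝ E3 ℝ).hasFDerivAt.comp_hasDerivAt t h

theorem hasDerivAt_snd {f : ℝ → E3 × ℝ} {f' : E3 × ℝ} {t : ℝ} (h : HasDerivAt f f' t) :
    HasDerivAt (fun t => (f t).2) f'.2 t :=
  (ContinuousLinearMap.snd ℝ E3 ℝ).hasFDerivAt.comp_hasDerivAt t h

theorem hasDerivAt_metric {lam : ℝ → ℝ} {p a b : ℝ → E3 × ℝ} {p' a' b' : E3 × ℝ} {t : ℝ}
    (hlam : DifferentiableAt ℝ lam (p t).2) (hp : HasDerivAt p p' t) (ha : HasDerivAt a a' t)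
    (hb : HasDerivAt b b' t) :
    HasDerivAt (fun t => metric lam (p t) (a t) (b t))
      (metric lam (p t) a' (b t) + metric lam (p t) (a t) b' +
        2 * lam (p t).2 * deriv lam (p t).2 * p'.2 * inner ℝ (a t).1 (b t).1) t := by
  have h1 := (hlam.hasDerivAt.comp t (hasDerivAt_snd hp)).fun_pow 2
  have h2 := (hasDerivAt_fst ha).inner ℝ (hasDerivAt_fst hb)
  have := ((hasDerivAt_snd ha).mul (hasDerivAt_snd hb)).add (h1.mul h2)
  refine this.congr_deriv ?_
  simp only [metric, Function.comp]
  push_cast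
  ring

theorem contDiffOn_metric {E : Type*} [NormedAddCommGroup E] [NormedSpace ℝ E] {s : Set E}
    {lam : ℝ → ℝ} (hlam : ContDiff ℝ ∞ lam) {p a b : E → E3 × ℝ} (hp : ContDiffOn ℝ ∞ p s)
    (ha : ContDiffOn ℝ ∞ a s) (hb : ContDiffOn ℝ ∞ b s) :
    ContDiffOn ℝ ∞ (fun q => metric lam (p q) (a q) (b q)) s :=
  (ha.snd.mul hb.snd).add (((hlam.comp_contDiffOn hp.snd).pow 2).mul (ha.fst.inner ℝ hb.fst))

theorem metric_comm (lam : ℝ → ℝ) (p v w : E3 × ℝ) : metric lam p v w = metric lam p w v := by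
  rw [metric, metric, real_inner_comm, mul_comm]

/-- First variation of the area of an immersion whose coordinates are orthogonal and have unit area
density. -/
theorem hasDerivAt_area {lam : ℝ → ℝ} (hlam : ContDiff ℝ ∞ lam) {U K : Set (ℝ × ℝ)}
    (hU : IsOpen U) {Φ : ℝ × ℝ → E3 × ℝ} {Ψ : ℝ → ℝ × ℝ → E3 × ℝ} (hΨ : IsVariation U K Φ Ψ)
    (hF : ∀ z ∈ U, metric lam (Φ z) (fderiv ℝ Φ z (1, 0)) (fderiv ℝ Φ z (0, 1)) = 0)
    (hEG : ∀ z ∈ U, metric lam (Φ z) (fderiv ℝ Φ z (1, 0)) (fderiv ℝ Φ z (1, 0)) *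
      metric lam (Φ z) (fderiv ℝ Φ z (0, 1)) (fderiv ℝ Φ z (0, 1)) = 1) :
    HasDerivAt (fun τ => ∫ z in K, areaDensity lam (Ψ τ) z)
      (∫ z in K,
        ((metric lam (Φ z) (fderiv ℝ Φ z (1, 0)) (fderiv ℝ (variationField Ψ) z (1, 0)) +
          lam (Φ z).2 * deriv lam (Φ z).2 * (variationField Ψ z).2 *
            inner ℝ (fderiv ℝ Φ z (1, 0)).1 (fderiv ℝ Φ z (1, 0)).1) *
          metric lam (Φ z) (fderiv ℝ Φ z (0, 1)) (fderiv ℝ Φ z (0, 1)) +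
        metric lam (Φ z) (fderiv ℝ Φ z (1, 0)) (fderiv ℝ Φ z (1, 0)) *
          (metric lam (Φ z) (fderiv ℝ Φ z (0, 1)) (fderiv ℝ (variationField Ψ) z (0, 1)) +
          lam (Φ z).2 * deriv lam (Φ z).2 * (variationField Ψ z).2 *
            inner ℝ (fderiv ℝ Φ z (0, 1)).1 (fderiv ℝ Φ z (0, 1)).1))) 0 := by
  have hO : IsOpen ((univ : Set ℝ) ×ˢ U) := isOpen_univ.prod hU
  have hs := hΨ.smooth
  set D : ℝ × ℝ → ℝ × (ℝ × ℝ) → E3 × ℝ := fun v q =>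
    fderiv ℝ (fun q : ℝ × (ℝ × ℝ) => Ψ q.1 q.2) q (0, v) with hD
  have hDs : ∀ v, ContDiffOn ℝ ∞ (D v) (univ ×ˢ U) := fun v =>
    (hs.fderiv_of_isOpen hO (by simp)).clm_apply contDiffOn_const
  have hDΨ : ∀ v τ, ∀ z ∈ U, D v (τ, z) = fderiv ℝ (Ψ τ) z v := fun v τ z hz =>
    (fderiv_slice hU hs τ hz v).symm
  -- The Gram determinant of the family. It equals `1` at `τ = 0`, so its root has derivative half
  -- of its own, and the squared mixed term contributes nothing because the coordinates start
  -- orthogonal.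
  set H : ℝ × (ℝ × ℝ) → ℝ := fun q =>
    metric lam (Ψ q.1 q.2) (D (1, 0) q) (D (1, 0) q) *
      metric lam (Ψ q.1 q.2) (D (0, 1) q) (D (0, 1) q) -
      metric lam (Ψ q.1 q.2) (D (1, 0) q) (D (0, 1) q) ^ 2 with hH
  have hHs : ContDiffOn ℝ ∞ H (univ ×ˢ U) :=
    ((contDiffOn_metric hlam hs (hDs _) (hDs _)).mul
      (contDiffOn_metric hlam hs (hDs _) (hDs _))).sub
      ((contDiffOn_metric hlam hs (hDs _) (hDs _)).pow 2)
  have h0 : ∀ z ∈ U, Ψ 0 =ᶠ[𝓝 z] Φ := fun z hz => by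
    filter_upwards [hU.mem_nhds hz] with y hy using hΨ.zero y hy
  have hD0 : ∀ v, ∀ z ∈ U, D v (0, z) = fderiv ℝ Φ z v := fun v z hz => by
    rw [hDΨ v 0 z hz, (h0 z hz).fderiv_eq]
  have hH1 : ∀ z ∈ U, H (0, z) = 1 := fun z hz => by
    simp only [hH, hD0 _ z hz, hΨ.zero z hz, hF z hz, hEG z hz]
    ring
  have key := hasDerivAt_setIntegral_sqrt hU hΨ.isCompact hΨ.subset hHs
    fun z hz => hH1 z (hΨ.subset hz)
  have e1 : (fun τ => ∫ z in K, areaDensity lam (Ψ τ) z) =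
      fun τ => ∫ z in K, Real.sqrt (H (τ, z)) := funext fun τ =>
    setIntegral_congr_fun hΨ.isCompact.measurableSet fun z hz => by
      simp only [areaDensity, hH, hDΨ _ τ z (hΨ.subset hz)]
  rw [e1]
  refine key.congr_deriv (setIntegral_congr_fun hΨ.isCompact.measurableSet fun z hz => ?_)
  have hz := hΨ.subset hz
  have h2 : HasDerivAt (fun τ => H (τ, z)) (fderiv ℝ H (0, z) (1, 0)) 0 := by
    have h3 : HasDerivAt (fun τ : ℝ => (τ, z)) (1, 0) 0 :=
      (hasDerivAt_id _).prodMk (hasDerivAt_const _ z)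
    exact ((hHs.contDiffAt (hO.mem_nhds (x := ((0 : ℝ), z)) ⟨trivial, hz⟩)).differentiableAt
      (by simp)).hasFDerivAt.comp_hasDerivAt (0 : ℝ) h3
  have hv := hasDerivAt_variation hU hs hz
  have hd : ∀ v, HasDerivAt (fun τ => D v (τ, z)) (fderiv ℝ (variationField Ψ) z v) 0 :=
    fun v => by
      have := hasDerivAt_fderiv_variation hU hs hz v
      simpa only [hDΨ v _ z hz] using this
  have hl : DifferentiableAt ℝ lam (Ψ 0 z).2 := hlam.differentiable (by simp) _
  have h4 := ((hasDerivAt_metric hl hv (hd (1, 0)) (hd (1, 0))).mul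
    (hasDerivAt_metric hl hv (hd (0, 1)) (hd (0, 1)))).sub
    ((hasDerivAt_metric hl hv (hd (1, 0)) (hd (0, 1))).fun_pow 2)
  have h5 := h2.unique h4
  simp only [hD0 _ z hz, hΨ.zero z hz, hF z hz] at h5
  simp only [h5]
  rw [metric_comm lam _ (fderiv ℝ (variationField Ψ) z (1, 0)) (fderiv ℝ Φ z (1, 0)),
    metric_comm lam _ (fderiv ℝ (variationField Ψ) z (0, 1)) (fderiv ℝ Φ z (0, 1))]
  ring

section revolution

variable {lam φ r : ℝ → ℝ} {x e₁ e₂ : E3}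

theorem isOpen_strip : IsOpen (Ioi (0 : ℝ) ×ˢ (univ : Set ℝ)) := isOpen_Ioi.prod isOpen_univ

theorem contDiffOn_fst_strip {f : ℝ → ℝ} (hf : ContDiffOn ℝ ∞ f (Ioi 0)) :
    ContDiffOn ℝ ∞ (fun z : ℝ × ℝ => f z.1) (Ioi (0 : ℝ) ×ˢ univ) :=
  hf.comp contDiffOn_fst fun _ hz => hz.1

theorem contDiffOn_revolution (hφ : ContDiffOn ℝ ∞ φ (Ioi 0)) (hr : ContDiffOn ℝ ∞ r (Ioi 0)) :
    ContDiffOn ℝ ∞ (revolution x e₁ e₂ φ r) (Ioi 0 ×ˢ univ) :=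
  ((contDiff_meridian x e₁ e₂).comp_contDiffOn
    ((contDiffOn_fst_strip hφ).prodMk contDiffOn_snd)).prodMk (contDiffOn_fst_strip hr)

theorem hasDerivAt_of_contDiffOn {f : ℝ → ℝ} (hf : ContDiffOn ℝ ∞ f (Ioi 0)) {t : ℝ} (ht : 0 < t) :
    HasDerivAt f (deriv f t) t :=
  ((hf.contDiffAt (Ioi_mem_nhds ht)).differentiableAt (by simp)).hasDerivAt

theorem hasDerivAt_meridian_comp (hφ : ContDiffOn ℝ ∞ φ (Ioi 0)) {t : ℝ} (ht : 0 < t) (θ : ℝ) :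
    HasDerivAt (fun t => meridian x e₁ e₂ (φ t) θ)
      (deriv φ t • meridian x e₁ e₂ (φ t + Real.pi / 2) θ) t :=
  (hasDerivAt_meridian_left x e₁ e₂ (φ t) θ).scomp t (hasDerivAt_of_contDiffOn hφ ht)

theorem fderiv_revolution_fst (hφ : ContDiffOn ℝ ∞ φ (Ioi 0)) (hr : ContDiffOn ℝ ∞ r (Ioi 0))
    {z : ℝ × ℝ} (hz : z ∈ Ioi (0 : ℝ) ×ˢ (univ : Set ℝ)) :
    fderiv ℝ (revolution x e₁ e₂ φ r) z (1, 0) =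
      (deriv φ z.1 • meridian x e₁ e₂ (φ z.1 + Real.pi / 2) z.2, deriv r z.1) :=
  (hasDerivAt_partial_fst (((contDiffOn_revolution hφ hr).contDiffAt
    (isOpen_strip.mem_nhds hz)).differentiableAt (by simp))).unique
    ((hasDerivAt_meridian_comp hφ hz.1 z.2).prodMk (hasDerivAt_of_contDiffOn hr hz.1))

theorem fderiv_revolution_snd (hφ : ContDiffOn ℝ ∞ φ (Ioi 0)) (hr : ContDiffOn ℝ ∞ r (Ioi 0))
    {z : ℝ × ℝ} (hz : z ∈ Ioi (0 : ℝ) ×ˢ (univ : Set ℝ)) :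
    fderiv ℝ (revolution x e₁ e₂ φ r) z (0, 1) = (Real.sin (φ z.1) • parallel e₁ e₂ z.2, 0) :=
  (hasDerivAt_partial_snd (((contDiffOn_revolution hφ hr).contDiffAt
    (isOpen_strip.mem_nhds hz)).differentiableAt (by simp))).unique
    ((hasDerivAt_meridian_right x e₁ e₂ (φ z.1) z.2).prodMk (hasDerivAt_const z.2 (r z.1)))

theorem contDiffOn_momentum_phi (hlam : ContDiff ℝ ∞ lam) (hg : IsStripGeodesic lam φ r) :
    ContDiffOn ℝ ∞ (fun s => coeffPhi lam (φ s) (r s) * deriv φ s) (Ioi 0) :=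
  (((hlam.comp_contDiffOn hg.smooth_r).pow 4).mul
    ((Real.contDiff_sin.comp_contDiffOn hg.smooth_phi).pow 2)).mul
    (hg.smooth_phi.deriv_of_isOpen isOpen_Ioi (by simp))

theorem contDiffOn_momentum_r (hlam : ContDiff ℝ ∞ lam) (hg : IsStripGeodesic lam φ r) :
    ContDiffOn ℝ ∞ (fun s => coeffR lam (φ s) (r s) * deriv r s) (Ioi 0) :=
  (((hlam.comp_contDiffOn hg.smooth_r).pow 2).mul
    ((Real.contDiff_sin.comp_contDiffOn hg.smooth_phi).pow 2)).mul
    (hg.smooth_r.deriv_of_isOpen isOpen_Ioi (by simp))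

theorem metric_revolution_fst (hφ : ContDiffOn ℝ ∞ φ (Ioi 0)) (hr : ContDiffOn ℝ ∞ r (Ioi 0))
    {z : ℝ × ℝ} (hz : z ∈ Ioi (0 : ℝ) ×ˢ (univ : Set ℝ)) (V : E3 × ℝ) :
    metric lam (revolution x e₁ e₂ φ r z) (fderiv ℝ (revolution x e₁ e₂ φ r) z (1, 0)) V =
      deriv r z.1 * V.2 + lam (r z.1) ^ 2 * deriv φ z.1 *
        inner ℝ (meridian x e₁ e₂ (φ z.1 + Real.pi / 2) z.2) V.1 := by
  rw [fderiv_revolution_fst hφ hr hz, metric, real_inner_smul_left]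
  simp only [revolution]
  ring

theorem metric_revolution_snd (hφ : ContDiffOn ℝ ∞ φ (Ioi 0)) (hr : ContDiffOn ℝ ∞ r (Ioi 0))
    {z : ℝ × ℝ} (hz : z ∈ Ioi (0 : ℝ) ×ˢ (univ : Set ℝ)) (V : E3 × ℝ) :
    metric lam (revolution x e₁ e₂ φ r z) (fderiv ℝ (revolution x e₁ e₂ φ r) z (0, 1)) V =
      lam (r z.1) ^ 2 * Real.sin (φ z.1) * inner ℝ (parallel e₁ e₂ z.2) V.1 := by
  rw [fderiv_revolution_snd hφ hr hz, metric, real_inner_smul_left]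
  simp only [revolution]
  ring

/-- The first variation density of a surface of revolution over a geodesic is a divergence. -/
theorem variation_density_eq (hlam : ContDiff ℝ ∞ lam) (hpos : ∀ ρ, 0 < lam ρ)
    (hg : IsStripGeodesic lam φ r) {V : ℝ × ℝ → E3 × ℝ} {z : ℝ × ℝ}
    (hz : z ∈ Ioi (0 : ℝ) ×ˢ (univ : Set ℝ)) (hV : DifferentiableAt ℝ V z)
    (hperp : inner ℝ (meridian x e₁ e₂ (φ z.1) z.2) (V z).1 = 0)
    {A B : ℝ} (hA : HasDerivAt (fun t => coeffR lam (φ t) (r t) * deriv r t * (V (t, z.2)).2 +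
      coeffPhi lam (φ t) (r t) * deriv φ t *
        inner ℝ (meridian x e₁ e₂ (φ t + Real.pi / 2) z.2) (V (t, z.2)).1) A z.1)
    (hB : HasDerivAt (fun θ => (Real.sin (φ z.1))⁻¹ *
      inner ℝ (parallel e₁ e₂ θ) (V (z.1, θ)).1) B z.2) :
    (deriv r z.1 * (fderiv ℝ V z (1, 0)).2 + lam (r z.1) ^ 2 * deriv φ z.1 *
        inner ℝ (meridian x e₁ e₂ (φ z.1 + Real.pi / 2) z.2) (fderiv ℝ V z (1, 0)).1 +
      lam (r z.1) * deriv lam (r z.1) * (V z).2 * deriv φ z.1 ^ 2) *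
      (lam (r z.1) ^ 2 * Real.sin (φ z.1) ^ 2) +
    (deriv r z.1 ^ 2 + lam (r z.1) ^ 2 * deriv φ z.1 ^ 2) *
      (lam (r z.1) ^ 2 * Real.sin (φ z.1) * inner ℝ (parallel e₁ e₂ z.2) (fderiv ℝ V z (0, 1)).1 +
      lam (r z.1) * deriv lam (r z.1) * (V z).2 * Real.sin (φ z.1) ^ 2) = A + B := by
  obtain ⟨t, θ⟩ := z
  have ht : 0 < t := hz.1
  have hs : 0 < Real.sin (φ t) := Real.sin_pos_of_mem_Ioo (hg.mem t ht)
  have hl := hpos (r t)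
  have hld : DifferentiableAt ℝ lam (r t) := hlam.differentiable (by simp) _
  have hφ := hasDerivAt_of_contDiffOn hg.smooth_phi ht
  have hVt := hasDerivAt_partial_fst hV
  have hVθ := hasDerivAt_partial_snd hV
  have us := hg.unit_speed t ht
  have hp : DifferentiableAt ℝ (fun s => coeffPhi lam (φ s) (r s) * deriv φ s) t := by
    exact ((contDiffOn_momentum_phi hlam hg).contDiffAt (Ioi_mem_nhds ht)).differentiableAt
      (by simp)
  have hq : DifferentiableAt ℝ (fun s => coeffR lam (φ s) (r s) * deriv r s) t := by
    exact ((contDiffOn_momentum_r hlam hg).contDiffAt (Ioi_mem_nhds ht)).differentiableAt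
      (by simp)
  have hp' := hp.hasDerivAt
  have hq' := hq.hasDerivAt
  -- The geodesic equations replace the derivatives of the two momenta; minimality of the surface
  -- rests on this substitution.
  rw [hg.eq_phi t ht, deriv_coeffPhi_left, deriv_coeffR_left] at hp'
  rw [hg.eq_r t ht, deriv_coeffPhi_right hld, deriv_coeffR_right hld] at hq'
  have hm : HasDerivAt (fun t => meridian x e₁ e₂ (φ t + Real.pi / 2) θ)
      (deriv φ t • meridian x e₁ e₂ (φ t + Real.pi / 2 + Real.pi / 2) θ) t :=
    HasDerivAt.scomp (h := fun t => φ t + Real.pi / 2) t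
      (hasDerivAt_meridian_left x e₁ e₂ (φ t + Real.pi / 2) θ) (hφ.add_const _)
  have hA' := hA.unique ((hq'.mul (hasDerivAt_snd hVt)).add
    (hp'.mul (hm.inner ℝ (hasDerivAt_fst hVt))))
  have hB' := hB.unique (((hasDerivAt_parallel e₁ e₂ θ).inner ℝ
    (hasDerivAt_fst hVθ)).const_mul (Real.sin (φ t))⁻¹)
  rw [hA', hB']
  clear hA' hB' hA hB hp' hq' hp hq hm
  simp only at hperp ⊢
  have e1 : meridian x e₁ e₂ (φ t + Real.pi / 2 + Real.pi / 2) θ = -meridian x e₁ e₂ (φ t) θ := by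
    simp only [meridian, Real.cos_add_pi_div_two, Real.sin_add_pi_div_two]
    module
  rw [e1, smul_neg, inner_neg_left, real_inner_smul_left, hperp]
  have e2 : inner ℝ (meridian x e₁ e₂ (φ t + Real.pi / 2) θ) (V (t, θ)).1 =
      -Real.sin (φ t) * inner ℝ x (V (t, θ)).1 +
        Real.cos (φ t) * inner ℝ (Real.cos θ • e₁ + Real.sin θ • e₂) (V (t, θ)).1 := by
    rw [meridian, inner_add_left, real_inner_smul_left, real_inner_smul_left,
      Real.cos_add_pi_div_two, Real.sin_add_pi_div_two]
  rw [meridian, inner_add_left, real_inner_smul_left, real_inner_smul_left] at hperp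
  rw [e2, inner_neg_left]
  simp only [coeffPhi, coeffR] at us ⊢
  generalize inner ℝ (Real.cos θ • e₁ + Real.sin θ • e₂) (V (t, θ)).1 = N at *
  generalize inner ℝ x (V (t, θ)).1 = X at *
  generalize inner ℝ (meridian x e₁ e₂ (φ t + Real.pi / 2) θ) (fderiv ℝ V (t, θ) (1, 0)).1 = Q at *
  generalize inner ℝ (parallel e₁ e₂ θ) (fderiv ℝ V (t, θ) (0, 1)).1 = T at *
  generalize (fderiv ℝ V (t, θ) (1, 0)).2 = W at *
  generalize (V (t, θ)).2 = w at *
  have hsc := Real.sin_sq_add_cos_sq (φ t)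
  generalize Real.sin (φ t) = s at *
  generalize Real.cos (φ t) = k at *
  generalize deriv φ t = a at *
  generalize deriv r t = b at *
  generalize deriv lam (r t) = L at *
  generalize lam (r t) = l at *
  -- This is unit speed. With `sin² + cos² = 1` and the tangency `hperp`, it closes the computation.
  have hsi : s⁻¹ = l ^ 2 * s * (b ^ 2 + l ^ 2 * a ^ 2) := by
    field_simp
    linear_combination -us
  rw [hsi]
  linear_combination (l ^ 2 * s ^ 2 * (b ^ 2 + l ^ 2 * a ^ 2)) * hperp -
    l ^ 2 * s * (b ^ 2 + l ^ 2 * a ^ 2) * N * hsc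

variable (hf : Frame x e₁ e₂)
include hf

theorem Frame.inner_meridian_add (φ θ : ℝ) :
    inner ℝ (meridian x e₁ e₂ (φ + Real.pi / 2) θ) (parallel e₁ e₂ θ) = 0 :=
  hf.inner_meridian_parallel _ _

theorem metric_revolution_fst_fst (hφ : ContDiffOn ℝ ∞ φ (Ioi 0)) (hr : ContDiffOn ℝ ∞ r (Ioi 0))
    {z : ℝ × ℝ} (hz : z ∈ Ioi (0 : ℝ) ×ˢ (univ : Set ℝ)) :
    metric lam (revolution x e₁ e₂ φ r z) (fderiv ℝ (revolution x e₁ e₂ φ r) z (1, 0))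
      (fderiv ℝ (revolution x e₁ e₂ φ r) z (1, 0)) =
      deriv r z.1 ^ 2 + lam (r z.1) ^ 2 * deriv φ z.1 ^ 2 := by
  rw [metric_revolution_fst hφ hr hz, fderiv_revolution_fst hφ hr hz, real_inner_smul_right,
    hf.inner_meridian]
  ring

theorem metric_revolution_snd_snd (hφ : ContDiffOn ℝ ∞ φ (Ioi 0)) (hr : ContDiffOn ℝ ∞ r (Ioi 0))
    {z : ℝ × ℝ} (hz : z ∈ Ioi (0 : ℝ) ×ˢ (univ : Set ℝ)) :
    metric lam (revolution x e₁ e₂ φ r z) (fderiv ℝ (revolution x e₁ e₂ φ r) z (0, 1))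
      (fderiv ℝ (revolution x e₁ e₂ φ r) z (0, 1)) = lam (r z.1) ^ 2 * Real.sin (φ z.1) ^ 2 := by
  rw [metric_revolution_snd hφ hr hz, fderiv_revolution_snd hφ hr hz, real_inner_smul_right,
    hf.inner_parallel]
  ring

theorem metric_revolution_fst_snd (hφ : ContDiffOn ℝ ∞ φ (Ioi 0)) (hr : ContDiffOn ℝ ∞ r (Ioi 0))
    {z : ℝ × ℝ} (hz : z ∈ Ioi (0 : ℝ) ×ˢ (univ : Set ℝ)) :
    metric lam (revolution x e₁ e₂ φ r z) (fderiv ℝ (revolution x e₁ e₂ φ r) z (1, 0))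
      (fderiv ℝ (revolution x e₁ e₂ φ r) z (0, 1)) = 0 := by
  rw [metric_revolution_fst hφ hr hz, fderiv_revolution_snd hφ hr hz, real_inner_smul_right,
    hf.inner_meridian_add]
  ring

end revolution

/-! ### Minimality of surfaces of revolution over geodesics. -/

theorem variationField_eq_zero {U K : Set (ℝ × ℝ)} (hU : IsOpen U) {Φ : ℝ × ℝ → E3 × ℝ}
    {Ψ : ℝ → ℝ × ℝ → E3 × ℝ} (hΨ : IsVariation U K Φ Ψ) {z : ℝ × ℝ} (hz : z ∈ U \ K) :
    variationField Ψ z = 0 := by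
  have h1 := hasDerivAt_variation hU hΨ.smooth hz.1
  have h2 : (fun τ => Ψ τ z) = fun _ => Φ z := funext fun τ => hΨ.fixed τ z hz
  rw [h2] at h1
  exact h1.unique (hasDerivAt_const _ _)

/-- Differentiate the constraint that the sphere component has norm `1`. -/
theorem inner_variationField {U K : Set (ℝ × ℝ)} (hU : IsOpen U) {Φ : ℝ × ℝ → E3 × ℝ}
    {Ψ : ℝ → ℝ × ℝ → E3 × ℝ} (hΨ : IsVariation U K Φ Ψ) {z : ℝ × ℝ} (hz : z ∈ U) :
    inner ℝ (Φ z).1 (variationField Ψ z).1 = 0 := by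
  have h1 := hasDerivAt_fst (hasDerivAt_variation hU hΨ.smooth hz)
  have h2 := h1.inner ℝ h1
  have h3 : (fun τ => inner ℝ (Ψ τ z).1 (Ψ τ z).1) = fun _ => (1 : ℝ) := funext fun τ => by
    have := (hΨ.mem τ z hz).1
    rw [real_inner_self_eq_norm_sq, mem_sphere_zero_iff_norm.1 this, one_pow]
  rw [h3] at h2
  have h4 := h2.unique (hasDerivAt_const _ _)
  rw [hΨ.zero z hz, real_inner_comm (Φ z).1] at h4
  linarith

variable {lam φ r : ℝ → ℝ} {x e₁ e₂ : E3}

theorem critical_revolution (hf : Frame x e₁ e₂) (hlam : ContDiff ℝ ∞ lam) (hpos : ∀ ρ, 0 < lam ρ)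
    (hg : IsStripGeodesic lam φ r) {K : Set (ℝ × ℝ)} {Ψ : ℝ → ℝ × ℝ → E3 × ℝ}
    (hΨ : IsVariation (Ioi 0 ×ˢ univ) K (revolution x e₁ e₂ φ r) Ψ) :
    HasDerivAt (fun τ => ∫ z in K, areaDensity lam (Ψ τ) z) 0 0 := by
  have hU := isOpen_strip
  have hsφ := hg.smooth_phi
  have hsr := hg.smooth_r
  have hF : ∀ z ∈ Ioi (0 : ℝ) ×ˢ (univ : Set ℝ), _ := fun z hz =>
    metric_revolution_fst_snd (lam := lam) hf hsφ hsr hz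
  have hE : ∀ z ∈ Ioi (0 : ℝ) ×ˢ (univ : Set ℝ), _ := fun z hz =>
    metric_revolution_fst_fst (lam := lam) hf hsφ hsr hz
  have hG : ∀ z ∈ Ioi (0 : ℝ) ×ˢ (univ : Set ℝ), _ := fun z hz =>
    metric_revolution_snd_snd (lam := lam) hf hsφ hsr hz
  have key := hasDerivAt_area hlam hU hΨ hF fun z hz => by
    rw [hE z hz, hG z hz, ← hg.unit_speed z.1 hz.1, coeffPhi, coeffR]
    ring
  refine key.congr_deriv ?_
  set V := variationField Ψ
  have hVs : ContDiffOn ℝ ∞ V (Ioi 0 ×ˢ univ) := contDiffOn_variationField hU hΨ.smooth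
  -- Flux across the parallels is the pairing of `V` with the geodesic momentum; flux across the
  -- meridians, `g₂`, is its component along the parallel over `sin φ`. Both vanish off `K`, so
  -- their derivatives integrate to `0`.
  set g₁ : ℝ × ℝ → ℝ := fun z => coeffR lam (φ z.1) (r z.1) * deriv r z.1 * (V z).2 +
    coeffPhi lam (φ z.1) (r z.1) * deriv φ z.1 *
      inner ℝ (meridian x e₁ e₂ (φ z.1 + Real.pi / 2) z.2) (V z).1 with hg₁
  set g₂ : ℝ × ℝ → ℝ := fun z => (Real.sin (φ z.1))⁻¹ * inner ℝ (parallel e₁ e₂ z.2) (V z).1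
    with hg₂
  have hs₁ : ContDiffOn ℝ ∞ g₁ (Ioi 0 ×ˢ univ) :=
    ((contDiffOn_fst_strip (contDiffOn_momentum_r hlam hg)).mul hVs.snd).add
      ((contDiffOn_fst_strip (contDiffOn_momentum_phi hlam hg)).mul
        (((contDiff_meridian x e₁ e₂).comp_contDiffOn
          (((contDiffOn_fst_strip hsφ).add contDiffOn_const).prodMk contDiffOn_snd)).inner ℝ
          hVs.fst))
  have hs₂ : ContDiffOn ℝ ∞ g₂ (Ioi 0 ×ˢ univ) :=
    (contDiffOn_fst_strip ((Real.contDiff_sin.comp_contDiffOn hsφ).inv fun t ht =>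
      (Real.sin_pos_of_mem_Ioo (hg.mem t ht)).ne')).mul
      (((contDiff_parallel e₁ e₂).comp_contDiffOn contDiffOn_snd).inner ℝ hVs.fst)
  have h0 : ∀ z ∈ (Ioi (0 : ℝ) ×ˢ univ) \ K, V z = 0 := fun z hz => variationField_eq_zero hU hΨ hz
  have hi : ∀ g : ℝ × ℝ → ℝ, ContDiffOn ℝ ∞ g (Ioi 0 ×ˢ univ) → ∀ v,
      IntegrableOn (fun z => fderiv ℝ g z v) K := fun g hgs v =>
    (((hgs.continuousOn_fderiv_of_isOpen hU (by simp)).clm_apply continuousOn_const).mono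
      hΨ.subset).integrableOn_compact hΨ.isCompact
  have z1 := setIntegral_fderiv_eq_zero hU hΨ.isCompact hΨ.subset (hs₁.of_le (by simp))
    (fun z hz => by simp [hg₁, h0 z hz]) (1, 0)
  have z2 := setIntegral_fderiv_eq_zero hU hΨ.isCompact hΨ.subset (hs₂.of_le (by simp))
    (fun z hz => by simp [hg₂, h0 z hz]) (0, 1)
  have z12 : ∫ z in K, (fderiv ℝ g₁ z (1, 0) + fderiv ℝ g₂ z (0, 1)) = 0 := by
    rw [integral_add (hi g₁ hs₁ _) (hi g₂ hs₂ _), z1, z2, add_zero]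
  refine Eq.trans ?_ z12
  refine setIntegral_congr_fun hΨ.isCompact.measurableSet fun z hzK => ?_
  have hz := hΨ.subset hzK
  have hd : ∀ {F : Type} [NormedAddCommGroup F] [NormedSpace ℝ F] {g : ℝ × ℝ → F},
      ContDiffOn ℝ ∞ g (Ioi 0 ×ˢ univ) → DifferentiableAt ℝ g z := fun hgs =>
    (hgs.contDiffAt (hU.mem_nhds hz)).differentiableAt (by simp)
  rw [← variation_density_eq hlam hpos hg hz (hd hVs) (inner_variationField hU hΨ hz)
    (hasDerivAt_partial_fst (hd hs₁)) (hasDerivAt_partial_snd (hd hs₂))]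
  simp only [hE z hz, hG z hz]
  rw [metric_revolution_fst hsφ hsr hz, metric_revolution_snd hsφ hsr hz,
    fderiv_revolution_fst hsφ hsr hz, fderiv_revolution_snd hsφ hsr hz]
  simp only [real_inner_smul_left, real_inner_smul_right, hf.inner_meridian, hf.inner_parallel]
  simp only [revolution, V]
  ring

theorem isMinimalImmersion_revolution (hf : Frame x e₁ e₂) (hlam : ContDiff ℝ ∞ lam)
    (hpos : ∀ ρ, 0 < lam ρ) (hg : IsStripGeodesic lam φ r) :
    IsMinimalImmersion lam (Ioi 0 ×ˢ univ) (revolution x e₁ e₂ φ r) where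
  smooth := contDiffOn_revolution hg.smooth_phi hg.smooth_r
  mem z _ := ⟨mem_sphere_zero_iff_norm.2 (hf.norm_meridian _ _), trivial⟩
  immersion z hz := by
    refine (injective_iff_map_eq_zero _).2 fun v hv => ?_
    have e : v = v.1 • (1, 0) + v.2 • (0, 1) := by ext <;> simp
    rw [e, map_add, map_smul, map_smul, fderiv_revolution_fst hg.smooth_phi hg.smooth_r hz,
      fderiv_revolution_snd hg.smooth_phi hg.smooth_r hz] at hv
    have hs := Real.sin_pos_of_mem_Ioo (hg.mem z.1 hz.1)
    have h1 := congrArg Prod.fst hv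
    have h2 := congrArg Prod.snd hv
    simp only [Prod.fst_add, Prod.smul_fst, Prod.fst_zero] at h1
    simp only [Prod.snd_add, Prod.smul_snd, Prod.snd_zero, smul_eq_mul, mul_zero, add_zero] at h2
    have h3 := congrArg (fun y => inner ℝ (parallel e₁ e₂ z.2) y) h1
    have h4 := congrArg (fun y => inner ℝ (meridian x e₁ e₂ (φ z.1 + Real.pi / 2) z.2) y) h1
    have c1 := hf.inner_meridian_add (φ z.1) z.2
    have c2 := (real_inner_comm _ _).trans c1
    simp only [inner_add_right, real_inner_smul_right, c1, c2, hf.inner_meridian,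
      hf.inner_parallel, inner_zero_right, mul_zero, add_zero, zero_add, mul_one] at h3 h4
    have hb : v.2 = 0 := by
      rcases mul_eq_zero.1 h3 with h | h
      · exact h
      · exact absurd h hs.ne'
    have ha : v.1 = 0 := by
      by_contra hne
      have r0 := (mul_eq_zero.1 h2).resolve_left hne
      have p0 := (mul_eq_zero.1 h4).resolve_left hne
      have := hg.unit_speed z.1 hz.1
      rw [r0, p0] at this
      norm_num at this
    exact Prod.ext ha hb
  critical _ _ hΨ := critical_revolution hf hlam hpos hg hΨ

/-! ### Embeddedness of the annuli. -/

variable {lam φ r : ℝ → ℝ} {e₁ e₂ : E3}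

/-- The parametrization of a surface of revolution by `(0, ∞) × S¹`. -/
noncomputable def revolutionCircle (x e₁ e₂ : E3) (φ r : ℝ → ℝ)
    (q : Ioi (0 : ℝ) × AddCircle (2 * Real.pi)) : E3 × ℝ :=
  (Real.cos (φ q.1) • x + Real.sin (φ q.1) •
    ((AddCircle.homeomorphCircle' q.2 : ℂ).re • e₁ + (AddCircle.homeomorphCircle' q.2 : ℂ).im • e₂),
    r q.1)

theorem revolutionCircle_coe (x e₁ e₂ : E3) (φ r : ℝ → ℝ) (t : Ioi (0 : ℝ)) (θ : ℝ) :
    revolutionCircle x e₁ e₂ φ r (t, (θ : AddCircle (2 * Real.pi))) =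
      revolution x e₁ e₂ φ r (t, θ) := by
  simp [revolutionCircle, revolution, meridian, AddCircle.homeomorphCircle'_apply_mk,
    Circle.coe_exp, Complex.exp_ofReal_mul_I_re, Complex.exp_ofReal_mul_I_im]

/-- The inverse is continuous because `t` is recovered from the height, and the longitude from the
components along `e₁` and `e₂` divided by `sin φ > 0`. -/
theorem isEmbedding_revolutionCircle {x : E3} (hf : Frame x e₁ e₂) (hφ : ContinuousOn φ (Ioi 0))
    (hm : ∀ t > 0, φ t ∈ Ioo 0 Real.pi) (hr : IsEmbedding fun t : Ioi (0 : ℝ) => r t) :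
    IsEmbedding (revolutionCircle x e₁ e₂ φ r) := by
  have hφ' : Continuous fun t : Ioi (0 : ℝ) => φ t := continuousOn_iff_continuous_domRestrict.1 hφ
  have hC : IsEmbedding fun a : AddCircle (2 * Real.pi) => (AddCircle.homeomorphCircle' a : ℂ) :=
    Topology.IsEmbedding.subtypeVal.comp AddCircle.homeomorphCircle'.isEmbedding
  have hc : Continuous (revolutionCircle x e₁ e₂ φ r) := by
    have h1 := hφ'.comp (continuous_fst (X := Ioi (0 : ℝ)) (Y := AddCircle (2 * Real.pi)))
    have h2 := hC.continuous.comp (continuous_snd (X := Ioi (0 : ℝ)) (Y := AddCircle (2 * Real.pi)))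
    have h3 := hr.continuous.comp (continuous_fst (X := Ioi (0 : ℝ)) (Y := AddCircle (2 * Real.pi)))
    exact (((Real.continuous_cos.comp h1).smul continuous_const).add
      ((Real.continuous_sin.comp h1).smul
        (((Complex.continuous_re.comp h2).smul continuous_const).add
          ((Complex.continuous_im.comp h2).smul continuous_const)))).prodMk h3
  refine Topology.IsInducing.isEmbedding (isInducing_iff_nhds.2 fun p => le_antisymm
    hc.continuousAt.le_comap ?_)
  set L := comap (revolutionCircle x e₁ e₂ φ r) (𝓝 (revolutionCircle x e₁ e₂ φ r p))
  have hL : Tendsto (revolutionCircle x e₁ e₂ φ r) L (𝓝 (revolutionCircle x e₁ e₂ φ r p)) :=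
    tendsto_comap
  have t1 : Tendsto Prod.fst L (𝓝 p.1) := by
    rw [hr.nhds_eq_comap, tendsto_comap_iff]
    exact (continuous_snd.tendsto _).comp hL
  have hsin : ∀ t : Ioi (0 : ℝ), Real.sin (φ t) ≠ 0 := fun t =>
    (Real.sin_pos_of_mem_Ioo (hm t t.2)).ne'
  have hw : ∀ q, (AddCircle.homeomorphCircle' q.2 : ℂ) = ((Real.sin (φ q.1))⁻¹ : ℝ) •
      (((inner ℝ e₁ (revolutionCircle x e₁ e₂ φ r q).1 : ℝ) : ℂ) +
        ((inner ℝ e₂ (revolutionCircle x e₁ e₂ φ r q).1 : ℝ) : ℂ) * Complex.I) := fun q => by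
    have := hsin q.1
    simp only [revolutionCircle, inner_add_right, real_inner_smul_right, hf.ax, hf.aa, hf.ab,
      hf.bx, hf.bb, hf.ba]
    generalize Real.sin (φ q.1) = s at this ⊢
    apply Complex.ext <;> simp <;> field_simp
  have t2 : Tendsto Prod.snd L (𝓝 p.2) := by
    rw [hC.nhds_eq_comap, tendsto_comap_iff]
    have h1 : Tendsto (fun q : Ioi (0 : ℝ) × AddCircle (2 * Real.pi) => (Real.sin (φ q.1))⁻¹) L
        (𝓝 (Real.sin (φ p.1))⁻¹) :=
      (((Real.continuous_sin.comp hφ').tendsto p.1).comp t1).inv₀ (hsin p.1)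
    have h2 : Continuous fun y : E3 × ℝ => ((inner ℝ e₁ y.1 : ℝ) : ℂ) +
        ((inner ℝ e₂ y.1 : ℝ) : ℂ) * Complex.I := by fun_prop
    have h3 := h1.smul ((h2.tendsto _).comp hL)
    refine (h3.congr fun q => (hw q).symm).trans_eq ?_
    rw [hw p]
  rw [nhds_prod_eq]
  exact t1.prodMk t2

theorem range_revolutionCircle {x : S2} (hf : Frame x e₁ e₂) {σ : ℝ → ℝ × ℝ}
    (hm : ∀ t > 0, (σ t).1 ∈ Ioo 0 Real.pi) :
    range (revolutionCircle x e₁ e₂ (fun t => (σ t).1) (fun t => (σ t).2)) = preimage x σ := by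
  have hx : ‖(x : E3)‖ = 1 := mem_sphere_zero_iff_norm.1 x.2
  ext p
  constructor
  · rintro ⟨⟨t, a⟩, rfl⟩
    obtain ⟨θ, rfl⟩ := QuotientAddGroup.mk_surjective a
    have := revolutionCircle_coe x e₁ e₂ (fun t => (σ t).1) (fun t => (σ t).2) t θ
    rw [show ((QuotientAddGroup.mk θ : ℝ ⧸ AddSubgroup.zmultiples (2 * Real.pi))) =
      (θ : AddCircle (2 * Real.pi)) from rfl, this]
    refine ⟨⟨mem_sphere_zero_iff_norm.2 (hf.norm_meridian _ _), trivial⟩, t, t.2, ?_⟩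
    refine Prod.ext ?_ rfl
    have h := hm t t.2
    simp only [revolution, InnerProductGeometry.angle, hx, hf.norm_meridian, hf.inner_x_meridian,
      mul_one, div_one]
    exact (Real.arccos_cos h.1.le h.2.le).symm
  · rintro ⟨hp, t, ht, h⟩
    have hy : ‖p.1‖ = 1 := mem_sphere_zero_iff_norm.1 hp.1
    have hs := Real.sin_pos_of_mem_Ioo (hm t ht)
    have h1 : Real.cos (σ t).1 = inner ℝ (x : E3) p.1 := by
      rw [h, InnerProductGeometry.cos_angle, hx, hy, mul_one, div_one]
    have h2 : inner ℝ e₁ p.1 ^ 2 + inner ℝ e₂ p.1 ^ 2 = Real.sin (σ t).1 ^ 2 := by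
      have h3 : inner ℝ p.1 p.1 = (1 : ℝ) := by rw [real_inner_self_eq_norm_sq, hy, one_pow]
      have h4 := congrArg (fun y => inner ℝ y p.1) (hf.repr p.1)
      simp only [inner_add_left, real_inner_smul_left, h3, ← h1] at h4
      linear_combination -h4 - Real.sin_sq_add_cos_sq (σ t).1
    have hn : ‖(⟨inner ℝ e₁ p.1 / Real.sin (σ t).1, inner ℝ e₂ p.1 / Real.sin (σ t).1⟩ : ℂ)‖ = 1 := by
      rw [← pow_eq_one_iff_of_nonneg (norm_nonneg _) two_ne_zero, Complex.sq_norm,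
        Complex.normSq_apply]
      field_simp
      linarith
    obtain ⟨W, hW⟩ : ∃ W : Circle, (W : ℂ) =
        ⟨inner ℝ e₁ p.1 / Real.sin (σ t).1, inner ℝ e₂ p.1 / Real.sin (σ t).1⟩ :=
      ⟨⟨_, mem_sphere_zero_iff_norm.2 hn⟩, rfl⟩
    refine ⟨(⟨t, ht⟩, AddCircle.homeomorphCircle'.symm W), Prod.ext ?_ (congrArg Prod.snd h :)⟩
    simp only [revolutionCircle, Homeomorph.apply_symm_apply, h1, hW]
    conv_rhs => rw [hf.repr p.1]
    simp only [smul_add, smul_smul, mul_div_cancel₀ _ hs.ne', add_assoc]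

theorem isMinimalAnnulus_preimage (hlam : ContDiff ℝ ∞ lam) (hpos : ∀ ρ, 0 < lam ρ) (x : S2)
    {σ : ℝ → ℝ × ℝ} (hg : IsStripGeodesic lam (fun t => (σ t).1) (fun t => (σ t).2))
    (hr : IsEmbedding fun t : Ioi (0 : ℝ) => (σ t).2) :
    IsMinimalAnnulus lam (preimage x σ) := by
  obtain ⟨e₁, e₂, hf⟩ := exists_frame x
  exact ⟨_, _, isMinimalImmersion_revolution hf hlam hpos hg,
    isEmbedding_revolutionCircle hf hg.smooth_phi.continuousOn hg.mem hr,
    range_revolutionCircle hf hg.mem, fun t θ => revolutionCircle_coe _ _ _ _ _ t θ⟩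

theorem isEmbedding_profile {l : ℝ → ℝ} (c : Collar l) {e : ℝ} (he : e ≠ 0) (θ₀ : ℝ) :
    IsEmbedding fun t : Ioi (0 : ℝ) => (c.profile e θ₀ t).2 := by
  have h1 : StrictMono fun t : Ioi (0 : ℝ) => -(c.arc θ₀ t).2.1 := fun s t hst =>
    neg_lt_neg (c.strictAntiOn_arc_r θ₀ (mem_Ici.2 (le_of_lt s.2)) (mem_Ici.2 (le_of_lt t.2)) hst)
  have h2 : Continuous fun t : Ioi (0 : ℝ) => -(c.arc θ₀ t).2.1 :=
    ((c.continuous_arc_right θ₀).comp continuous_subtype_val).snd.fst.neg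
  have : PreconnectedSpace (Ioi (0 : ℝ)) := Subtype.preconnectedSpace isPreconnected_Ioi
  have h3 := h1.isEmbedding_of_ordConnected (isPreconnected_range h2).ordConnected
  convert (Homeomorph.mulLeft₀ (-e) (neg_ne_zero.2 he)).isEmbedding.comp h3 using 2 with t
  simp [Collar.profile]

/-! ### Strict stability of the central sphere. -/

section stability

variable {lam : ℝ → ℝ}

/-- The area density of a graph with height `τ u` and squared gradient `τ² k`. -/
noncomputable def graphDensity (lam : ℝ → ℝ) (u k τ : ℝ) : ℝ :=
  lam (τ * u) * Real.sqrt (lam (τ * u) ^ 2 + τ ^ 2 * k)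

/-- The first derivative of `graphDensity` in `τ`. -/
noncomputable def graphDensity₁ (lam : ℝ → ℝ) (u k τ : ℝ) : ℝ :=
  deriv lam (τ * u) * u * Real.sqrt (lam (τ * u) ^ 2 + τ ^ 2 * k) +
    lam (τ * u) * (lam (τ * u) * (deriv lam (τ * u) * u) + τ * k) *
      (Real.sqrt (lam (τ * u) ^ 2 + τ ^ 2 * k))⁻¹

/-- The second derivative of `graphDensity` in `τ`. -/
noncomputable def graphDensity₂ (lam : ℝ → ℝ) (u k τ : ℝ) : ℝ :=
  deriv (deriv lam) (τ * u) * u * u * Real.sqrt (lam (τ * u) ^ 2 + τ ^ 2 * k) +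
    (2 * (deriv lam (τ * u) * u) * (lam (τ * u) * (deriv lam (τ * u) * u) + τ * k) +
      lam (τ * u) * ((deriv lam (τ * u) * u) ^ 2 +
        lam (τ * u) * (deriv (deriv lam) (τ * u) * u * u) + k)) *
      (Real.sqrt (lam (τ * u) ^ 2 + τ ^ 2 * k))⁻¹ -
    lam (τ * u) * (lam (τ * u) * (deriv lam (τ * u) * u) + τ * k) ^ 2 *
      ((Real.sqrt (lam (τ * u) ^ 2 + τ ^ 2 * k))⁻¹) ^ 3

variable (hlam : ContDiff ℝ ∞ lam) (hpos : ∀ ρ, 0 < lam ρ)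
include hpos

theorem graph_radicand_pos {k : ℝ} (hk : 0 ≤ k) (u τ : ℝ) : 0 < lam (τ * u) ^ 2 + τ ^ 2 * k := by
  have := hpos (τ * u)
  positivity

include hlam

theorem hasDerivAt_graphDensity {k : ℝ} (hk : 0 ≤ k) (u τ : ℝ) :
    HasDerivAt (graphDensity lam u k) (graphDensity₁ lam u k τ) τ := by
  have hQ := graph_radicand_pos hpos hk u τ
  have hR := Real.sqrt_pos.2 hQ
  have h1 : HasDerivAt (fun τ => lam (τ * u)) (deriv lam (τ * u) * u) τ :=
    HasDerivAt.comp (h₂ := lam) τ (hlam.differentiable (by simp) _).hasDerivAt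
      (by simpa using (hasDerivAt_id τ).mul_const u)
  have h2 := (((h1.fun_pow 2).add (((hasDerivAt_id τ).fun_pow 2).mul_const k)).sqrt hQ.ne')
  refine (h1.mul h2).congr_deriv ?_
  simp only [graphDensity₁, id, Pi.add_apply] at *
  field_simp
  push_cast
  ring

theorem hasDerivAt_graphDensity₁ {k : ℝ} (hk : 0 ≤ k) (u τ : ℝ) :
    HasDerivAt (graphDensity₁ lam u k) (graphDensity₂ lam u k τ) τ := by
  have hQ := graph_radicand_pos hpos hk u τ
  have hR := Real.sqrt_pos.2 hQ
  have hid : HasDerivAt (fun τ => τ * u) u τ := by simpa using (hasDerivAt_id τ).mul_const u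
  have h1 : HasDerivAt (fun τ => lam (τ * u)) (deriv lam (τ * u) * u) τ :=
    HasDerivAt.comp (h₂ := lam) τ (hlam.differentiable (by simp) _).hasDerivAt hid
  have h1' : HasDerivAt (fun τ => deriv lam (τ * u)) (deriv (deriv lam) (τ * u) * u) τ :=
    HasDerivAt.comp (h₂ := deriv lam) τ
      (((contDiff_infty_iff_deriv.1 hlam).2).differentiable (by simp) _).hasDerivAt hid
  have h2 : HasDerivAt (fun τ => Real.sqrt (lam (τ * u) ^ 2 + τ ^ 2 * k)) _ τ :=
    (((h1.fun_pow 2).add (((hasDerivAt_id τ).fun_pow 2).mul_const k)).sqrt hQ.ne')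
  have h3 := h1'.mul_const u
  have h4 := (h3.mul h2).add ((h1.mul ((h1.mul h3).add ((hasDerivAt_id τ).mul_const k))).mul
    (h2.inv hR.ne'))
  refine h4.congr_deriv ?_
  simp only [graphDensity₂, id, Pi.add_apply, Pi.mul_apply, Pi.inv_apply] at *
  have hs : Real.sqrt (lam (τ * u) ^ 2 + τ ^ 2 * k) ^ 2 = lam (τ * u) ^ 2 + τ ^ 2 * k :=
    Real.sq_sqrt hQ.le
  generalize Real.sqrt (lam (τ * u) ^ 2 + τ ^ 2 * k) = s at *
  generalize lam (τ * u) = l at *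
  generalize deriv lam (τ * u) = d at *
  generalize deriv (deriv lam) (τ * u) = D at *
  field_simp
  push_cast
  ring

theorem continuous_graph {u k : S2 → ℝ} (hu : Continuous u) (hk : Continuous k)
    (hk0 : ∀ y, 0 ≤ k y) :
    Continuous (fun q : ℝ × S2 => graphDensity lam (u q.2) (k q.2) q.1) ∧
    Continuous (fun q : ℝ × S2 => graphDensity₁ lam (u q.2) (k q.2) q.1) ∧
    Continuous (fun q : ℝ × S2 => graphDensity₂ lam (u q.2) (k q.2) q.1) := by
  have c0 := hlam.continuous
  have d1 := (contDiff_infty_iff_deriv.1 hlam).2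
  have c1 := d1.continuous
  have c2 := (contDiff_infty_iff_deriv.1 d1).2.continuous
  have hR : Continuous fun q : ℝ × S2 =>
      (Real.sqrt (lam (q.1 * u q.2) ^ 2 + q.1 ^ 2 * k q.2))⁻¹ :=
    Continuous.inv₀ (by fun_prop) fun q =>
      (Real.sqrt_pos.2 (graph_radicand_pos hpos (hk0 q.2) (u q.2) q.1)).ne'
  unfold graphDensity graphDensity₁ graphDensity₂
  exact ⟨by fun_prop, by fun_prop, by fun_prop⟩

/-- At the critical height the second variation is the integral of `2 λ(0) λ''(0) u² + k`, where `k`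
is the squared tangential gradient of `u`, nonnegative by Cauchy–Schwarz; so `c = 2 λ(0) λ''(0)`
works. -/
theorem isStrictlyStableMinimalSphere (h1 : deriv lam 0 = 0) (h2 : 0 < iteratedDeriv 2 lam 0) :
    IsStrictlyStableMinimalSphere lam := by
  have hdd : iteratedDeriv 2 lam 0 = deriv (deriv lam) 0 := by
    rw [iteratedDeriv_succ, iteratedDeriv_one]
  rw [hdd] at h2
  have main : ∀ u : E3 → ℝ, ContDiff ℝ ∞ u → ∃ k : S2 → ℝ, Continuous k ∧ (∀ y, 0 ≤ k y) ∧
      HasDerivAt (graphArea lam u) 0 0 ∧ iteratedDeriv 2 (graphArea lam u) 0 =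
        ∫ y : S2, (2 * lam 0 * deriv (deriv lam) 0 * u y ^ 2 + k y)
          ∂((volume : Measure E3).toSphere) := by
    intro u hu
    set k : S2 → ℝ := fun y =>
      ‖gradient u (y : E3)‖ ^ 2 - inner ℝ (gradient u (y : E3)) (y : E3) ^ 2 with hk
    have hgrad : Continuous (gradient u) :=
      (InnerProductSpace.toDual ℝ E3).symm.continuous.comp (hu.continuous_fderiv (by simp))
    have hkc : Continuous k := by
      have := hgrad.comp (continuous_subtype_val (p := fun y : E3 => y ∈ Metric.sphere (0 : E3) 1))
      exact (this.norm.pow 2).sub ((this.inner continuous_subtype_val).pow 2)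
    have hk0 : ∀ y, 0 ≤ k y := fun y => by
      have h := abs_real_inner_le_norm (gradient u (y : E3)) (y : E3)
      rw [mem_sphere_zero_iff_norm.1 y.2, mul_one] at h
      have := sq_le_sq' (neg_le_of_abs_le h) (le_of_abs_le h)
      simp only [hk]
      linarith
    have huc : Continuous fun y : S2 => u y := hu.continuous.comp continuous_subtype_val
    obtain ⟨g0, g1, g2⟩ := continuous_graph hlam hpos huc hkc hk0
    have hA : ∀ τ ∈ Ioo (-1 : ℝ) 1, HasDerivAt (graphArea lam u)
        (∫ y : S2, graphDensity₁ lam (u y) (k y) τ ∂((volume : Measure E3).toSphere)) τ := by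
      intro τ hτ
      have := hasDerivAt_setIntegral_of_isCompact (μ := (volume : Measure E3).toSphere)
        (K := univ) isCompact_univ MeasurableSet.univ
        (F := fun τ y => graphDensity lam (u y) (k y) τ)
        (F' := fun τ y => graphDensity₁ lam (u y) (k y) τ) hτ
        (fun τ _ => (g0.comp (by fun_prop : Continuous fun y : S2 => (τ, y))).continuousOn)
        g1.continuousOn (fun τ _ y _ => hasDerivAt_graphDensity hlam hpos (hk0 y) (u y) τ)
      simp only [Measure.restrict_univ] at this
      exact this
    have hB : HasDerivAt
        (fun τ => ∫ y : S2, graphDensity₁ lam (u y) (k y) τ ∂((volume : Measure E3).toSphere))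
        (∫ y : S2, graphDensity₂ lam (u y) (k y) 0 ∂((volume : Measure E3).toSphere)) 0 := by
      have := hasDerivAt_setIntegral_of_isCompact (μ := (volume : Measure E3).toSphere)
        (K := univ) isCompact_univ MeasurableSet.univ
        (F := fun τ y => graphDensity₁ lam (u y) (k y) τ)
        (F' := fun τ y => graphDensity₂ lam (u y) (k y) τ) (δ := 1) (τ₀ := 0)
        ⟨by norm_num, by norm_num⟩
        (fun τ _ => (g1.comp (by fun_prop : Continuous fun y : S2 => (τ, y))).continuousOn)
        g2.continuousOn (fun τ _ y _ => hasDerivAt_graphDensity₁ hlam hpos (hk0 y) (u y) τ)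
      simp only [Measure.restrict_univ] at this
      exact this
    have hl0 := hpos 0
    refine ⟨k, hkc, hk0, (hA 0 ⟨by norm_num, by norm_num⟩).congr_deriv ?_, ?_⟩
    · simp [graphDensity₁, h1]
    · have he : deriv (graphArea lam u) =ᶠ[𝓝 0] fun τ =>
          ∫ y : S2, graphDensity₁ lam (u y) (k y) τ ∂((volume : Measure E3).toSphere) := by
        filter_upwards [Ioo_mem_nhds (by norm_num : (-1 : ℝ) < 0) (by norm_num : (0 : ℝ) < 1)]
          with τ hτ using (hA τ hτ).deriv
      rw [iteratedDeriv_succ, iteratedDeriv_one, he.deriv_eq, hB.deriv]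
      congr 1 with y
      simp only [graphDensity₂, zero_mul, h1, zero_pow two_ne_zero, add_zero, mul_zero, zero_add,
        Real.sqrt_sq hl0.le]
      field_simp
      ring
  refine ⟨fun u hu => ?_, 2 * lam 0 * deriv (deriv lam) 0, ?_, fun u hu => ?_⟩
  · obtain ⟨k, -, -, h, -⟩ := main u hu
    exact h
  · have := hpos 0
    positivity
  · obtain ⟨k, hkc, hk0, -, h⟩ := main u hu
    rw [h, ← integral_const_mul]
    have huc : Continuous fun y : S2 => u y := hu.continuous.comp continuous_subtype_val
    have hi : ∀ f : S2 → ℝ, Continuous f → Integrable f ((volume : Measure E3).toSphere) :=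
      fun f hf => hf.integrable_of_hasCompactSupport (HasCompactSupport.of_compactSpace f)
    exact integral_mono (hi _ (by fun_prop)) (hi _ (by fun_prop)) fun y =>
      le_add_of_nonneg_right (hk0 y)

end stability

/-! ### The circle of annuli for each center. -/

/-- The preimage of a curve in the interior of the strip determines the curve's image. -/
theorem image_eq_of_preimage_eq {x : S2} {σ τ : ℝ → ℝ × ℝ} (hσ : ∀ t > 0, (σ t).1 ∈ Ioo 0 Real.pi)
    (h : preimage x σ = preimage x τ) : σ '' Ioi 0 ⊆ τ '' Ioi 0 := by
  rintro _ ⟨t, ht, rfl⟩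
  obtain ⟨e₁, e₂, hf⟩ := exists_frame x
  have hx : ‖(x : E3)‖ = 1 := mem_sphere_zero_iff_norm.1 x.2
  have hm := hσ t ht
  have ha : InnerProductGeometry.angle (x : E3) (meridian x e₁ e₂ (σ t).1 0) = (σ t).1 := by
    rw [InnerProductGeometry.angle, hx, hf.norm_meridian, hf.inner_x_meridian, mul_one, div_one,
      Real.arccos_cos hm.1.le hm.2.le]
  have hp : (meridian x e₁ e₂ (σ t).1 0, (σ t).2) ∈ preimage x σ :=
    ⟨⟨mem_sphere_zero_iff_norm.2 (hf.norm_meridian _ _), trivial⟩, t, ht, by rw [ha]⟩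
  rw [h] at hp
  simpa only [ha] using hp.2

namespace Collar

/-- Dependence of the profile curve on its initial angle, in the `C¹` topology on compact sets. -/
theorem continuous_profile_uniformOnFun {l : ℝ → ℝ} (c : Collar l) (e : ℝ) :
    Continuous fun θ₀ : ℝ => UniformOnFun.ofFun {K : Set (Ioi (0 : ℝ)) | IsCompact K}
      (fun t : Ioi (0 : ℝ) => (c.profile e θ₀ t, deriv (c.profile e θ₀) t)) := by
  have h1 : Continuous fun q : ℝ × Ioi (0 : ℝ) =>
      (c.profile e q.1 q.2, deriv (c.profile e q.1) q.2) := by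
    have h2 : (fun q : ℝ × Ioi (0 : ℝ) => deriv (c.profile e q.1) q.2) =
        fun q => c.velocity e q.1 q.2 := funext fun q => (c.hasDerivAt_profile e q.1 q.2.2).deriv
    have h3 : Continuous fun q : ℝ × Ioi (0 : ℝ) => (q.1, (q.2 : ℝ)) := by fun_prop
    have h4 : Continuous fun q : ℝ × Ioi (0 : ℝ) => deriv (c.profile e q.1) q.2 := by
      rw [h2]
      exact ContinuousOn.comp_continuous (g := fun q : ℝ × ℝ => c.velocity e q.1 q.2)
        (f := fun q : ℝ × Ioi (0 : ℝ) => (q.1, (q.2 : ℝ))) (c.continuousOn_velocity e) h3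
        fun q => ⟨trivial, q.2.2⟩
    exact (Continuous.comp (g := fun q : ℝ × ℝ => c.profile e q.1 q.2)
      (f := fun q : ℝ × Ioi (0 : ℝ) => (q.1, (q.2 : ℝ))) (c.continuous_profile e) h3).prodMk h4
  -- A jointly continuous map curries to a continuous map for the compact-open topology, which here
  -- is uniform convergence on compact sets.
  exact ContinuousMap.isUniformEmbedding_toUniformOnFunIsCompact.uniformContinuous.continuous.comp
    (ContinuousMap.curry ⟨_, h1⟩).continuous

variable {lam : ℝ → ℝ} {e : ℝ} (c : Collar fun ρ => lam (e * ρ))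

/-- The generator of a spiraling annulus given by its center and its initial direction. -/
noncomputable def generator (hlam : ContDiff ℝ ∞ lam) (hpos : ∀ r, 0 < lam r)
    (he : e = 1 ∨ e = -1) (q : S2 × Circle) : Generator lam e c.ε :=
  ⟨(q.1, c.profile e (Complex.arg q.2)), isSpiralingGeodesic_profile he c _,
    isMinimalAnnulus_preimage hlam hpos q.1 (isSpiralingGeodesic_profile he c _).geodesic
      (isEmbedding_profile c (by rcases he with rfl | rfl <;> norm_num) _)⟩

/-- `Complex.arg` jumps at `-1`, but the profile is `2π`-periodic in its angle, so continuity
descends along the quotient map `Circle.exp`. -/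
theorem continuous_generator (hlam : ContDiff ℝ ∞ lam) (hpos : ∀ r, 0 < lam r)
    (he : e = 1 ∨ e = -1) : Continuous (c.generator hlam hpos he) := by
  refine continuous_induced_rng.2 (continuous_fst.prodMk ?_)
  have h : Continuous fun s : Circle =>
      UniformOnFun.ofFun {K : Set (Ioi (0 : ℝ)) | IsCompact K} (fun t : Ioi (0 : ℝ) =>
        (c.profile e (Complex.arg s) t, deriv (c.profile e (Complex.arg s)) t)) := by
    rw [Circle.isAddQuotientCoveringMap_exp.toIsQuotientMap.continuous_iff]
    refine (c.continuous_profile_uniformOnFun e).congr fun θ => ?_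
    obtain ⟨n, hn⟩ := Circle.exp_eq_exp.1 (Circle.exp_arg (Circle.exp θ))
    have hp : c.profile e (Complex.arg (Circle.exp θ)) = c.profile e θ := by
      rw [hn]
      exact (c.profile_periodic e).int_mul n θ
    simp only [Function.comp, hp]
  exact h.comp continuous_snd

theorem exists_family (hlam : ContDiff ℝ ∞ lam) (hpos : ∀ r, 0 < lam r) (he : e = 1 ∨ e = -1) :
    ∃ F : S2 × Circle → SpiralingAnnulus lam e c.ε, Continuous F ∧
      (∀ x s, ∃ q : Generator lam e c.ε, q.1.1 = x ∧ F (x, s) = q.annulus) ∧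
      ∀ x, Function.Injective (fun s => F (x, s)) := by
  have hq : Continuous (Generator.annulus : Generator lam e c.ε → SpiralingAnnulus lam e c.ε) :=
    continuous_coinduced_rng
  refine ⟨fun q => (c.generator hlam hpos he q).annulus,
    hq.comp (c.continuous_generator hlam hpos he),
    fun x s => ⟨c.generator hlam hpos he (x, s), rfl, rfl⟩, fun x s t hst => ?_⟩
  have h1 : preimage x (c.profile e (Complex.arg s)) = preimage x (c.profile e (Complex.arg t)) :=
    congrArg Subtype.val hst
  have hm : ∀ θ₀, ∀ u > 0, (c.profile e θ₀ u).1 ∈ Ioo 0 Real.pi := fun θ₀ =>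
    (isSpiralingGeodesic_profile he c θ₀).geodesic.mem
  have h2 := (image_eq_of_preimage_eq (hm _) h1).antisymm (image_eq_of_preimage_eq (hm _) h1.symm)
  obtain ⟨hc, hs⟩ := c.cos_sin_eq_of_image_eq (by rcases he with rfl | rfl <;> norm_num) h2
  rw [← Circle.exp_arg s, ← Circle.exp_arg t]
  ext
  rw [Circle.coe_exp, Circle.coe_exp, Complex.exp_mul_I, Complex.exp_mul_I, ← Complex.ofReal_cos,
    ← Complex.ofReal_sin, ← Complex.ofReal_cos, ← Complex.ofReal_sin, hc, hs]

end Collar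

/-- Sufficiently thin one-sided collars. -/
theorem exists_side_collar {lam : ℝ → ℝ} (hlam : ContDiff ℝ ∞ lam) (hpos : ∀ r, 0 < lam r)
    (h1 : deriv lam 0 = 0) (h2 : 0 < iteratedDeriv 2 lam 0) {e : ℝ} (he : e = 1 ∨ e = -1) :
    ∃ ε₀ > 0, ∀ ε, 0 < ε → ε ≤ ε₀ → ∃ c : Collar fun ρ => lam (e * ρ), c.ε = ε := by
  have hc : ContDiff ℝ ∞ fun ρ => lam (e * ρ) := hlam.comp (contDiff_const.mul contDiff_id)
  refine exists_collar hc (fun _ => hpos _) ?_ ?_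
  · have := iteratedDeriv_comp_const_mul (n := 1) (hlam.of_le (by simp)) e
    rw [iteratedDeriv_one, iteratedDeriv_one] at this
    simp [this, h1]
  · rw [iteratedDeriv_comp_const_mul (n := 2) (hlam.of_le (WithTop.coe_le_coe.2 le_top)) e]
    rcases he with rfl | rfl <;> simpa using h2

end Warped

theorem mainTheorem9 (lam : ℝ → ℝ) (hlam : ContDiff ℝ ∞ lam) (hpos : ∀ r, 0 < lam r)
    (h1 : deriv lam 0 = 0) (h2 : 0 < iteratedDeriv 2 lam 0) :
    Warped.IsStrictlyStableMinimalSphere lam ∧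
    ∃ ε > 0, ∀ e : ℝ, e = 1 ∨ e = -1 →
      ∃ F : Warped.S2 × Circle → Warped.SpiralingAnnulus lam e ε,
        Continuous F ∧
        (∀ x s, ∃ q : Warped.Generator lam e ε, q.1.1 = x ∧ F (x, s) = q.annulus) ∧
        ∀ x, Function.Injective (fun s => F (x, s)) := by
  refine ⟨Warped.isStrictlyStableMinimalSphere hlam hpos h1 h2, ?_⟩
  obtain ⟨ε₁, hε₁, hc₁⟩ := Warped.exists_side_collar hlam hpos h1 h2 (Or.inl rfl)
  obtain ⟨ε₂, hε₂, hc₂⟩ := Warped.exists_side_collar hlam hpos h1 h2 (Or.inr rfl)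
  -- One width serves both sides, because every thinner collar is admissible as well.
  have hε : 0 < min ε₁ ε₂ := lt_min hε₁ hε₂
  refine ⟨min ε₁ ε₂, hε, fun e he => ?_⟩
  obtain ⟨c, hc⟩ : ∃ c : Warped.Collar fun ρ => lam (e * ρ), c.ε = min ε₁ ε₂ := by
    rcases he with rfl | rfl
    · exact hc₁ _ hε (min_le_left _ _)
    · exact hc₂ _ hε (min_le_right _ _)
  rw [← hc]
  exact c.exists_family hlam hpos he
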